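/- Let $r>0$ and, for an integer $n\ge 2$, let $P_n\subset\mathbb{C}$ be the solid regular $2n$-gon of circumradius $r$. Let $S_n$ be the quotient of $P_n$ obtained by identifying each pair of opposite sides by the translation that carries one to the other, and suppose that all vertices of $P_n$ are identified to a single point $p\in S_n$. A *flat chart* of $S_n$ is a homeomorphism from an open subset of $S_n$ to an open subset of $\mathbb{C}$ which, composed with the projection $P_n\to S_n$, is locally a translation; a *cone point* is a point of $S_n$ that lies in the domain of no flat chart. For $u\in\mathbb{C}\setminus\{0\}$, a *complete straight line of direction $u$* is the image of a continuous map $\gamma$ from a closed interval (bounded, a half line, or $\mathbb{R}$) of positive length to $S_n$ which in flat charts has the form $t\mapsto a+tu$ at each interior parameter, and which sends the endpoints of the interval, if there are any, to cone points. Given a family of subsets (leaves) of a surface, a point is *regular* if it has an open neighbourhood, homeomorphic to an open rectangle, in which each point lies on exactly one leaf and in which the connected components of each leaf are exactly the horizontal slices that it meets; otherwise it is *singular*. Then $S_n$ is a compact connected orientable surface without boundary, whose genus $g$, determined by $V-E+F=2-2g$ for the cell structure coming from $P_n$, satisfies $g\ge 1$; its only cone point is $p$ if $g>1$, and it has no cone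 point if $g=1$. For every direction $u\ne 0$ the complete straight lines of direction $u$ cover $S_n$ and are the leaves of a foliation in the following sense: if $g>1$, the point $p$ is the one and only singular point, and at least two distinct leaves intersect at $p$; if $g=1$, there is no singular point. Moreover every genus $g\ge 1$ occurs: for $n=2g$ all vertices of $P_n$ are identified and $V-E+F=2-2g$. -/

import Mathlib

open Set Filter Topology
open scoped Complex ContDiff

noncomputable section

namespace PolygonSurface

/-- The `k`-th vertex (indices are read modulo `2n`) of the regular `2n`-gon of circumradius `r`. -/
def vertex (n : ℕ) (r : ℝ) (k : ℕ) : ℂ :=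
  (r : ℂ) * Complex.exp (Real.pi * k / n * Complex.I)

/-- The solid regular `2n`-gon of circumradius `r`, centred at the origin of the plane `ℂ`. -/
def polygon (n : ℕ) (r : ℝ) : Set ℂ :=
  convexHull ℝ (range (vertex n r))

/-- The `k`-th side of the polygon. The side opposite to it is the one of index `k + n`. -/
def side (n : ℕ) (r : ℝ) (k : ℕ) : Set ℂ :=
  segment ℝ (vertex n r k) (vertex n r (k + 1))

/-- The identification of opposite sides: a point `z` of the side `k` is glued to its image under
the translation that carries the side `k` to the opposite side `k + n`; it sends the vertex `k` to
the vertex `k + n + 1` and the vertex `k + 1` to the vertex `k + n`. -/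
def Glue (n : ℕ) (r : ℝ) (z w : polygon n r) : Prop :=
  ∃ k : ℕ, (z : ℂ) ∈ side n r k ∧ (w : ℂ) = z + (vertex n r (k + n + 1) - vertex n r k)

/-- The surface obtained from the regular `2n`-gon by identifying opposite sides by translations,
with the quotient topology (the quotient is by the equivalence relation generated by `Glue`). -/
abbrev Surface (n : ℕ) (r : ℝ) : Type :=
  Quot (Glue n r)

/-- The projection of the polygon to the surface. -/
def proj (n : ℕ) (r : ℝ) (z : polygon n r) : Surface n r :=
  Quot.mk (Glue n r) z

/-- The point of the surface represented by the `k`-th vertex of the polygon. -/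
def vertexPoint (n : ℕ) (r : ℝ) (k : ℕ) : Surface n r :=
  proj n r ⟨vertex n r k, subset_convexHull ℝ _ (mem_range_self k)⟩

/-- The image of the `k`-th side in the surface. -/
def edge (n : ℕ) (r : ℝ) (k : ℕ) : Set (Surface n r) :=
  proj n r '' {z | (z : ℂ) ∈ side n r k}

/-- All vertices of the polygon are identified to one point. -/
def OneVertex (n : ℕ) (r : ℝ) : Prop :=
  ∀ k : ℕ, vertexPoint n r k = vertexPoint n r 0

/-- Euler characteristic of the cell structure induced by the polygon: number of vertices
minus number of edges plus one face. -/
def eulerChar (n : ℕ) (r : ℝ) : ℤ :=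
  (range (vertexPoint n r)).ncard - (range (edge n r)).ncard + 1

/-- A compact connected orientable surface without boundary: a compact connected Hausdorff space
with a smooth atlas modelled on the plane whose transition maps have positive Jacobian. -/
structure IsClosedOrientableSurface (S : Type*) [TopologicalSpace S] : Prop where
  t2 : T2Space S
  compact : CompactSpace S
  connected : ConnectedSpace S
  oriented_atlas : ∃ A : Set (OpenPartialHomeomorph S ℂ),
    (∀ x : S, ∃ φ ∈ A, x ∈ φ.source) ∧
    ∀ φ ∈ A, ∀ ψ ∈ A,
      ContDiffOn ℝ ∞ (ψ ∘ φ.symm) (φ.symm.trans ψ).source ∧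
      ∀ z ∈ (φ.symm.trans ψ).source, 0 < (fderiv ℝ (ψ ∘ φ.symm) z).det

/-- The charts of the flat structure: charts of the surface which, read in the polygon, are
translations near every point of the polygon that represents a point of their domain. -/
def IsFlatChart (n : ℕ) (r : ℝ) (φ : OpenPartialHomeomorph (Surface n r) ℂ) : Prop :=
  ∀ z : polygon n r, proj n r z ∈ φ.source →
    ∃ c : ℂ, ∀ᶠ w : polygon n r in 𝓝 z, φ (proj n r w) = (w : ℂ) + c

/-- The points at which the piecewise Euclidean structure is singular: those without a flat chart. -/
def conePoints (n : ℕ) (r : ℝ) : Set (Surface n r) :=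
  {x | ¬ ∃ φ, IsFlatChart n r φ ∧ x ∈ φ.source}

/-- On the open set `I` of parameters, `γ` is a straight line with velocity `u`. -/
def IsStraightOn (n : ℕ) (r : ℝ) (u : ℂ) (γ : ℝ → Surface n r) (I : Set ℝ) : Prop :=
  ∀ t ∈ I, ∃ φ, IsFlatChart n r φ ∧ γ t ∈ φ.source ∧
    ∀ᶠ s in 𝓝 t, γ s ∈ φ.source ∧ φ (γ s) = φ (γ t) + ((s - t : ℝ) : ℂ) * u

/-- A complete straight line of direction `u`, as a subset of the surface: it is parametrized by
a closed interval `closure I` with nonempty interior `I` (possibly a half line or the whole line),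
it is straight on `I`, and it can end only at a cone point. -/
def IsLine (n : ℕ) (r : ℝ) (u : ℂ) (L : Set (Surface n r)) : Prop :=
  ∃ (I : Set ℝ) (γ : ℝ → Surface n r), IsOpen I ∧ I.Nonempty ∧ I.OrdConnected ∧
    IsStraightOn n r u γ I ∧ ContinuousOn γ (closure I) ∧
    (∀ t ∈ frontier I, γ t ∈ conePoints n r) ∧ L = γ '' closure I

/-- The family of all complete straight lines of direction `u` in the surface. -/
def lines (n : ℕ) (r : ℝ) (u : ℂ) : Set (Set (Surface n r)) :=
  {L | IsLine n r u L}

/-- The point `x` is a regular point of the family `F` of leaves on a surface: it has a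
neighbourhood, mapped by a chart to an open rectangle, in which every point lies on exactly one
leaf and in which the connected components of each leaf are the horizontal slices. -/
def IsRegularPoint {S : Type*} [TopologicalSpace S] (F : Set (Set S)) (x : S) : Prop :=
  ∃ φ : OpenPartialHomeomorph S ℂ, x ∈ φ.source ∧
    (∃ a b c d : ℝ, φ.target = Ioo a b ×ℂ Ioo c d) ∧
    (∀ y ∈ φ.source, ∃! L, L ∈ F ∧ y ∈ L) ∧
    ∀ L ∈ F, ∀ y ∈ L ∩ φ.source,
      connectedComponentIn (L ∩ φ.source) y = {z ∈ φ.source | (φ z).im = (φ y).im}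

/-- The singular points of a family of leaves. -/
def singularPoints {S : Type*} [TopologicalSpace S] (F : Set (Set S)) : Set S :=
  {x | ¬ IsRegularPoint F x}

end PolygonSurface

end

noncomputable section

namespace PolygonSurface

/-! ### Straight curves and complete straight lines -/

section Foliation

variable {n : ℕ} {r : ℝ} {u : ℂ}

/-! Combinatorics. Crossing side `k` carries corner `k` to corner `k + n + 1` and corner `k + 1` to
corner `k + n`. For odd `n` both shifts are even, so the parity of a corner survives in the quotient
(`even_of_oneVertex`); for even `n`, `(n + 1)² ≡ 1` modulo `2n` and all corners are identified
(`oneVertex_of_even`). So a single vertex forces `n = 2g`, and `V - E + F = 1 - n + 1 = 2 - 2g`.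

Local geometry. Points other than the vertex `p` have flat charts, made of a disc inside the polygon
or of two half discs at opposite sides. At `p` meet `2n` corners of angle `π(n-1)/n`, in total
`2π(n-1)`. Cut the plane at the origin into `2n` sectors of angle `π/n`: the map `ζ ↦ ζ^(n-1)` opens
each sector onto a corner, and neighbouring sectors fit along glued sides (`discPieces_wedgeMap`).
This gives a chart at `p`, flat for `n = 2`; in general its transitions to flat charts are
holomorphic with nonzero derivative, which gives the orientation. If `n ≥ 4`, every direction `u`
points into the polygon from two different corners (`exists_two_corners`), so two disjoint rays of
direction `u` leave `p`, which no flat chart allows.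

Foliation. Flat charts differ by translations, so a straight curve of direction `u` is determined by
one of its points. All straight curves through a point glue to a maximal one. At a finite end its
cluster points must be cone points, since otherwise it could be prolonged; compactness and the
uniqueness of the cone point then give a limit (`exists_isCompleteCurve`). Thus exactly one line
passes through each point that is not a cone point. In a flat chart turned by `u⁻¹` the lines are
horizontal, and each line meets only countably many heights, so its components are single slices
(`isRegularPoint_lines`). If `g > 1`, the two rays leaving `p` lie on different lines
(`exists_lines_ne_of_rays`), and so `p` is singular. -/

theorem continuous_proj (n : ℕ) (r : ℝ) : Continuous (proj n r) := continuous_quot_mk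

theorem proj_surjective (n : ℕ) (r : ℝ) : Function.Surjective (proj n r) := Quot.mk_surjective

theorem isClosedMap_proj [CompactSpace (polygon n r)] [T2Space (Surface n r)] :
    IsClosedMap (proj n r) :=
  (continuous_proj n r).isClosedMap

/-- Near each polygon point over `y` both charts are translations, and their difference is the
constant read off at `y`, whichever representative is used. As `proj` is closed, what holds near the
whole fibre of `y` holds near `y`. -/
theorem IsFlatChart.sub_eventuallyEq [CompactSpace (polygon n r)] [T2Space (Surface n r)]
    {φ ψ : OpenPartialHomeomorph (Surface n r) ℂ} (hφ : IsFlatChart n r φ)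
    (hψ : IsFlatChart n r ψ) {y : Surface n r} (hy : y ∈ φ.source) (hy' : y ∈ ψ.source) :
    ∀ᶠ q in 𝓝 y, ψ q = φ q + (ψ y - φ y) := by
  refine (isClosedMap_proj (n := n) (r := r)).eventually_nhds_fiber
    (p := fun w => ψ (proj n r w) = φ (proj n r w) + (ψ y - φ y)) y ?_ |>.mono ?_
  · rintro z rfl
    obtain ⟨c, hc⟩ := hφ z hy
    obtain ⟨d, hd⟩ := hψ z hy'
    have hc0 := hc.self_of_nhds
    have hd0 := hd.self_of_nhds
    filter_upwards [hc, hd] with w hw hw'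
    rw [hw, hw', hc0, hd0]; ring
  · intro q hq
    obtain ⟨z, rfl⟩ := proj_surjective n r q
    exact hq z rfl

theorem IsFlatChart.not_mem_conePoints {φ : OpenPartialHomeomorph (Surface n r) ℂ}
    (hφ : IsFlatChart n r φ) {x : Surface n r} (hx : x ∈ φ.source) : x ∉ conePoints n r :=
  fun h => h ⟨φ, hφ, hx⟩

theorem IsStraightOn.mono {γ : ℝ → Surface n r} {I J : Set ℝ} (h : IsStraightOn n r u γ I)
    (hJ : J ⊆ I) : IsStraightOn n r u γ J := fun t ht => h t (hJ ht)

theorem IsStraightOn.not_mem_conePoints {γ : ℝ → Surface n r} {I : Set ℝ}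
    (h : IsStraightOn n r u γ I) {t : ℝ} (ht : t ∈ I) : γ t ∉ conePoints n r := by
  obtain ⟨φ, hφ, hx, -⟩ := h t ht
  exact hφ.not_mem_conePoints hx

theorem IsStraightOn.continuousAt {γ : ℝ → Surface n r} {I : Set ℝ}
    (h : IsStraightOn n r u γ I) {t : ℝ} (ht : t ∈ I) : ContinuousAt γ t := by
  obtain ⟨φ, hφ, hx, hev⟩ := h t ht
  have h1 : ContinuousAt (fun s : ℝ => φ.symm (φ (γ t) + ((s - t : ℝ) : ℂ) * u)) t := by
    refine ContinuousAt.comp (g := φ.symm) ?_ (by fun_prop)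
    simpa using φ.continuousAt_symm (φ.map_source hx)
  refine h1.congr ?_
  filter_upwards [hev] with s hs
  rw [← hs.2, φ.left_inv hs.1]

/-- Straightness is defined by one flat chart at each parameter; since flat charts differ locally by
translations, any other one serves as well. -/
theorem IsStraightOn.eventually_chart [CompactSpace (polygon n r)] [T2Space (Surface n r)]
    {γ : ℝ → Surface n r} {I : Set ℝ} (h : IsStraightOn n r u γ I) {t : ℝ} (ht : t ∈ I)
    {φ : OpenPartialHomeomorph (Surface n r) ℂ} (hφ : IsFlatChart n r φ) (hx : γ t ∈ φ.source) :
    ∀ᶠ s in 𝓝 t, γ s ∈ φ.source ∧ φ (γ s) = φ (γ t) + ((s - t : ℝ) : ℂ) * u := by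
  obtain ⟨ψ, hψ, hx', hev⟩ := h t ht
  have hc := h.continuousAt ht
  filter_upwards [hev, hc.eventually (hψ.sub_eventuallyEq hφ hx' hx),
    hc.eventually (φ.open_source.mem_nhds hx)] with s h1 h2 h3
  refine ⟨h3, ?_⟩
  rw [h2, h1.2]; ring

/-- Agreement is an open condition by the equation in a common flat chart, disagreement is open
because the surface is Hausdorff, and `J` is connected. -/
theorem IsStraightOn.eqOn [CompactSpace (polygon n r)] [T2Space (Surface n r)]
    {γ δ : ℝ → Surface n r} {J : Set ℝ} (hJ : J.OrdConnected) (hJo : IsOpen J)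
    (h : IsStraightOn n r u γ J) (h' : IsStraightOn n r u δ J) {t₀ : ℝ} (ht₀ : t₀ ∈ J)
    (h0 : γ t₀ = δ t₀) : EqOn γ δ J := by
  have hopen : IsOpen (J ∩ {t | γ t = δ t}) := by
    rw [isOpen_iff_mem_nhds]
    rintro t ⟨htJ, ht⟩
    obtain ⟨φ, hφ, hx, hev⟩ := h t htJ
    have hev' := h'.eventually_chart htJ hφ (ht ▸ hx)
    filter_upwards [hev, hev', hJo.mem_nhds htJ] with s h1 h2 h3
    refine ⟨h3, φ.injOn h1.1 h2.1 ?_⟩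
    rw [h1.2, h2.2, ht]
  have hopen' : IsOpen (J ∩ {t | γ t ≠ δ t}) := by
    rw [isOpen_iff_mem_nhds]
    rintro t ⟨htJ, ht⟩
    filter_upwards [((h.continuousAt htJ).prodMk (h'.continuousAt htJ)).eventually
      (isClosed_diagonal.isOpen_compl.mem_nhds ht), hJo.mem_nhds htJ] with s h1 h2
    exact ⟨h2, h1⟩
  intro t ht
  by_contra hne
  obtain ⟨s, -, h1, h2⟩ := hJ.isPreconnected _ _ hopen hopen'
    (fun s hs => (em (γ s = δ s)).imp (fun h => ⟨hs, h⟩) (fun h => ⟨hs, h⟩))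
    ⟨t₀, ht₀, ht₀, h0⟩ ⟨t, ht, ht, hne⟩
  exact h2.2 h1.2

theorem IsStraightOn.congr {γ δ : ℝ → Surface n r} {I : Set ℝ} (hI : IsOpen I)
    (h : IsStraightOn n r u γ I) (he : EqOn γ δ I) : IsStraightOn n r u δ I := by
  intro t ht
  obtain ⟨φ, hφ, hx, hev⟩ := h t ht
  refine ⟨φ, hφ, he ht ▸ hx, ?_⟩
  filter_upwards [hev, hI.mem_nhds ht] with s hs hsI
  rw [← he hsI, ← he ht]
  exact hs

theorem IsStraightOn.union {γ : ℝ → Surface n r} {I J : Set ℝ}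
    (h : IsStraightOn n r u γ I) (h' : IsStraightOn n r u γ J) :
    IsStraightOn n r u γ (I ∪ J) := fun t ht => ht.elim (h t) (h' t)

theorem IsStraightOn.shift {γ : ℝ → Surface n r} {I : Set ℝ} (h : IsStraightOn n r u γ I)
    (c : ℝ) : IsStraightOn n r u (fun t => γ (t + c)) ((fun t => t + c) ⁻¹' I) := by
  intro t ht
  obtain ⟨φ, hφ, hx, hev⟩ := h (t + c) ht
  refine ⟨φ, hφ, hx, ?_⟩
  have : Tendsto (fun s : ℝ => s + c) (𝓝 t) (𝓝 (t + c)) := by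
    exact (continuous_add_const c).tendsto t
  filter_upwards [this.eventually hev] with s hs
  simpa using hs

theorem IsFlatChart.isStraightOn_symm {φ : OpenPartialHomeomorph (Surface n r) ℂ}
    (hφ : IsFlatChart n r φ) (a : ℂ) (t₀ : ℝ) (u : ℂ) :
    IsStraightOn n r u (fun s => φ.symm (a + ((s - t₀ : ℝ) : ℂ) * u))
      {s | a + ((s - t₀ : ℝ) : ℂ) * u ∈ φ.target} := by
  intro t ht
  refine ⟨φ, hφ, φ.map_target ht, ?_⟩
  have hc : Continuous fun s : ℝ => a + ((s - t₀ : ℝ) : ℂ) * u := by fun_prop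
  filter_upwards [(φ.open_target.preimage hc).mem_nhds ht] with s hs
  refine ⟨φ.map_target hs, ?_⟩
  rw [φ.right_inv hs, φ.right_inv ht]
  push_cast; ring

/-- Parametrized complete straight lines. -/
structure IsCompleteCurve (n : ℕ) (r : ℝ) (u : ℂ) (I : Set ℝ) (γ : ℝ → Surface n r) : Prop where
  isOpen : IsOpen I
  ordConnected : I.OrdConnected
  straight : IsStraightOn n r u γ I
  continuousOn : ContinuousOn γ (closure I)
  frontier : ∀ t ∈ frontier I, γ t ∈ conePoints n r

theorem IsCompleteCurve.mem_lines {I : Set ℝ} {γ : ℝ → Surface n r}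
    (h : IsCompleteCurve n r u I γ) (hI : I.Nonempty) : γ '' closure I ∈ lines n r u :=
  ⟨I, γ, h.isOpen, hI, h.ordConnected, h.straight, h.continuousOn, h.frontier, rfl⟩

theorem exists_isCompleteCurve_of_mem_lines {L : Set (Surface n r)} (hL : L ∈ lines n r u) :
    ∃ I γ, IsCompleteCurve n r u I γ ∧ I.Nonempty ∧ L = γ '' closure I := by
  obtain ⟨I, γ, h1, h2, h3, h4, h5, h6, h7⟩ := hL
  exact ⟨I, γ, ⟨h1, h3, h4, h5, h6⟩, h2, h7⟩

theorem IsCompleteCurve.mem_of_closure {I : Set ℝ} {γ : ℝ → Surface n r}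
    (h : IsCompleteCurve n r u I γ) {t : ℝ} (ht : t ∈ closure I)
    (hc : γ t ∉ conePoints n r) : t ∈ I := by
  by_contra hI
  exact hc (h.frontier t (by rw [h.isOpen.frontier_eq]; exact ⟨ht, hI⟩))

theorem IsCompleteCurve.shift {I : Set ℝ} {γ : ℝ → Surface n r}
    (h : IsCompleteCurve n r u I γ) (c : ℝ) :
    IsCompleteCurve n r u ((fun t => t + c) ⁻¹' I) (fun t => γ (t + c)) := by
  have hcl : closure ((fun t => t + c) ⁻¹' I) = (fun t => t + c) ⁻¹' closure I :=
    ((Homeomorph.addRight c).preimage_closure I).symm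
  have hfr : _root_.frontier ((fun t => t + c) ⁻¹' I) = (fun t => t + c) ⁻¹' _root_.frontier I :=
    ((Homeomorph.addRight c).preimage_frontier I).symm
  refine ⟨h.isOpen.preimage (continuous_add_const c), ?_, h.straight.shift c, ?_, ?_⟩
  · exact h.ordConnected.preimage_mono (fun a b hab => by simpa using hab)
  · rw [hcl]
    exact h.continuousOn.comp (continuous_add_const c).continuousOn (fun t ht => ht)
  · rw [hfr]
    exact fun t ht => h.frontier _ ht

theorem shift_image_closure (I : Set ℝ) (γ : ℝ → Surface n r) (c : ℝ) :
    (fun t => γ (t + c)) '' closure ((fun t => t + c) ⁻¹' I) = γ '' closure I := by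
  have hcl : closure ((fun t => t + c) ⁻¹' I) = (fun t => t + c) ⁻¹' closure I :=
    ((Homeomorph.addRight c).preimage_closure I).symm
  rw [hcl]
  ext x
  constructor
  · rintro ⟨t, ht, rfl⟩
    exact ⟨t + c, ht, rfl⟩
  · rintro ⟨t, ht, rfl⟩
    exact ⟨t - c, by simpa using ht, by simp⟩

/-! ### Maximality and uniqueness of complete lines -/

variable [CompactSpace (polygon n r)] [T2Space (Surface n r)]

/-- A complete straight line contains every straight curve that meets it. -/
theorem IsCompleteCurve.subset_and_eqOn {I J : Set ℝ} {γ δ : ℝ → Surface n r}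
    (h : IsCompleteCurve n r u I γ) (hJ : IsOpen J) (hJc : J.OrdConnected)
    (hδ : IsStraightOn n r u δ J) {t₀ : ℝ} (ht : t₀ ∈ I) (ht' : t₀ ∈ J) (h0 : γ t₀ = δ t₀) :
    J ⊆ I ∧ EqOn γ δ J := by
  have heq : EqOn γ δ (I ∩ J) := IsStraightOn.eqOn (h.ordConnected.inter hJc)
    (h.isOpen.inter hJ) (h.straight.mono inter_subset_left) (hδ.mono inter_subset_right)
    ⟨ht, ht'⟩ h0
  have hsub : J ⊆ I := by
    -- The connected set `J` cannot leave `I`: at a frontier point of `I` inside `J`, the curve `γ`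
    -- is at a cone point, yet by continuity it equals `δ` there, which has a flat chart.
    refine (hJc.isPreconnected).subset_left_of_subset_union h.isOpen isClosed_closure.isOpen_compl
      (disjoint_compl_right.mono_left subset_closure) ?_ ⟨t₀, ht', ht⟩
    intro t htJ
    by_cases hcl : t ∈ closure I
    · left
      by_contra hI
      have hcone := h.frontier t (by rw [h.isOpen.frontier_eq]; exact ⟨hcl, hI⟩)
      have hmem : t ∈ closure (I ∩ J) := by
        rw [inter_comm]
        exact hJ.inter_closure ⟨htJ, hcl⟩
      have : (𝓝[I ∩ J] t).NeBot := mem_closure_iff_nhdsWithin_neBot.1 hmem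
      have h1 : Tendsto γ (𝓝[I ∩ J] t) (𝓝 (γ t)) :=
        (h.continuousOn t hcl).mono (inter_subset_left.trans subset_closure)
      have h2 : Tendsto δ (𝓝[I ∩ J] t) (𝓝 (δ t)) :=
        (hδ.continuousAt htJ).mono_left nhdsWithin_le_nhds
      have h3 := tendsto_nhds_unique (h1.congr' (eventually_nhdsWithin_of_forall heq)) h2
      exact hδ.not_mem_conePoints htJ (h3 ▸ hcone)
    · exact Or.inr hcl
  exact ⟨hsub, fun t htJ => heq ⟨hsub htJ, htJ⟩⟩

theorem IsCompleteCurve.eq_of_eq {I J : Set ℝ} {γ δ : ℝ → Surface n r}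
    (h : IsCompleteCurve n r u I γ) (h' : IsCompleteCurve n r u J δ) {t₀ : ℝ} (ht : t₀ ∈ I)
    (ht' : t₀ ∈ J) (h0 : γ t₀ = δ t₀) : I = J ∧ EqOn γ δ (closure I) := by
  obtain ⟨h1, h2⟩ := h.subset_and_eqOn h'.isOpen h'.ordConnected h'.straight ht ht' h0
  obtain ⟨h3, -⟩ := h'.subset_and_eqOn h.isOpen h.ordConnected h.straight ht' ht h0.symm
  have hIJ : I = J := h3.antisymm h1
  subst hIJ
  refine ⟨rfl, ?_⟩
  exact EqOn.of_subset_closure h2 h.continuousOn h'.continuousOn subset_closure subset_rfl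

/-- Two complete straight lines of the same direction through a point that is not a cone point
coincide. -/
theorem lines_eq_of_mem {L L' : Set (Surface n r)} (hL : L ∈ lines n r u)
    (hL' : L' ∈ lines n r u) {y : Surface n r} (hy : y ∉ conePoints n r) (h : y ∈ L)
    (h' : y ∈ L') : L = L' := by
  obtain ⟨I, γ, hγ, -, rfl⟩ := exists_isCompleteCurve_of_mem_lines hL
  obtain ⟨J, δ, hδ, -, rfl⟩ := exists_isCompleteCurve_of_mem_lines hL'
  obtain ⟨t, ht, rfl⟩ := h
  obtain ⟨s, hs, hst⟩ := h'
  have htI := hγ.mem_of_closure ht hy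
  have hsJ := hδ.mem_of_closure hs (hst ▸ hy)
  -- After this shift both curves pass through the common point at the same parameter `t`.
  obtain ⟨h1, h2⟩ := hγ.eq_of_eq (hδ.shift (s - t)) htI (by simpa using hsJ) (by simp [hst])
  rw [← shift_image_closure J δ (s - t), ← h1]
  exact h2.image_eq

/-- The heights at which a straight curve meets a flat chart form a countable set. -/
theorem IsStraightOn.countable_heights {γ : ℝ → Surface n r} {I : Set ℝ}
    (h : IsStraightOn n r u γ I) (hu : u ≠ 0) {φ : OpenPartialHomeomorph (Surface n r) ℂ}
    (hφ : IsFlatChart n r φ) :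
    ((fun z => (u⁻¹ * φ z).im) '' (γ '' I ∩ φ.source)).Countable := by
  let T : Set ℝ := {t ∈ I | γ t ∈ φ.source}
  have hev : ∀ t ∈ T, ∀ᶠ s in 𝓝 t, (u⁻¹ * φ (γ s)).im = (u⁻¹ * φ (γ t)).im := by
    intro t ht
    filter_upwards [h.eventually_chart ht.1 hφ ht.2] with s hs
    have : u⁻¹ * φ (γ s) = u⁻¹ * φ (γ t) + ((s - t : ℝ) : ℂ) := by
      rw [hs.2]; field_simp
    rw [this, Complex.add_im, Complex.ofReal_im, add_zero]
  -- The height is locally constant along the curve, and by the Lindelöf property countably many of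
  -- the neighbourhoods on which it is constant cover `T`.
  obtain ⟨t, htT, htc, hcov⟩ := TopologicalSpace.countable_cover_nhdsWithin
    (s := T) (f := fun t => {s | (u⁻¹ * φ (γ s)).im = (u⁻¹ * φ (γ t)).im})
    (fun t ht => mem_nhdsWithin_of_mem_nhds (hev t ht))
  refine (htc.image fun t => (u⁻¹ * φ (γ t)).im).mono ?_
  rintro _ ⟨_, ⟨⟨s, hs, rfl⟩, hsφ⟩, rfl⟩
  obtain ⟨a, ha, hsa⟩ := mem_iUnion₂.1 (hcov ⟨hs, hsφ⟩)
  exact ⟨a, ha, hsa.symm⟩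

theorem exists_rectangle_subset {U : Set ℂ} (hU : IsOpen U) {z : ℂ} (hz : z ∈ U) :
    ∃ a b c d : ℝ, z ∈ Ioo a b ×ℂ Ioo c d ∧ Ioo a b ×ℂ Ioo c d ⊆ U := by
  obtain ⟨ε, hε, hb⟩ := Metric.isOpen_iff.1 hU z hz
  refine ⟨z.re - ε / 2, z.re + ε / 2, z.im - ε / 2, z.im + ε / 2, ?_, ?_⟩
  · simp [Complex.mem_reProdIm, hε]
  · intro w hw
    rw [Complex.mem_reProdIm, mem_Ioo, mem_Ioo] at hw
    refine hb ?_
    rw [Metric.mem_ball, dist_eq_norm]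
    refine (Complex.norm_le_abs_re_add_abs_im _).trans_lt ?_
    have h1 : |(w - z).re| < ε / 2 := abs_lt.2 ⟨by simp; linarith, by simp; linarith⟩
    have h2 : |(w - z).im| < ε / 2 := abs_lt.2 ⟨by simp; linarith, by simp; linarith⟩
    linarith

/-! ### Existence of lines, regular points, and rays from a cone point -/

section Existence

variable [CompactSpace (Surface n r)]

/-- Through every point that is not a cone point there is a complete straight line. -/
theorem exists_isCompleteCurve (hsub : (conePoints n r).Subsingleton) {x : Surface n r}
    (hx : x ∉ conePoints n r) (hu : u ≠ 0) :
    ∃ I γ, IsCompleteCurve n r u I γ ∧ (0 : ℝ) ∈ I ∧ γ 0 = x := by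
  classical
  -- All straight curves that are at `x` at time `0`. Any two agree where both are defined, so they
  -- glue to a maximal one on the union `I` of their domains.
  let F : Set (Set ℝ × (ℝ → Surface n r)) := {A | IsOpen A.1 ∧ A.1.OrdConnected ∧ (0 : ℝ) ∈ A.1 ∧
    IsStraightOn n r u A.2 A.1 ∧ A.2 0 = x}
  have hagree : ∀ A ∈ F, ∀ B ∈ F, EqOn A.2 B.2 (A.1 ∩ B.1) := by
    rintro A ⟨hA1, hA2, hA3, hA4, hA5⟩ B ⟨hB1, hB2, hB3, hB4, hB5⟩
    exact IsStraightOn.eqOn (hA2.inter hB2) (hA1.inter hB1) (hA4.mono inter_subset_left)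
      (hB4.mono inter_subset_right) ⟨hA3, hB3⟩ (hA5.trans hB5.symm)
  let I : Set ℝ := ⋃ A ∈ F, A.1
  have hsubI : ∀ A ∈ F, A.1 ⊆ I := fun A hA => subset_biUnion_of_mem (u := Prod.fst) hA
  have hIo : IsOpen I := isOpen_biUnion fun A hA => hA.1
  have hch : ∀ t ∈ I, ∃ A ∈ F, t ∈ A.1 := fun t ht => by simpa [I] using ht
  have : Nonempty (Surface n r) := ⟨x⟩
  choose! A hAF hAt using hch
  -- The value given to the curve outside `I`: the cone point, if there is one, so that the curve
  -- extends continuously to its ends. The fallback `x` is harmless: an end of `I` produces a cone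
  -- point.
  let p : Surface n r := if h : (conePoints n r).Nonempty then h.some else x
  let γ : ℝ → Surface n r := fun t => if t ∈ I then (A t).2 t else p
  have hγ : ∀ B ∈ F, EqOn B.2 γ B.1 := by
    intro B hB t ht
    have htI := hsubI B hB ht
    simp only [γ, htI, if_true]
    exact hagree B hB (A t) (hAF t htI) ⟨ht, hAt t htI⟩
  have hstr : IsStraightOn n r u γ I := by
    intro t ht
    exact (hAF t ht).2.2.2.1.congr (hAF t ht).1 (hγ _ (hAF t ht)) t (hAt t ht)
  obtain ⟨φ, hφ, hxφ⟩ : ∃ φ, IsFlatChart n r φ ∧ x ∈ φ.source := by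
    simpa [conePoints] using hx
  have hball : ∀ (ψ : OpenPartialHomeomorph (Surface n r) ℂ) (hψ : IsFlatChart n r ψ) (a : ℂ)
      (t₀ ε : ℝ), Metric.ball a ε ⊆ ψ.target →
      IsStraightOn n r u (fun s => ψ.symm (a + ((s - t₀ : ℝ) : ℂ) * u))
        (Metric.ball t₀ (ε / ‖u‖)) := by
    intro ψ hψ a t₀ ε hε
    refine (hψ.isStraightOn_symm a t₀ u).mono fun s hs => hε ?_
    rw [Metric.mem_ball, Real.dist_eq, lt_div_iff₀ (norm_pos_iff.2 hu)] at hs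
    rw [Metric.mem_ball, dist_eq_norm]
    simpa [-Complex.ofReal_sub] using hs
  have hord : ∀ t₀ ε : ℝ, (Metric.ball t₀ ε).OrdConnected := fun t₀ ε => by
    rw [Real.ball_eq_Ioo]; exact ordConnected_Ioo
  have h0 : (0 : ℝ) ∈ I := by
    obtain ⟨ε, hε, hb⟩ := Metric.isOpen_iff.1 φ.open_target _ (φ.map_source hxφ)
    have hpos : 0 < ε / ‖u‖ := div_pos hε (norm_pos_iff.2 hu)
    refine hsubI (Metric.ball 0 (ε / ‖u‖), _) ⟨Metric.isOpen_ball, hord _ _,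
      Metric.mem_ball_self hpos, hball φ hφ _ 0 ε hb, ?_⟩ (Metric.mem_ball_self hpos)
    simp [φ.left_inv hxφ]
  have hIc : I.OrdConnected := by
    rw [← isPreconnected_iff_ordConnected]
    refine isPreconnected_of_forall 0 fun t ht => ⟨(A t).1, hsubI _ (hAF t ht), (hAF t ht).2.2.1,
      hAt t ht, (hAF t ht).2.1.isPreconnected⟩
  have hγ0 : γ 0 = x := by
    rw [← hγ _ (hAF 0 h0) (hAt 0 h0)]; exact (hAF 0 h0).2.2.2.2
  -- A cluster point at an end that had a flat chart would allow the curve to be continued past `b`,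
  -- against the maximality of `I`.
  have hcl : ∀ b ∈ closure I, b ∉ I → ∀ q, MapClusterPt q (𝓝[I] b) γ → q ∈ conePoints n r := by
    intro b hb hbI q hq
    by_contra hqc
    obtain ⟨ψ, hψ, hqψ⟩ : ∃ ψ, IsFlatChart n r ψ ∧ q ∈ ψ.source := by
      simpa [conePoints] using hqc
    obtain ⟨ε, hε, hb'⟩ := Metric.isOpen_iff.1 ψ.open_target _ (ψ.map_source hqψ)
    have hV : ψ.source ∩ ψ ⁻¹' Metric.ball (ψ q) (ε / 2) ∈ 𝓝 q :=
      (ψ.isOpen_inter_preimage Metric.isOpen_ball).mem_nhds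
        ⟨hqψ, Metric.mem_ball_self (half_pos hε)⟩
    have hpos : 0 < ε / 2 / ‖u‖ := div_pos (half_pos hε) (norm_pos_iff.2 hu)
    -- With `γ t` within `ε / 2` of `q` in the chart, the disc of radius `ε / 2` around it stays in
    -- the target, and the segment in that disc lasts for the time `ε / 2 / ‖u‖` on either side of
    -- `t`, enough to reach `b`.
    obtain ⟨t, ⟨ht1, ht2⟩, htI, ht3⟩ := ((hq.frequently hV).and_eventually
      ((eventually_mem_nhdsWithin).and
        (nhdsWithin_le_nhds (Metric.ball_mem_nhds b hpos)))).exists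
    have hsubb : Metric.ball (ψ (γ t)) (ε / 2) ⊆ ψ.target := by
      refine Subset.trans (Metric.ball_subset_ball' ?_) hb'
      have := Metric.mem_ball.1 ht2
      linarith
    set δ : ℝ → Surface n r := fun s => ψ.symm (ψ (γ t) + ((s - t : ℝ) : ℂ) * u) with hδ
    have hδs : IsStraightOn n r u δ (Metric.ball t (ε / 2 / ‖u‖)) := hball ψ hψ _ t _ hsubb
    have htt : t ∈ Metric.ball t (ε / 2 / ‖u‖) := Metric.mem_ball_self hpos
    have hδt : γ t = δ t := by simp [δ, ψ.left_inv ht1]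
    have heq : EqOn γ δ (I ∩ Metric.ball t (ε / 2 / ‖u‖)) :=
      IsStraightOn.eqOn (hIc.inter (hord _ _)) (hIo.inter Metric.isOpen_ball)
        (hstr.mono inter_subset_left) (hδs.mono inter_subset_right) ⟨htI, htt⟩ hδt
    let η : ℝ → Surface n r := fun s => if s ∈ I then γ s else δ s
    have hη1 : EqOn γ η I := fun s hs => by simp [η, hs]
    have hη2 : EqOn δ η (Metric.ball t (ε / 2 / ‖u‖)) := fun s hs => by
      by_cases hsI : s ∈ I
      · simp [η, hsI, heq ⟨hsI, hs⟩]
      · simp [η, hsI]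
    refine hbI (hsubI (I ∪ Metric.ball t (ε / 2 / ‖u‖), η) ⟨hIo.union Metric.isOpen_ball, ?_,
      Or.inl h0, (hstr.congr hIo hη1).union (hδs.congr Metric.isOpen_ball hη2), ?_⟩ (Or.inr ?_))
    · rw [← isPreconnected_iff_ordConnected]
      exact hIc.isPreconnected.union t htI htt (hord _ _).isPreconnected
    · exact (hη1 h0).symm.trans hγ0
    · rwa [Metric.mem_ball_comm]
  have hend : ∀ b ∈ closure I, b ∉ I → p ∈ conePoints n r ∧ Tendsto γ (𝓝[I] b) (𝓝 p) := by
    intro b hb hbI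
    have hne : (𝓝[I] b).NeBot := mem_closure_iff_nhdsWithin_neBot.1 hb
    obtain ⟨q, hq⟩ := exists_clusterPt_of_compactSpace (map γ (𝓝[I] b))
    have hqc := hcl b hb hbI q hq
    have hpc : p ∈ conePoints n r := by
      have : (conePoints n r).Nonempty := ⟨q, hqc⟩
      simp only [p, this, dif_pos]
      exact this.some_mem
    -- In a compact space a single possible cluster point is a limit; this is where `hsub` enters.
    exact ⟨hpc, le_nhds_of_unique_clusterPt fun z hz => hsub (hcl b hb hbI z hz) hpc⟩
  have hγp : ∀ b, b ∉ I → γ b = p := fun b hb => by simp [γ, hb]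
  refine ⟨I, γ, ⟨hIo, hIc, hstr, ?_, ?_⟩, h0, hγ0⟩
  · intro b hb
    by_cases hbI : b ∈ I
    · exact (hstr.continuousAt hbI).continuousWithinAt
    · have hU : closure I ⊆ I ∪ Iᶜ := by simp
      refine ContinuousWithinAt.mono ?_ hU
      have h1 := (hend b hb hbI).2
      rw [ContinuousWithinAt, hγp b hbI, nhdsWithin_union, tendsto_sup]
      refine ⟨h1, ?_⟩
      refine tendsto_const_nhds.congr' ?_
      filter_upwards [self_mem_nhdsWithin] with s hs
      exact (hγp s hs).symm
  · intro b hb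
    rw [hIo.frontier_eq] at hb
    rw [hγp b hb.2]
    exact (hend b hb.1 hb.2).1

theorem exists_mem_lines (hsub : (conePoints n r).Subsingleton)
    (hu : u ≠ 0) {x : Surface n r} (hx : x ∉ conePoints n r) : ∃ L ∈ lines n r u, x ∈ L := by
  obtain ⟨I, γ, h, h0, rfl⟩ := exists_isCompleteCurve hsub hx hu
  exact ⟨_, h.mem_lines ⟨0, h0⟩, 0, subset_closure h0, rfl⟩

/-- Points that are not cone points are regular points of the foliation by straight lines. -/
theorem isRegularPoint_lines (hsub : (conePoints n r).Subsingleton) (hu : u ≠ 0)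
    {x : Surface n r} (hx : x ∉ conePoints n r) : IsRegularPoint (lines n r u) x := by
  obtain ⟨φ, hφ, hxφ⟩ : ∃ φ, IsFlatChart n r φ ∧ x ∈ φ.source := by
    simpa [conePoints] using hx
  -- Multiplication by `u⁻¹` makes the direction `u` horizontal and turns the parameter into the
  -- real part.
  let e : ℂ ≃ₜ ℂ := Homeomorph.mulLeft₀ u⁻¹ (inv_ne_zero hu)
  have hezl : ∀ z, e z = u⁻¹ * z := fun z => rfl
  let χ : OpenPartialHomeomorph (Surface n r) ℂ := φ.trans e.toOpenPartialHomeomorph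
  have hχs : χ.source = φ.source := by simp [χ]
  have hχ : ∀ z, χ z = u⁻¹ * φ z := fun z => rfl
  obtain ⟨a, b, c, d, hmem, hR⟩ := exists_rectangle_subset χ.open_target
    (χ.map_source (x := x) (by rwa [hχs]))
  have hRo : IsOpen (Ioo a b ×ℂ Ioo c d) := isOpen_Ioo.reProdIm isOpen_Ioo
  let ψ : OpenPartialHomeomorph (Surface n r) ℂ := (χ.symm.restrOpen _ hRo).symm
  have hψt : ψ.target = Ioo a b ×ℂ Ioo c d := by
    have : ψ.target = χ.target ∩ (Ioo a b ×ℂ Ioo c d) := by simp [ψ]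
    rw [this, inter_eq_right.2 hR]
  have hψ : ∀ z, ψ z = u⁻¹ * φ z := fun z => rfl
  have hψs : ψ.source ⊆ φ.source := by
    intro z hz
    have : ψ.source = χ.source ∩ χ ⁻¹' (Ioo a b ×ℂ Ioo c d) := by simp [ψ]
    rw [this, hχs] at hz
    exact hz.1
  have hsym : ∀ w, ψ.symm w = φ.symm (u * w) := by
    intro w
    change φ.symm (e.symm w) = _
    congr 1
    rw [e.symm_apply_eq, hezl]
    field_simp
  have hxψ : x ∈ ψ.source := by
    have : ψ.source = χ.source ∩ χ ⁻¹' (Ioo a b ×ℂ Ioo c d) := by simp [ψ]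
    rw [this, hχs]
    exact ⟨hxφ, hmem⟩
  refine ⟨ψ, hxψ, ⟨a, b, c, d, hψt⟩, ?_, ?_⟩
  · intro y hy
    have hyc := hφ.not_mem_conePoints (hψs hy)
    obtain ⟨L, hL, hyL⟩ := exists_mem_lines hsub hu hyc
    exact ⟨L, ⟨hL, hyL⟩, fun L' hL' => lines_eq_of_mem hL'.1 hL hyc hL'.2 hyL⟩
  · rintro L hL y ⟨hyL, hyψ⟩
    have hnc : ∀ z ∈ ψ.source, z ∉ conePoints n r := fun z hz => hφ.not_mem_conePoints (hψs hz)
    obtain ⟨I, γ, hγ, -, rfl⟩ := exists_isCompleteCurve_of_mem_lines hL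
    obtain ⟨t, ht, rfl⟩ := hyL
    have htI := hγ.mem_of_closure ht (hnc _ hyψ)
    have hyt := ψ.map_source hyψ
    rw [hψt, Complex.mem_reProdIm] at hyt
    set y₀ := ψ (γ t) with hy₀
    -- The times during which the horizontal line that is at `y₀` at time `t` stays in the
    -- rectangle.
    let J : Set ℝ := Ioo (a - y₀.re + t) (b - y₀.re + t)
    have hJt : ∀ s ∈ J, y₀ + ((s - t : ℝ) : ℂ) ∈ ψ.target := by
      intro s hs
      rw [hψt, Complex.mem_reProdIm]
      refine ⟨?_, by simpa using hyt.2⟩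
      simp only [Complex.add_re, Complex.ofReal_re]
      exact ⟨by linarith [hs.1], by linarith [hs.2]⟩
    let δ : ℝ → Surface n r := fun s => ψ.symm (y₀ + ((s - t : ℝ) : ℂ))
    have hδ : IsStraightOn n r u δ J := by
      have h1 := (hφ.isStraightOn_symm (u * y₀) t u).mono (J := J) (by
        intro s hs
        have h2 := ψ.map_target (hJt s hs)
        have h3 : ψ (ψ.symm (y₀ + ((s - t : ℝ) : ℂ))) = _ := ψ.right_inv (hJt s hs)
        have h4 := φ.map_source (hψs h2)
        rw [hψ, inv_mul_eq_iff_eq_mul₀ hu] at h3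
        rw [h3] at h4
        simp only [mem_ofPred_eq]
        convert h4 using 1
        ring)
      convert h1 using 1
      funext s
      simp only [δ, hsym]
      congr 1
      ring
    have htJ : t ∈ J := ⟨by linarith [hyt.1.1], by linarith [hyt.1.2]⟩
    have hδt : γ t = δ t := by
      simp only [δ, sub_self, Complex.ofReal_zero, add_zero]
      rw [hy₀, ψ.left_inv hyψ]
    obtain ⟨hJI, hJeq⟩ := hγ.subset_and_eqOn isOpen_Ioo ordConnected_Ioo hδ htI htJ hδt
    have hslice : {z ∈ ψ.source | (ψ z).im = y₀.im} = δ '' J := by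
      ext z
      constructor
      · rintro ⟨hz, hzi⟩
        have hzt := ψ.map_source hz
        rw [hψt, Complex.mem_reProdIm] at hzt
        refine ⟨(ψ z).re - y₀.re + t, ⟨by linarith [hzt.1.1], by linarith [hzt.1.2]⟩, ?_⟩
        have : y₀ + (((ψ z).re - y₀.re + t - t : ℝ) : ℂ) = ψ z := by
          apply Complex.ext <;> simp [hzi]
        simp only [δ, this, ψ.left_inv hz]
      · rintro ⟨s, hs, rfl⟩
        refine ⟨ψ.map_target (hJt s hs), ?_⟩
        simp only [δ, ψ.right_inv (hJt s hs)]
        simp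
    have hmem : γ t ∈ γ '' closure I ∩ ψ.source := ⟨⟨t, ht, rfl⟩, hyψ⟩
    apply Subset.antisymm
    · intro z hz
      have hzL := connectedComponentIn_subset _ _ hz
      refine ⟨hzL.2, ?_⟩
      have hcont : ContinuousOn (fun z => (ψ z).im) (γ '' closure I ∩ ψ.source) :=
        Complex.continuous_im.comp_continuousOn (ψ.continuousOn.mono inter_subset_right)
      have hpre := (isPreconnected_connectedComponentIn (F := γ '' closure I ∩ ψ.source)
        (x := γ t)).image _ (hcont.mono (connectedComponentIn_subset _ _))
      -- The heights on the component form a connected subset of a countable set of reals, hence a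
      -- single point.
      have hcount : ((fun z => (ψ z).im) '' (γ '' closure I ∩ ψ.source)).Countable := by
        refine (hγ.straight.countable_heights hu hφ).mono ?_
        rintro _ ⟨_, ⟨⟨s, hs, rfl⟩, hsψ⟩, rfl⟩
        exact ⟨γ s, ⟨⟨s, hγ.mem_of_closure hs (hnc _ hsψ), rfl⟩, hψs hsψ⟩, rfl⟩
      exact hcount.isTotallyDisconnected _ (image_mono (connectedComponentIn_subset _ _)) hpre
        (mem_image_of_mem _ hz) (mem_image_of_mem _ (mem_connectedComponentIn hmem))
    · rw [hslice]
      have hpre : IsPreconnected (δ '' J) := isPreconnected_Ioo.image _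
        fun s hs => (hδ.continuousAt hs).continuousWithinAt
      refine hpre.subset_connectedComponentIn ⟨t, htJ, hδt.symm⟩ ?_
      rintro _ ⟨s, hs, rfl⟩
      exact ⟨⟨s, subset_closure (hJI hs), hJeq hs⟩, ψ.map_target (hJt s hs)⟩

/-- A straight ray that starts at a cone point extends to a complete straight line. -/
theorem exists_isCompleteCurve_of_ray (hsub : (conePoints n r).Subsingleton) (hu : u ≠ 0)
    {p : Surface n r} (hp : p ∈ conePoints n r) {σ : ℝ → Surface n r} {ε : ℝ} (hε : 0 < ε)
    (hσ : IsStraightOn n r u σ (Ioo 0 ε)) (hlim : Tendsto σ (𝓝[>] 0) (𝓝 p)) :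
    ∃ I γ, IsCompleteCurve n r u I γ ∧ Ioo 0 ε ⊆ I ∧ I ⊆ Ioi 0 ∧ EqOn γ σ (Ioo 0 ε) ∧
      (0 : ℝ) ∈ closure I ∧ γ 0 = p := by
  have hhalf : ε / 2 ∈ Ioo 0 ε := ⟨half_pos hε, half_lt_self hε⟩
  -- The complete line through the point `σ (ε / 2)`, moved in time so as to be there at `ε / 2`,
  -- continues the ray.
  obtain ⟨I₀, γ₀, h₀, h0I, h00⟩ := exists_isCompleteCurve hsub (hσ.not_mem_conePoints hhalf) hu
  have h := h₀.shift (-(ε / 2))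
  set I := (fun t => t + -(ε / 2)) ⁻¹' I₀
  set γ := fun t => γ₀ (t + -(ε / 2))
  obtain ⟨h1, h2⟩ := h.subset_and_eqOn isOpen_Ioo ordConnected_Ioo hσ (t₀ := ε / 2)
    (by simpa [I] using h0I) hhalf (by simpa [γ] using h00)
  have hcl : (0 : ℝ) ∈ closure I := by
    refine closure_mono h1 ?_
    rw [closure_Ioo hε.ne]
    exact left_mem_Icc.2 hε.le
  have hγ0 : γ 0 = p := by
    have ht1 : Tendsto γ (𝓝[Ioo 0 ε] 0) (𝓝 (γ 0)) :=
      (h.continuousOn 0 hcl).mono (h1.trans subset_closure)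
    have ht2 : Tendsto γ (𝓝[Ioo 0 ε] 0) (𝓝 p) :=
      (hlim.mono_left (nhdsWithin_mono _ Ioo_subset_Ioi_self)).congr'
        (eventually_nhdsWithin_of_forall fun s hs => (h2 hs).symm)
    have : (𝓝[Ioo 0 ε] (0 : ℝ)).NeBot := by
      rw [nhdsWithin_Ioo_eq_nhdsGT hε]; infer_instance
    exact tendsto_nhds_unique ht1 ht2
  refine ⟨I, γ, h, h1, ?_, h2, hcl, hγ0⟩
  intro t ht
  -- A parameter `t ≤ 0` in `I` would put `0` in `I` by convexity, and then `p = γ 0` would have a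
  -- flat chart.
  by_contra hneg
  have h0I : (0 : ℝ) ∈ I := h.ordConnected.out ht (h1 hhalf) ⟨not_lt.1 hneg, hhalf.1.le⟩
  exact h.straight.not_mem_conePoints h0I (hγ0 ▸ hp)

/-- Two different straight rays that start at a cone point lie on different lines. -/
theorem exists_lines_ne_of_rays (hsub : (conePoints n r).Subsingleton) (hu : u ≠ 0)
    {p : Surface n r} (hp : p ∈ conePoints n r) {σ τ : ℝ → Surface n r} {ε : ℝ} (hε : 0 < ε)
    (hσ : IsStraightOn n r u σ (Ioo 0 ε)) (hσ0 : Tendsto σ (𝓝[>] 0) (𝓝 p))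
    (hτ : IsStraightOn n r u τ (Ioo 0 ε)) (hτ0 : Tendsto τ (𝓝[>] 0) (𝓝 p))
    (hne : ∀ t ∈ Ioo 0 ε, σ t ≠ τ t) :
    ∃ L ∈ lines n r u, ∃ L' ∈ lines n r u, L ≠ L' ∧ p ∈ L ∩ L' := by
  obtain ⟨I, γ, hγ, hεI, hI0, hγσ, hIcl, hγ0⟩ := exists_isCompleteCurve_of_ray hsub hu hp hε hσ hσ0
  obtain ⟨J, δ, hδ, hεJ, hJ0, hδτ, hJcl, hδ0⟩ := exists_isCompleteCurve_of_ray hsub hu hp hε hτ hτ0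
  have hhalf : ε / 2 ∈ Ioo 0 ε := ⟨half_pos hε, half_lt_self hε⟩
  refine ⟨_, hγ.mem_lines ⟨_, hεI hhalf⟩, _, hδ.mem_lines ⟨_, hεJ hhalf⟩, ?_,
    ⟨0, hIcl, hγ0⟩, ⟨0, hJcl, hδ0⟩⟩
  intro heq
  have hmem : γ (ε / 2) ∈ δ '' closure J := heq ▸ ⟨_, subset_closure (hεI hhalf), rfl⟩
  obtain ⟨s, hs, hst⟩ := hmem
  have hsJ := hδ.mem_of_closure hs (hst ▸ hγ.straight.not_mem_conePoints (hεI hhalf))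
  obtain ⟨h1, h2⟩ := hγ.eq_of_eq (hδ.shift (s - ε / 2)) (hεI hhalf)
    (by simpa using hsJ) (by simp [hst])
  -- If the lines coincide, the parametrizations differ by a shift. Both domains have infimum `0`,
  -- so the shift is zero and the rays agree at `ε / 2`.
  have hinf : IsGLB I 0 := ⟨fun t ht => (hI0 ht).le, fun b hb =>
    (isClosed_Ici.closure_subset_iff.2 fun t ht => hb ht) hIcl⟩
  have hinf' : IsGLB J 0 := ⟨fun t ht => (hJ0 ht).le, fun b hb =>
    (isClosed_Ici.closure_subset_iff.2 fun t ht => hb ht) hJcl⟩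
  have hinf2 : IsGLB I (-(s - ε / 2)) := by
    rw [h1]
    constructor
    · intro t ht
      have : 0 < t + (s - ε / 2) := hJ0 ht
      linarith
    · intro b hb
      have : b + (s - ε / 2) ∈ lowerBounds J := fun t ht => by
        have := hb (show t - (s - ε / 2) ∈ _ by simpa using ht)
        linarith
      linarith [hinf'.2 this]
  have hs0 : s = ε / 2 := by linarith [hinf.unique hinf2]
  refine hne _ hhalf ?_
  rw [← hγσ hhalf, ← hδτ hhalf, ← hst, hs0]

end Existence

end Foliation

/-! ### The regular polygon as an intersection of half planes -/

/-- The point of the unit circle of angle `π x / n`. -/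
def cis (n : ℕ) (x : ℝ) : ℂ := Complex.exp ((Real.pi * x / n : ℝ) * Complex.I)

/-- The apothem of the regular `2n`-gon of circumradius `r`. -/
def apothem (n : ℕ) (r : ℝ) : ℝ := r * Real.cos (Real.pi / (2 * n))

/-- Half of the side length of the regular `2n`-gon of circumradius `r`. -/
def halfSide (n : ℕ) (r : ℝ) : ℝ := r * Real.sin (Real.pi / (2 * n))

/-- The outward unit normal of the `k`-th side. -/
def normal (n : ℕ) (k : ℤ) : ℂ := cis n (k + 1 / 2)

/-- The signed distance, in the direction of the `k`-th normal, from the line through the origin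
parallel to the `k`-th side. -/
def height (n : ℕ) (k : ℤ) (z : ℂ) : ℝ := (z * cis n (-(k + 1 / 2))).re

/-- The vertices of the polygon, indexed by the integers. -/
def corner (n : ℕ) (r : ℝ) (k : ℤ) : ℂ := r * cis n k

section Geometry

variable {n : ℕ} {r : ℝ}

theorem cis_add (n : ℕ) (x y : ℝ) : cis n (x + y) = cis n x * cis n y := by
  unfold cis
  rw [← Complex.exp_add]
  congr 1
  push_cast
  ring

@[simp] theorem cis_zero (n : ℕ) : cis n 0 = 1 := by simp [cis]

theorem cis_mul_cis_neg (n : ℕ) (x : ℝ) : cis n x * cis n (-x) = 1 := by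
  rw [← cis_add]; simp

@[simp] theorem norm_cis (n : ℕ) (x : ℝ) : ‖cis n x‖ = 1 := Complex.norm_exp_ofReal_mul_I _

theorem cis_re (n : ℕ) (x : ℝ) : (cis n x).re = Real.cos (Real.pi * x / n) :=
  Complex.exp_ofReal_mul_I_re _

theorem cis_im (n : ℕ) (x : ℝ) : (cis n x).im = Real.sin (Real.pi * x / n) :=
  Complex.exp_ofReal_mul_I_im _

theorem cis_nat_mul (n : ℕ) (x : ℝ) (m : ℕ) : cis n (m * x) = cis n x ^ m := by
  unfold cis
  rw [← Complex.exp_nat_mul]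
  congr 1
  push_cast
  ring

theorem cis_self (hn : n ≠ 0) : cis n n = -1 := by
  have : (n : ℝ) ≠ 0 := by exact_mod_cast hn
  unfold cis
  rw [mul_div_assoc, div_self this, mul_one, Complex.exp_pi_mul_I]

theorem cis_add_self (hn : n ≠ 0) (x : ℝ) : cis n (x + n) = -cis n x := by
  rw [cis_add, cis_self hn]; ring

theorem cis_add_period (hn : n ≠ 0) (x : ℝ) (m : ℤ) : cis n (x + 2 * n * m) = cis n x := by
  have : (n : ℝ) ≠ 0 := by exact_mod_cast hn
  unfold cis
  rw [Complex.exp_eq_exp_iff_exists_int]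
  refine ⟨m, ?_⟩
  have : (n : ℂ) ≠ 0 := by exact_mod_cast hn
  push_cast
  field_simp

/-- The offset `x` lets the same periodicity serve the corners (integers) and the normals
(half-integers); from here on an index matters only modulo `2n`. -/
theorem cis_congr (hn : n ≠ 0) {j k : ℤ} (h : (2 * n : ℤ) ∣ j - k) (x : ℝ) :
    cis n (j + x) = cis n (k + x) := by
  obtain ⟨m, hm⟩ := h
  have hj : (j : ℝ) = k + 2 * n * m := by
    have : j = k + 2 * n * m := by linarith
    exact_mod_cast this
  rw [hj, ← cis_add_period hn (k + x) m]
  congr 1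
  ring

theorem vertex_eq_corner (n : ℕ) (r : ℝ) (k : ℕ) : vertex n r k = corner n r k := by
  unfold vertex corner cis
  push_cast
  rfl

theorem corner_congr (hn : n ≠ 0) {j k : ℤ} (h : (2 * n : ℤ) ∣ j - k) :
    corner n r j = corner n r k := by
  have := cis_congr hn h 0
  simp only [add_zero] at this
  rw [corner, corner, this]

theorem exists_nat_dvd_sub (hn : n ≠ 0) (k : ℤ) :
    ∃ m : ℕ, m < 2 * n ∧ (2 * n : ℤ) ∣ k - m := by
  have h2 : (0 : ℤ) < 2 * n := by omega
  have h1 := Int.emod_nonneg k h2.ne'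
  have h3 := Int.emod_lt_of_pos k h2
  refine ⟨(k % (2 * n)).toNat, by omega, ?_⟩
  rw [Int.toNat_of_nonneg h1]
  exact Int.dvd_self_sub_emod

theorem exists_vertex_eq_corner (hn : n ≠ 0) (k : ℤ) :
    ∃ m : ℕ, m < 2 * n ∧ vertex n r m = corner n r k := by
  obtain ⟨m, hm, h⟩ := exists_nat_dvd_sub hn k
  exact ⟨m, hm, by rw [vertex_eq_corner, corner_congr hn h]⟩

theorem range_vertex (hn : n ≠ 0) : range (vertex n r) = range (corner n r) := by
  apply Subset.antisymm
  · rintro _ ⟨k, rfl⟩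
    exact ⟨k, (vertex_eq_corner n r k).symm⟩
  · rintro _ ⟨k, rfl⟩
    obtain ⟨m, -, h⟩ := exists_vertex_eq_corner (r := r) hn k
    exact ⟨m, h⟩

theorem finite_range_corner (hn : n ≠ 0) : (range (corner n r)).Finite := by
  refine ((Finset.range (2 * n)).finite_toSet.image (vertex n r)).subset ?_
  rintro _ ⟨k, rfl⟩
  obtain ⟨m, hm, h⟩ := exists_vertex_eq_corner (r := r) hn k
  exact ⟨m, by simpa using hm, h⟩

theorem isCompact_polygon (hn : n ≠ 0) : IsCompact (polygon n r) := by
  rw [polygon, range_vertex hn]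
  exact (finite_range_corner hn).isCompact_convexHull (𝕜 := ℝ)

theorem corner_mem_polygon (hn : n ≠ 0) (k : ℤ) : corner n r k ∈ polygon n r := by
  rw [polygon, range_vertex hn]
  exact subset_convexHull ℝ _ ⟨k, rfl⟩

theorem convex_polygon (n : ℕ) (r : ℝ) : Convex ℝ (polygon n r) := convex_convexHull ℝ _

theorem corner_add_self (hn : n ≠ 0) (k : ℤ) : corner n r (k + n) = -corner n r k := by
  unfold corner
  push_cast
  rw [cis_add_self hn]; ring

theorem zero_mem_polygon (hn : n ≠ 0) : (0 : ℂ) ∈ polygon n r := by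
  have := convex_polygon n r (corner_mem_polygon hn 0) (corner_mem_polygon hn (0 + n))
    (show (0 : ℝ) ≤ 1 / 2 by norm_num) (show (0 : ℝ) ≤ 1 / 2 by norm_num) (by norm_num)
  rw [corner_add_self hn] at this
  simpa using this

theorem continuous_height (n : ℕ) (k : ℤ) : Continuous (height n k) := by
  unfold height; fun_prop

theorem height_add (n : ℕ) (k : ℤ) (z w : ℂ) :
    height n k (z + w) = height n k z + height n k w := by
  simp only [height, add_mul, Complex.add_re]

theorem height_neg (n : ℕ) (k : ℤ) (z : ℂ) : height n k (-z) = -height n k z := by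
  simp only [height, neg_mul, Complex.neg_re]

theorem height_sub (n : ℕ) (k : ℤ) (z w : ℂ) :
    height n k (z - w) = height n k z - height n k w := by
  rw [sub_eq_add_neg, height_add, height_neg]; ring

theorem height_smul (n : ℕ) (k : ℤ) (a : ℝ) (z : ℂ) : height n k (a * z) = a * height n k z := by
  simp only [height, mul_assoc, Complex.re_ofReal_mul]

theorem abs_height_le (n : ℕ) (k : ℤ) (z : ℂ) : |height n k z| ≤ ‖z‖ := by
  refine (Complex.abs_re_le_norm _).trans ?_
  simp

theorem height_congr (hn : n ≠ 0) {j k : ℤ} (h : (2 * n : ℤ) ∣ j - k) (z : ℂ) :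
    height n j z = height n k z := by
  have h' : (2 * n : ℤ) ∣ -j - -k := by
    rw [show -j - -k = -(j - k) by ring]; exact h.neg_right
  have := cis_congr hn h' (-1 / 2)
  unfold height
  rw [show (-(j + 1 / 2) : ℝ) = ((-j : ℤ) : ℝ) + -1 / 2 by push_cast; ring,
    show (-(k + 1 / 2) : ℝ) = ((-k : ℤ) : ℝ) + -1 / 2 by push_cast; ring, this]

theorem normal_congr (hn : n ≠ 0) {j k : ℤ} (h : (2 * n : ℤ) ∣ j - k) :
    normal n j = normal n k := cis_congr hn h _

theorem height_add_self (hn : n ≠ 0) (k : ℤ) (z : ℂ) :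
    height n (k + n) z = -height n k z := by
  have : cis n (-((k : ℝ) + 1 / 2)) = -cis n (-((k : ℝ) + n + 1 / 2)) := by
    rw [← cis_add_self hn]; congr 1; ring
  unfold height
  push_cast
  rw [this]
  simp

theorem normal_add_self (hn : n ≠ 0) (k : ℤ) : normal n (k + n) = -normal n k := by
  unfold normal
  rw [← cis_add_self hn]
  congr 1
  push_cast
  ring

@[simp] theorem height_normal (n : ℕ) (k : ℤ) : height n k (normal n k) = 1 := by
  unfold height normal
  rw [cis_mul_cis_neg]
  simp

@[simp] theorem norm_normal (n : ℕ) (k : ℤ) : ‖normal n k‖ = 1 := norm_cis _ _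

theorem half_angle_pos (hn : n ≠ 0) : 0 < Real.pi / (2 * n) := by
  have : (0 : ℝ) < n := by exact_mod_cast Nat.pos_of_ne_zero hn
  positivity

theorem half_angle_le (hn : 2 ≤ n) : Real.pi / (2 * n) ≤ Real.pi / 4 := by
  have : (2 : ℝ) ≤ n := by exact_mod_cast hn
  apply div_le_div_of_nonneg_left Real.pi_pos.le (by norm_num) (by linarith)

theorem apothem_pos (hn : 2 ≤ n) (hr : 0 < r) : 0 < apothem n r := by
  have h1 := half_angle_pos (n := n) (by omega)
  have h2 := half_angle_le hn
  refine mul_pos hr (Real.cos_pos_of_mem_Ioo ⟨?_, ?_⟩) <;> linarith [Real.pi_pos]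

theorem halfSide_pos (hn : 2 ≤ n) (hr : 0 < r) : 0 < halfSide n r := by
  have h1 := half_angle_pos (n := n) (by omega)
  have h2 := half_angle_le hn
  refine mul_pos hr (Real.sin_pos_of_mem_Ioo ⟨?_, ?_⟩) <;> linarith [Real.pi_pos]

/-- In the frame whose first axis is the `k`-th normal, side `k` is the vertical segment of abscissa
`apothem n r`, with ordinates between `∓ halfSide n r`. -/
theorem corner_eq_normal_mul (n : ℕ) (r : ℝ) (k : ℤ) :
    corner n r k = normal n k * (apothem n r - halfSide n r * Complex.I) := by
  have h : cis n (-(1 / 2)) = Real.cos (Real.pi / (2 * n)) - Real.sin (Real.pi / (2 * n)) *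
      Complex.I := by
    have e : Real.pi * (-(1 / 2)) / n = -(Real.pi / (2 * n)) := by
      rw [div_mul_eq_div_div]; ring
    apply Complex.ext
    · rw [cis_re, e, Real.cos_neg]; simp [-Complex.ofReal_cos, -Complex.ofReal_sin]
    · rw [cis_im, e, Real.sin_neg]; simp [-Complex.ofReal_cos, -Complex.ofReal_sin]
  unfold corner normal apothem halfSide
  rw [show (k : ℝ) = (k + 1 / 2) + (-(1 / 2)) by ring, cis_add, h]
  push_cast
  ring_nf

theorem corner_succ_eq_normal_mul (n : ℕ) (r : ℝ) (k : ℤ) :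
    corner n r (k + 1) = normal n k * (apothem n r + halfSide n r * Complex.I) := by
  have h : cis n (1 / 2) = Real.cos (Real.pi / (2 * n)) + Real.sin (Real.pi / (2 * n)) *
      Complex.I := by
    have e : Real.pi * (1 / 2) / n = Real.pi / (2 * n) := by
      rw [div_mul_eq_div_div]; ring
    apply Complex.ext
    · rw [cis_re, e]; simp [-Complex.ofReal_cos, -Complex.ofReal_sin]
    · rw [cis_im, e]; simp [-Complex.ofReal_cos, -Complex.ofReal_sin]
  unfold corner normal apothem halfSide
  push_cast
  rw [show (k : ℝ) + 1 = (k + 1 / 2) + (1 / 2) by ring, cis_add, h]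
  push_cast
  ring

theorem corner_add_corner_succ (n : ℕ) (r : ℝ) (k : ℤ) :
    corner n r k + corner n r (k + 1) = 2 * apothem n r * normal n k := by
  rw [corner_eq_normal_mul, corner_succ_eq_normal_mul]; ring

theorem height_corner (n : ℕ) (r : ℝ) (j k : ℤ) :
    height n j (corner n r k) = r * Real.cos (Real.pi * (k - j - 1 / 2) / n) := by
  unfold height corner
  rw [mul_assoc, ← cis_add, Complex.re_ofReal_mul, cis_re]
  congr 4
  ring

/-- The product form shows the sign: both sines are positive when `k - j` is one of `2, …, 2n - 1`,
and one of them vanishes for `k - j` equal to `0` or `1`, the two ends of side `j`. -/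
theorem apothem_sub_height_corner (n : ℕ) (r : ℝ) (j k : ℤ) :
    apothem n r - height n j (corner n r k) =
      2 * r * (Real.sin (Real.pi * (k - j) / (2 * n)) *
        Real.sin (Real.pi * (k - j - 1) / (2 * n))) := by
  rw [height_corner, apothem, ← mul_sub, Real.cos_sub_cos]
  have e1 : (Real.pi / (2 * n) + Real.pi * (k - j - 1 / 2) / n) / 2 =
      Real.pi * (k - j) / (2 * n) := by
    rw [div_mul_eq_div_div, div_mul_eq_div_div]; ring
  have e2 : (Real.pi / (2 * n) - Real.pi * (k - j - 1 / 2) / n) / 2 =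
      -(Real.pi * (k - j - 1) / (2 * n)) := by
    rw [div_mul_eq_div_div, div_mul_eq_div_div]; ring
  rw [e1, e2, Real.sin_neg]
  ring

theorem height_corner_lt (hn : n ≠ 0) (hr : 0 < r) {j k : ℤ} (h1 : ¬ (2 * n : ℤ) ∣ k - j)
    (h2 : ¬ (2 * n : ℤ) ∣ k - j - 1) : height n j (corner n r k) < apothem n r := by
  obtain ⟨m, hm, hd⟩ := exists_nat_dvd_sub hn (k - j)
  have hd' : (2 * n : ℤ) ∣ k - (j + m) := by rwa [sub_add_eq_sub_sub]
  have hm0 : m ≠ 0 := by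
    rintro rfl
    exact h1 (by simpa using hd)
  have hm1 : m ≠ 1 := by
    rintro rfl
    exact h2 (by simpa using hd)
  rw [corner_congr hn hd', ← sub_pos, apothem_sub_height_corner]
  push_cast
  have hn0 : (0 : ℝ) < n := by exact_mod_cast Nat.pos_of_ne_zero hn
  have hm2 : (2 : ℝ) ≤ m := by exact_mod_cast (by omega : 2 ≤ m)
  have hm3 : (m : ℝ) < 2 * n := by exact_mod_cast hm
  have hpi := Real.pi_pos
  have key : ∀ x : ℝ, 0 < x → x < 2 * n → 0 < Real.sin (Real.pi * x / (2 * n)) := by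
    intro x hx hx'
    apply Real.sin_pos_of_pos_of_lt_pi (by positivity)
    rw [div_lt_iff₀ (by positivity)]
    gcongr
  have k1 := key m (by linarith) hm3
  have k2 := key (m - 1) (by linarith) (by linarith)
  rw [show (j : ℝ) + m - j = m by ring]
  positivity

theorem height_corner_self (n : ℕ) (r : ℝ) (k : ℤ) : height n k (corner n r k) = apothem n r := by
  have := apothem_sub_height_corner n r k k
  simp at this
  linarith

theorem height_corner_succ (n : ℕ) (r : ℝ) (k : ℤ) :
    height n k (corner n r (k + 1)) = apothem n r := by
  have := apothem_sub_height_corner n r k (k + 1)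
  simp at this
  linarith

theorem height_corner_le (hn : n ≠ 0) (hr : 0 < r) (j k : ℤ) :
    height n j (corner n r k) ≤ apothem n r := by
  by_cases h1 : (2 * n : ℤ) ∣ k - j
  · rw [corner_congr hn h1, height_corner_self]
  · by_cases h2 : (2 * n : ℤ) ∣ k - j - 1
    · rw [corner_congr hn (show (2 * n : ℤ) ∣ k - (j + 1) by rwa [sub_add_eq_sub_sub]),
        height_corner_succ]
    · exact (height_corner_lt hn hr h1 h2).le

theorem height_combo (n : ℕ) (k : ℤ) (a b : ℝ) (z w : ℂ) :
    height n k (a * z + b * w) = a * height n k z + b * height n k w := by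
  rw [height_add, height_smul, height_smul]

theorem height_le_of_mem (hn : n ≠ 0) (hr : 0 < r) {z : ℂ} (hz : z ∈ polygon n r) (j : ℤ) :
    height n j z ≤ apothem n r := by
  have hconv : Convex ℝ {w : ℂ | height n j w ≤ apothem n r} := by
    intro z hz w hw a b ha hb hab
    simp only [mem_ofPred_eq] at hz hw ⊢
    rw [Complex.real_smul, Complex.real_smul, height_combo]
    calc a * height n j z + b * height n j w ≤ a * apothem n r + b * apothem n r := by gcongr
      _ = apothem n r := by rw [← add_mul, hab, one_mul]
  refine convexHull_min ?_ hconv hz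
  rw [range_vertex hn]
  rintro _ ⟨k, rfl⟩
  exact height_corner_le hn hr j k

/-- Measure the argument of `z` in units of `π / n`. Its integer part selects the two consecutive
corners, and its fractional part `s` gives the coefficients through `cis s · sin(π/n) =
sin(π(1-s)/n) + sin(πs/n) · cis 1`. -/
theorem exists_combo_corner (hn : 2 ≤ n) (hr : 0 < r) (z : ℂ) :
    ∃ (k : ℤ) (a b : ℝ), 0 ≤ a ∧ 0 ≤ b ∧ z = a * corner n r k + b * corner n r (k + 1) := by
  have hn0 : (0 : ℝ) < n := by exact_mod_cast (by omega : 0 < n)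
  have hn2 : (2 : ℝ) ≤ n := by exact_mod_cast hn
  have hpi := Real.pi_pos
  set x : ℝ := n * z.arg / Real.pi with hx
  set s : ℝ := Int.fract x with hs
  have hs0 : 0 ≤ s := Int.fract_nonneg x
  have hs1 : s < 1 := Int.fract_lt_one x
  have hz : z = ‖z‖ * (cis n ⌊x⌋ * cis n s) := by
    rw [← cis_add, hs, Int.floor_add_fract, cis, hx]
    rw [show Real.pi * (n * z.arg / Real.pi) / n = z.arg by field_simp]
    exact (Complex.norm_mul_exp_arg_mul_I z).symm
  have hsin : 0 < Real.sin (Real.pi / n) := by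
    apply Real.sin_pos_of_pos_of_lt_pi (by positivity)
    rw [div_lt_iff₀ hn0]
    nlinarith
  have hsn : ∀ t : ℝ, 0 ≤ t → t ≤ 1 → 0 ≤ Real.sin (Real.pi * t / n) := by
    intro t ht ht'
    apply Real.sin_nonneg_of_nonneg_of_le_pi (by positivity)
    rw [div_le_iff₀ hn0]
    nlinarith
  set b := Real.sin (Real.pi * s / n) / Real.sin (Real.pi / n) with hb
  set a := Real.sin (Real.pi * (1 - s) / n) / Real.sin (Real.pi / n) with ha
  have hcs : cis n s = a + b * cis n 1 := by
    apply Complex.ext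
    · simp only [Complex.add_re, Complex.ofReal_re, Complex.re_ofReal_mul, cis_re, mul_one]
      rw [ha, hb, show Real.pi * (1 - s) / n = Real.pi / n - Real.pi * s / n by ring,
        Real.sin_sub]
      field_simp
      ring
    · simp only [Complex.add_im, Complex.ofReal_im, Complex.im_ofReal_mul, cis_im, mul_one]
      rw [hb]
      field_simp
      ring
  refine ⟨⌊x⌋, ‖z‖ * a / r, ‖z‖ * b / r, ?_, ?_, ?_⟩
  · have := hsn (1 - s) (by linarith) (by linarith)
    positivity
  · have := hsn s hs0 hs1.le
    positivity
  · have hr' : (r : ℂ) ≠ 0 := by exact_mod_cast hr.ne'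
    conv_lhs => rw [hz, hcs]
    unfold corner
    push_cast
    rw [cis_add]
    field_simp

/-- If `z` is the nonnegative combination of corners `k` and `k + 1` with coefficients `a` and `b`,
then its height over side `k` is `(a + b)` times the apothem. Hence `a + b ≤ 1`, and the missing
weight goes to the centre. -/
theorem mem_polygon_iff (hn : 2 ≤ n) (hr : 0 < r) (z : ℂ) :
    z ∈ polygon n r ↔ ∀ j, height n j z ≤ apothem n r := by
  have hn' : n ≠ 0 := by omega
  refine ⟨fun h j => height_le_of_mem hn' hr h j, fun h => ?_⟩
  obtain ⟨k, a, b, ha, hb, rfl⟩ := exists_combo_corner hn hr z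
  have h1 := h k
  rw [height_combo, height_corner_self, height_corner_succ, ← add_mul] at h1
  have hab : a + b ≤ 1 := by
    have := apothem_pos hn hr
    nlinarith
  have hmem : (1 - a - b) • (0 : ℂ) + a • corner n r k + b • corner n r (k + 1) ∈ polygon n r := by
    have := (convex_polygon n r).sum_mem (t := Finset.univ) (w := ![1 - a - b, a, b])
      (z := ![0, corner n r k, corner n r (k + 1)])
      (by intro i _; fin_cases i <;> simp <;> linarith) (by simp [Fin.sum_univ_three]; ring)
      (by
        intro i _
        fin_cases i
        · exact zero_mem_polygon hn'
        · exact corner_mem_polygon hn' _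
        · exact corner_mem_polygon hn' _)
    simpa [Fin.sum_univ_three] using this
  simpa using hmem

/-- On the line of side `k` only the coordinate `y` along the side is free; the half planes of the
two neighbouring sides bound it by `halfSide n r` in absolute value. -/
theorem mem_segment_corner_iff (hn : 2 ≤ n) (hr : 0 < r) (k : ℤ) (z : ℂ) :
    z ∈ segment ℝ (corner n r k) (corner n r (k + 1)) ↔
      z ∈ polygon n r ∧ height n k z = apothem n r := by
  have hn' : n ≠ 0 := by omega
  constructor
  · intro h
    refine ⟨(convex_polygon n r).segment_subset (corner_mem_polygon hn' _)
      (corner_mem_polygon hn' _) h, ?_⟩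
    obtain ⟨a, b, -, -, hab, rfl⟩ := h
    rw [Complex.real_smul, Complex.real_smul, height_combo, height_corner_self,
      height_corner_succ, ← add_mul, hab, one_mul]
  · rintro ⟨hz, hk⟩
    set y : ℝ := (z * cis n (-(k + 1 / 2))).im with hy
    have hzy : z = normal n k * (apothem n r + y * Complex.I) := by
      have h1 : z * cis n (-(k + 1 / 2)) = apothem n r + y * Complex.I := by
        apply Complex.ext
        · simp only [Complex.add_re, Complex.ofReal_re, Complex.re_ofReal_mul, Complex.I_re]
          rw [← hk, height]; ring
        · simp [hy]
      rw [← h1, normal, mul_left_comm, cis_mul_cis_neg, mul_one]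
    have hh : ∀ m : ℤ, height n (k + m) z =
        apothem n r * Real.cos (Real.pi * m / n) + y * Real.sin (Real.pi * m / n) := by
      intro m
      have h1 : normal n k * cis n (-((k + m : ℤ) + 1 / 2)) = cis n (-m) := by
        rw [normal, ← cis_add]; congr 1; push_cast; ring
      have e : Real.pi * -m / n = -(Real.pi * m / n) := by ring
      rw [height, hzy, mul_right_comm, h1, Complex.mul_re, cis_re, cis_im, e, Real.cos_neg,
        Real.sin_neg]
      simp
      ring
    have hpi := Real.pi_pos
    have hα0 := half_angle_pos hn'
    have hα1 := half_angle_le hn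
    have e2 : Real.pi / n = 2 * (Real.pi / (2 * n)) := by
      have : (n : ℝ) ≠ 0 := by exact_mod_cast hn'
      field_simp
    set α := Real.pi / (2 * n) with hα
    have hsα : 0 < Real.sin α := Real.sin_pos_of_pos_of_lt_pi hα0 (by linarith)
    have hcα : 0 < Real.cos α := Real.cos_pos_of_mem_Ioo ⟨by linarith, by linarith⟩
    -- This says that the end `y = halfSide n r` also lies on the line of side `k + 1`.
    have hid : apothem n r - apothem n r * Real.cos (2 * α) = halfSide n r * Real.sin (2 * α) := by
      rw [apothem, halfSide, ← hα, Real.cos_two_mul, Real.sin_two_mul]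
      linear_combination (2 * r * Real.cos α) * (-1) * (Real.sin_sq_add_cos_sq α)
    have hs2 : 0 < Real.sin (2 * α) := by rw [Real.sin_two_mul]; positivity
    have hup : y ≤ halfSide n r := by
      have h1 := height_le_of_mem hn' hr hz (k + 1)
      have h2 := hh 1
      simp only [Int.cast_one, mul_one, e2] at h2
      nlinarith
    have hlo : -halfSide n r ≤ y := by
      have h1 := height_le_of_mem hn' hr hz (k + -1)
      have h2 := hh (-1)
      have e3 : Real.pi * ((-1 : ℤ) : ℝ) / n = -(2 * α) := by push_cast; rw [← e2]; ring
      rw [e3, Real.cos_neg, Real.sin_neg] at h2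
      nlinarith
    have ha := halfSide_pos hn hr
    refine ⟨(halfSide n r - y) / (2 * halfSide n r), (halfSide n r + y) / (2 * halfSide n r),
      div_nonneg (by linarith) (by linarith), div_nonneg (by linarith) (by linarith),
      by field_simp; ring, ?_⟩
    rw [Complex.real_smul, Complex.real_smul, corner_eq_normal_mul, corner_succ_eq_normal_mul]
    have ha' : (halfSide n r : ℂ) ≠ 0 := by exact_mod_cast ha.ne'
    conv_rhs => rw [hzy]
    push_cast
    field_simp
    ring

theorem mem_side_iff (hn : 2 ≤ n) (hr : 0 < r) (k : ℕ) (z : ℂ) :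
    z ∈ side n r k ↔ z ∈ polygon n r ∧ height n k z = apothem n r := by
  rw [← mem_segment_corner_iff hn hr, side, vertex_eq_corner, vertex_eq_corner]
  push_cast
  rfl

/-- Two different sides meet at most at vertices. -/
theorem mem_range_corner_of_height_eq (hn : 2 ≤ n) (hr : 0 < r) {z : ℂ} (hz : z ∈ polygon n r)
    {j k : ℤ} (hj : height n j z = apothem n r) (hk : height n k z = apothem n r)
    (hjk : ¬ (2 * n : ℤ) ∣ j - k) : z ∈ range (corner n r) := by
  have hn' : n ≠ 0 := by omega
  obtain ⟨a, b, ha, hb, hab, rfl⟩ := (mem_segment_corner_iff hn hr k z).2 ⟨hz, hk⟩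
  rw [Complex.real_smul, Complex.real_smul] at *
  rcases ha.eq_or_lt with rfl | ha
  · exact ⟨k + 1, by simp [show b = 1 by linarith]⟩
  rcases hb.eq_or_lt with rfl | hb
  · exact ⟨k, by simp [show a = 1 by linarith]⟩
  exfalso
  rw [height_combo] at hj
  have h1 := height_corner_le hn' hr j k
  have h2 := height_corner_le hn' hr j (k + 1)
  -- A linear function that reaches its maximum inside a segment reaches it at both ends. So corners
  -- `k` and `k + 1` both lie on side `j`, which without `j ≡ k` would need `2n ∣ 2`.
  have e1 : height n j (corner n r k) = apothem n r := by
    by_contra hne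
    have h3 := mul_lt_mul_of_pos_left (lt_of_le_of_ne h1 hne) ha
    have h4 := mul_le_mul_of_nonneg_left h2 hb.le
    have h5 : a * apothem n r + b * apothem n r = apothem n r := by rw [← add_mul, hab, one_mul]
    linarith
  have e2 : height n j (corner n r (k + 1)) = apothem n r := by
    by_contra hne
    have h3 := mul_lt_mul_of_pos_left (lt_of_le_of_ne h2 hne) hb
    have h4 := mul_le_mul_of_nonneg_left h1 ha.le
    have h5 : a * apothem n r + b * apothem n r = apothem n r := by rw [← add_mul, hab, one_mul]
    linarith
  have d1 : (2 * n : ℤ) ∣ k - j ∨ (2 * n : ℤ) ∣ k - j - 1 := by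
    by_contra! hc
    exact (height_corner_lt hn' hr hc.1 hc.2).ne e1
  have d2 : (2 * n : ℤ) ∣ k + 1 - j ∨ (2 * n : ℤ) ∣ k + 1 - j - 1 := by
    by_contra! hc
    exact (height_corner_lt hn' hr hc.1 hc.2).ne e2
  have hd : ¬ (2 * n : ℤ) ∣ k - j := fun h => hjk (by
    rw [show j - k = -(k - j) by ring]; exact h.neg_right)
  have hd1 := d1.resolve_left hd
  rcases d2 with h | h
  · have h3 := dvd_sub h hd1
    rw [show k + 1 - j - (k - j - 1) = 2 by ring] at h3
    have := Int.le_of_dvd (by norm_num) h3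
    omega
  · exact hd (by rwa [show k + 1 - j - 1 = k - j by ring] at h)

end Geometry

/-! ### The identification of opposite sides -/

section Gluing

variable {n : ℕ} {r : ℝ}

theorem dvd_of_height_corner_eq (hn : n ≠ 0) (hr : 0 < r) {j k : ℤ}
    (h : height n j (corner n r k) = apothem n r) :
    (2 * n : ℤ) ∣ k - j ∨ (2 * n : ℤ) ∣ k - (j + 1) := by
  by_contra! hc
  exact (height_corner_lt hn hr hc.1 (by rw [sub_sub]; exact hc.2)).ne h

/-- A corner is determined by the two sides that contain it: corner `k` lies on sides `k` and `k -
1`, and modulo `2n ≥ 4` only the index `k` fits both. -/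
theorem corner_eq_corner_iff (hn : 2 ≤ n) (hr : 0 < r) {j k : ℤ} :
    corner n r j = corner n r k ↔ (2 * n : ℤ) ∣ j - k := by
  have hn' : n ≠ 0 := by omega
  refine ⟨fun h => ?_, corner_congr hn'⟩
  have h1 := dvd_of_height_corner_eq hn' hr (h ▸ height_corner_self n r k)
  have h2 := dvd_of_height_corner_eq (j := k - 1) (k := j) hn' hr (by
    rw [h]; simpa using height_corner_succ n r (k - 1))
  rcases h1 with h1 | h1
  · exact h1
  rcases h2 with h2 | h2
  · have h3 := dvd_sub h2 h1
    rw [show j - (k - 1) - (j - (k + 1)) = 2 by ring] at h3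
    have := Int.le_of_dvd (by norm_num) h3
    omega
  · simpa using h2

theorem norm_corner (hr : 0 < r) (k : ℤ) : ‖corner n r k‖ = r := by
  simp [corner, abs_of_pos hr]

theorem apothem_lt (hn : 2 ≤ n) (hr : 0 < r) : apothem n r < r := by
  have h1 := half_angle_pos (n := n) (by omega)
  have h2 := half_angle_le hn
  have h3 : Real.cos (Real.pi / (2 * n)) < 1 := by
    rw [← Real.cos_zero]
    exact Real.cos_lt_cos_of_nonneg_of_le_pi le_rfl (by linarith [Real.pi_pos]) h1
  unfold apothem
  nlinarith

/-- The image of a point of the side `k` on the opposite side. -/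
def crossing (n : ℕ) (r : ℝ) (k : ℤ) (z : ℂ) : ℂ := z - 2 * apothem n r * normal n k

theorem vertex_sub_vertex (hn : n ≠ 0) (k : ℕ) :
    vertex n r (k + n + 1) - vertex n r k = -(2 * apothem n r * normal n k) := by
  rw [vertex_eq_corner, vertex_eq_corner, ← corner_add_corner_succ]
  push_cast
  rw [show (k + n + 1 : ℤ) = k + 1 + n by ring, corner_add_self hn]
  ring

theorem crossing_congr (hn : n ≠ 0) {j k : ℤ} (h : (2 * n : ℤ) ∣ j - k) (z : ℂ) :
    crossing n r j z = crossing n r k z := by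
  rw [crossing, crossing, normal_congr hn h]

theorem crossing_corner (hn : n ≠ 0) (k : ℤ) :
    crossing n r k (corner n r k) = corner n r (k + n + 1) := by
  rw [crossing, ← corner_add_corner_succ, show (k + n + 1 : ℤ) = k + 1 + n by ring,
    corner_add_self hn]
  ring

theorem crossing_corner_succ (hn : n ≠ 0) (k : ℤ) :
    crossing n r k (corner n r (k + 1)) = corner n r (k + n) := by
  rw [crossing, ← corner_add_corner_succ, corner_add_self hn]
  ring

theorem crossing_crossing (hn : n ≠ 0) (k : ℤ) (z : ℂ) :
    crossing n r (k + n) (crossing n r k z) = z := by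
  rw [crossing, crossing, normal_add_self hn]; ring

theorem height_crossing (n : ℕ) (r : ℝ) (k : ℤ) (z : ℂ) :
    height n k (crossing n r k z) = height n k z - 2 * apothem n r := by
  rw [crossing, height_sub, show (2 * apothem n r * normal n k : ℂ) =
    ((2 * apothem n r : ℝ) : ℂ) * normal n k by push_cast; ring, height_smul, height_normal,
    mul_one]

theorem height_crossing_opposite (hn : n ≠ 0) {k : ℤ} {z : ℂ}
    (h : height n k z = apothem n r) : height n (k + n) (crossing n r k z) = apothem n r := by
  rw [height_add_self hn, height_crossing, h]; ring

theorem crossing_mem_range_corner_iff (hn : 2 ≤ n) (hr : 0 < r) {k : ℤ} {z : ℂ}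
    (h : height n k z = apothem n r) :
    crossing n r k z ∈ range (corner n r) ↔ z ∈ range (corner n r) := by
  have hn' : n ≠ 0 := by omega
  have key : ∀ (k : ℤ) (z : ℂ), height n k z = apothem n r → z ∈ range (corner n r) →
      crossing n r k z ∈ range (corner n r) := by
    rintro k _ hk ⟨j, rfl⟩
    rcases dvd_of_height_corner_eq hn' hr hk with hd | hd
    · rw [corner_congr hn' hd, crossing_corner hn']; exact mem_range_self _
    · rw [corner_congr hn' hd, crossing_corner_succ hn']; exact mem_range_self _
  refine ⟨fun hc => ?_, key k z h⟩
  have := key (k + n) _ (height_crossing_opposite hn' h) hc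
  rwa [crossing_crossing hn'] at this

theorem crossing_mem_polygon (hn : 2 ≤ n) (hr : 0 < r) {k : ℤ} {z : ℂ} (hz : z ∈ polygon n r)
    (h : height n k z = apothem n r) : crossing n r k z ∈ polygon n r := by
  have hn' : n ≠ 0 := by omega
  obtain ⟨a, b, ha, hb, hab, rfl⟩ := (mem_segment_corner_iff hn hr k z).2 ⟨hz, h⟩
  have : crossing n r k (a • corner n r k + b • corner n r (k + 1)) =
      a • corner n r (k + n + 1) + b • corner n r (k + n) := by
    have hab' : (a : ℂ) + b = 1 := by exact_mod_cast hab
    rw [← crossing_corner hn', ← crossing_corner_succ hn']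
    simp only [crossing, Complex.real_smul]
    linear_combination (2 * (apothem n r : ℂ) * normal n k) * hab'
  rw [this]
  exact convex_polygon n r (corner_mem_polygon hn' _) (corner_mem_polygon hn' _) ha hb hab

theorem glue_iff (hn : 2 ≤ n) (hr : 0 < r) (z w : polygon n r) :
    Glue n r z w ↔ ∃ k : ℤ, height n k z = apothem n r ∧ (w : ℂ) = crossing n r k z := by
  have hn' : n ≠ 0 := by omega
  constructor
  · rintro ⟨k, hk, hw⟩
    refine ⟨k, ((mem_side_iff hn hr k z).1 hk).2, ?_⟩
    rw [hw, vertex_sub_vertex hn', crossing]; ring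
  · rintro ⟨k, hk, hw⟩
    obtain ⟨m, -, hd⟩ := exists_nat_dvd_sub hn' k
    refine ⟨m, (mem_side_iff hn hr m z).2 ⟨z.2, by rw [← hk, height_congr hn' hd]⟩, ?_⟩
    rw [hw, crossing_congr hn' hd, vertex_sub_vertex hn', crossing]; ring

/-- If `n` is odd, the parity of a vertex is well defined on the surface. -/
theorem even_of_oneVertex (hn : 2 ≤ n) (hr : 0 < r) (h : OneVertex n r) : Even n := by
  by_contra hodd
  rw [Nat.not_even_iff_odd] at hodd
  have hn' : n ≠ 0 := by omega
  -- Being a corner of even index, read as false away from the corners. Crossing a side shifts the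
  -- index of a corner by `n + 1` or `n - 1`, both even here, so `Q` descends to the surface and
  -- separates corner `1` from corner `0`.
  let Q : ℂ → Prop := fun z => ∃ k : ℤ, Even k ∧ z = corner n r k
  have hpar : ∀ k : ℤ, Q (corner n r k) ↔ Even k := by
    intro k
    refine ⟨?_, fun hk => ⟨k, hk, rfl⟩⟩
    rintro ⟨j, hj, hjk⟩
    obtain ⟨m, hm⟩ := (corner_eq_corner_iff hn hr).1 hjk
    rw [show k = j + 2 * (n * m) by linarith]
    exact hj.add (even_two_mul _)
  have hodd' : Odd (n : ℤ) := by exact_mod_cast hodd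
  have hQ : ∀ (k : ℤ) (z : ℂ), height n k z = apothem n r → (Q z ↔ Q (crossing n r k z)) := by
    intro k z hz
    by_cases hc : z ∈ range (corner n r)
    · obtain ⟨j, rfl⟩ := hc
      rcases dvd_of_height_corner_eq hn' hr hz with hd | hd
      · rw [corner_congr hn' hd, crossing_corner hn', hpar, hpar, add_assoc]
        have : Even ((n : ℤ) + 1) := hodd'.add_one
        simp [Int.even_add, this]
      · rw [corner_congr hn' hd, crossing_corner_succ hn', hpar, hpar]
        grind
    · have hc' := mt (crossing_mem_range_corner_iff hn hr hz).1 hc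
      constructor
      · rintro ⟨j, -, rfl⟩; exact absurd (mem_range_self j) hc
      · rintro ⟨j, -, hj⟩; exact absurd ⟨j, hj.symm⟩ hc'
  let f : Surface n r → Prop := Quot.lift (fun z : polygon n r => Q z) (by
    intro z w hzw
    obtain ⟨k, hk, hw⟩ := (glue_iff hn hr z w).1 hzw
    simp only [hw]
    exact propext (hQ k z hk))
  have h1 : f (vertexPoint n r 1) = f (vertexPoint n r 0) := by rw [h 1]
  have h2 : Q (vertex n r 1) = Q (vertex n r 0) := h1
  rw [vertex_eq_corner, vertex_eq_corner, eq_iff_iff, hpar, hpar] at h2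
  simp at h2

theorem vertexPoint_succ (n : ℕ) (r : ℝ) (k : ℕ) :
    vertexPoint n r k = vertexPoint n r (k + n + 1) := by
  apply Quot.sound
  refine ⟨k, left_mem_segment ℝ _ _, ?_⟩
  simp

theorem vertexPoint_eq_of_vertex_eq {j k : ℕ} (h : vertex n r j = vertex n r k) :
    vertexPoint n r j = vertexPoint n r k := by
  unfold vertexPoint
  congr 1
  exact Subtype.ext h

/-- The gluing allows index steps of `n + 1`. Taking `n + 1` of them moves the index by `(n + 1)² =
1 + n(n + 2)`, which is `1` modulo `2n` for even `n`. -/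
theorem oneVertex_of_even (hn : n ≠ 0) (h : Even n) : OneVertex n r := by
  have hstep : ∀ k m : ℕ, vertexPoint n r (k + m * (n + 1)) = vertexPoint n r k := by
    intro k m
    induction m with
    | zero => simp
    | succ m ih =>
      rw [← ih, vertexPoint_succ n r (k + m * (n + 1))]
      congr 1
      ring
  intro k
  induction k with
  | zero => rfl
  | succ k ih =>
    rw [← ih, ← hstep k (n + 1)]
    apply vertexPoint_eq_of_vertex_eq
    rw [vertex_eq_corner, vertex_eq_corner]
    apply corner_congr hn
    obtain ⟨m, hm⟩ := h
    refine ⟨-(m + 1), ?_⟩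
    push_cast
    have : (n : ℤ) = m + m := by exact_mod_cast hm
    rw [this]
    ring

/-- The equivalence relation generated by the identification of opposite sides when all vertices
are identified. -/
def Related (n : ℕ) (r : ℝ) (z w : ℂ) : Prop :=
  z = w ∨ (∃ k : ℤ, height n k z = apothem n r ∧ w = crossing n r k z) ∨
    (z ∈ range (corner n r) ∧ w ∈ range (corner n r))

theorem Related.symm (hn : n ≠ 0) {z w : ℂ} (h : Related n r z w) : Related n r w z := by
  rcases h with rfl | ⟨k, hk, rfl⟩ | ⟨h1, h2⟩
  · exact Or.inl rfl
  · exact Or.inr (Or.inl ⟨k + n, height_crossing_opposite hn hk, (crossing_crossing hn k z).symm⟩)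
  · exact Or.inr (Or.inr ⟨h2, h1⟩)

theorem Related.mem_range_corner (hn : 2 ≤ n) (hr : 0 < r) {z w : ℂ} (h : Related n r z w)
    (hz : z ∈ range (corner n r)) : w ∈ range (corner n r) := by
  rcases h with rfl | ⟨k, hk, rfl⟩ | ⟨h1, h2⟩
  · exact hz
  · exact (crossing_mem_range_corner_iff hn hr hk).2 hz
  · exact h2

/-- Away from the corners a point lies on at most one side, so a second crossing can only undo the
first; at a corner the last clause of `Related` absorbs everything. -/
theorem Related.trans (hn : 2 ≤ n) (hr : 0 < r) {z w x : ℂ} (hw : w ∈ polygon n r)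
    (h : Related n r z w) (h' : Related n r w x) : Related n r z x := by
  have hn' : n ≠ 0 := by omega
  by_cases hc : w ∈ range (corner n r)
  · exact Or.inr (Or.inr ⟨(h.symm hn').mem_range_corner hn hr hc, h'.mem_range_corner hn hr hc⟩)
  rcases h with rfl | ⟨k, hk, rfl⟩ | ⟨-, h2⟩
  · exact h'
  · rcases h' with rfl | ⟨j, hj, rfl⟩ | ⟨h1, -⟩
    · exact Or.inr (Or.inl ⟨k, hk, rfl⟩)
    · left
      by_cases hd : (2 * n : ℤ) ∣ j - (k + n)
      · rw [crossing_congr hn' hd, crossing_crossing hn']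
      · exact absurd (mem_range_corner_of_height_eq hn hr hw hj (height_crossing_opposite hn' hk)
          hd) hc
    · exact absurd h1 hc
  · exact absurd h2 hc

theorem proj_eq_proj_iff (hn : 2 ≤ n) (hr : 0 < r) (h1 : OneVertex n r) (z w : polygon n r) :
    proj n r z = proj n r w ↔ Related n r z w := by
  have hn' : n ≠ 0 := by omega
  constructor
  · intro h
    have h' : (Quot.mk (Glue n r) z) = Quot.mk (Glue n r) w := h
    rw [Quot.eq] at h'
    induction h' with
    | rel z w hzw =>
      exact Or.inr (Or.inl ((glue_iff hn hr z w).1 hzw))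
    | refl z => exact Or.inl rfl
    | symm z w _ ih => exact (ih (Quot.eq.2 (by assumption))).symm hn'
    | trans z w x _ _ ih1 ih2 =>
      exact (ih1 (Quot.eq.2 (by assumption))).trans hn hr w.2 (ih2 (Quot.eq.2 (by assumption)))
  · rintro (h | h | ⟨⟨j, hj⟩, ⟨k, hk⟩⟩)
    · rw [Subtype.ext h]
    · exact Quot.sound ((glue_iff hn hr z w).2 h)
    · obtain ⟨a, -, ha⟩ := exists_vertex_eq_corner (r := r) hn' j
      obtain ⟨b, -, hb⟩ := exists_vertex_eq_corner (r := r) hn' k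
      have ha' : proj n r z = vertexPoint n r a := by
        unfold vertexPoint; congr 1; exact Subtype.ext (by simp [ha, hj])
      have hb' : proj n r w = vertexPoint n r b := by
        unfold vertexPoint; congr 1; exact Subtype.ext (by simp [hb, hk])
      rw [ha', hb', h1 a, h1 b]

/-- The image of a compact Hausdorff space under a continuous closed map is Hausdorff. -/
theorem t2Space_of_isClosedMap {X Y : Type*} [TopologicalSpace X] [TopologicalSpace Y]
    [CompactSpace X] [T2Space X] {f : X → Y} (hc : Continuous f) (hf : IsClosedMap f)
    (hs : Function.Surjective f) : T2Space Y := by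
  constructor
  intro x y hxy
  have hcl : ∀ y, IsClosed (f ⁻¹' {y}) := by
    intro y
    obtain ⟨a, rfl⟩ := hs y
    have := hf {a} isClosed_singleton
    rw [image_singleton] at this
    exact this.preimage hc
  obtain ⟨U, V, hU, hV, hxU, hyV, hUV⟩ := SeparatedNhds.of_isCompact_isCompact
    (hcl x).isCompact (hcl y).isCompact
    (disjoint_left.2 fun z hz hz' => hxy (hz.symm.trans hz'))
  refine ⟨(f '' Uᶜ)ᶜ, (f '' Vᶜ)ᶜ, (hf _ hU.isClosed_compl).isOpen_compl,
    (hf _ hV.isClosed_compl).isOpen_compl, ?_, ?_, ?_⟩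
  · rintro ⟨z, hz, rfl⟩; exact hz (hxU rfl)
  · rintro ⟨z, hz, rfl⟩; exact hz (hyV rfl)
  · rw [disjoint_left]
    intro q hq hq'
    obtain ⟨z, rfl⟩ := hs q
    have hzU : z ∈ U := by by_contra h; exact hq ⟨z, h, rfl⟩
    have hzV : z ∈ V := by by_contra h; exact hq' ⟨z, h, rfl⟩
    exact disjoint_left.1 hUV hzU hzV

/-- By periodicity `2n` crossings suffice, so the relation is a finite union of closed sets. -/
theorem isClosed_related (hn : n ≠ 0) : IsClosed {q : ℂ × ℂ | Related n r q.1 q.2} := by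
  have hfin := (finite_range_corner (r := r) hn).isClosed
  have hset : {q : ℂ × ℂ | Related n r q.1 q.2} = {q : ℂ × ℂ | q.1 = q.2} ∪
      ((⋃ m ∈ Finset.range (2 * n), {q : ℂ × ℂ | height n m q.1 = apothem n r} ∩
        {q : ℂ × ℂ | q.2 = crossing n r m q.1}) ∪
      (range (corner n r)) ×ˢ (range (corner n r))) := by
    ext ⟨z, w⟩
    simp only [Related, mem_ofPred_eq, mem_union, mem_prod]
    refine or_congr Iff.rfl (or_congr ?_ Iff.rfl)
    simp only [mem_iUnion, mem_inter_iff, mem_ofPred_eq, Finset.mem_range, exists_prop]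
    constructor
    · rintro ⟨k, hk, hw⟩
      obtain ⟨m, hm, hd⟩ := exists_nat_dvd_sub hn k
      exact ⟨m, hm, by rw [← hk, height_congr hn hd], by rw [hw, crossing_congr hn hd]⟩
    · rintro ⟨m, -, h1, h2⟩
      exact ⟨m, h1, h2⟩
  rw [hset]
  refine (isClosed_eq continuous_fst continuous_snd).union (IsClosed.union ?_ (hfin.prod hfin))
  refine isClosed_biUnion_finset fun m _ => ?_
  refine (isClosed_eq ((continuous_height n m).comp continuous_fst) continuous_const).inter
    (isClosed_eq continuous_snd ?_)
  unfold crossing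
  fun_prop

theorem compactSpace_polygon (hn : n ≠ 0) : CompactSpace (polygon n r) :=
  isCompact_iff_compactSpace.1 (isCompact_polygon hn)

/-- The saturation of a closed set is the projection, along a compact factor, of a closed part of
the relation. Hence the quotient map is closed, and it carries the Hausdorff property over from the
compact polygon. -/
theorem t2Space_surface (hn : 2 ≤ n) (hr : 0 < r) (h1 : OneVertex n r) :
    T2Space (Surface n r) := by
  have hn' : n ≠ 0 := by omega
  have := compactSpace_polygon (r := r) hn'
  refine t2Space_of_isClosedMap (continuous_proj n r) ?_ (proj_surjective n r)
  intro C hC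
  rw [← (isQuotientMap_quot_mk (r := Glue n r)).isClosed_preimage]
  have hset : Quot.mk (Glue n r) ⁻¹' (proj n r '' C) = Prod.snd '' ((C ×ˢ univ) ∩
      {q : polygon n r × polygon n r | Related n r q.1 q.2}) := by
    ext w
    constructor
    · rintro ⟨z, hz, hzw⟩
      exact ⟨(z, w), ⟨⟨hz, trivial⟩, (proj_eq_proj_iff hn hr h1 z w).1 hzw⟩, rfl⟩
    · rintro ⟨⟨z, w⟩, ⟨⟨hz, -⟩, hzw⟩, rfl⟩
      exact ⟨z, hz, (proj_eq_proj_iff hn hr h1 z w).2 hzw⟩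
  rw [hset]
  have hcl : IsClosed ((C ×ˢ univ) ∩ {q : polygon n r × polygon n r | Related n r q.1 q.2}) := by
    refine (hC.prod isClosed_univ).inter ?_
    exact (isClosed_related (r := r) hn').preimage
      (f := fun q : polygon n r × polygon n r => ((q.1 : ℂ), (q.2 : ℂ))) (by fun_prop)
  exact isClosedMap_snd_of_compactSpace _ hcl

theorem compactSpace_surface (hn : n ≠ 0) : CompactSpace (Surface n r) := by
  have := compactSpace_polygon (r := r) hn
  infer_instance

theorem connectedSpace_surface (hn : n ≠ 0) : ConnectedSpace (Surface n r) := by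
  have h : IsConnected (polygon n r) :=
    ⟨⟨0, zero_mem_polygon hn⟩, (convex_polygon n r).isPreconnected⟩
  have := isConnected_iff_connectedSpace.1 h
  exact (proj_surjective n r).connectedSpace (continuous_proj n r)

/-! ### Counting the cells -/

theorem edge_congr (hn : 2 ≤ n) (hr : 0 < r) {j k : ℕ} (h : (2 * n : ℤ) ∣ j - k) :
    edge n r j = edge n r k := by
  have : {z : polygon n r | (z : ℂ) ∈ side n r j} = {z : polygon n r | (z : ℂ) ∈ side n r k} := by
    ext z
    simp only [mem_ofPred_eq]
    rw [mem_side_iff hn hr, mem_side_iff hn hr, height_congr (by omega) h]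
  rw [edge, edge, this]

theorem edge_subset_edge_opposite (hn : 2 ≤ n) (hr : 0 < r) (k : ℕ) :
    edge n r k ⊆ edge n r (k + n) := by
  have hn' : n ≠ 0 := by omega
  rintro _ ⟨z, hz, rfl⟩
  have hz' := ((mem_side_iff hn hr k z).1 hz).2
  refine ⟨⟨crossing n r k z, crossing_mem_polygon hn hr z.2 hz'⟩, ?_, ?_⟩
  · change crossing n r k z ∈ side n r (k + n)
    rw [mem_side_iff hn hr]
    refine ⟨crossing_mem_polygon hn hr z.2 hz', ?_⟩
    push_cast
    exact height_crossing_opposite hn' hz'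
  · exact (Quot.sound ((glue_iff hn hr _ _).2 ⟨k, hz', rfl⟩)).symm

theorem edge_opposite (hn : 2 ≤ n) (hr : 0 < r) (k : ℕ) : edge n r (k + n) = edge n r k := by
  refine Subset.antisymm ?_ (edge_subset_edge_opposite hn hr k)
  refine (edge_subset_edge_opposite hn hr (k + n)).trans (edge_congr hn hr ?_).subset
  exact ⟨1, by push_cast; ring⟩

/-- The midpoint of a side is not a vertex. -/
theorem apothem_mul_normal_not_mem (hn : 2 ≤ n) (hr : 0 < r) (k : ℤ) :
    (apothem n r : ℂ) * normal n k ∉ range (corner n r) := by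
  rintro ⟨j, hj⟩
  have h1 := norm_corner (n := n) hr j
  rw [hj] at h1
  simp [abs_of_pos (apothem_pos hn hr)] at h1
  exact (apothem_lt hn hr).ne h1

theorem apothem_mul_normal_mem (hn : 2 ≤ n) (k : ℤ) :
    (apothem n r : ℂ) * normal n k ∈ polygon n r := by
  have hn' : n ≠ 0 := by omega
  have := convex_polygon n r (corner_mem_polygon hn' k) (corner_mem_polygon hn' (k + 1))
    (show (0 : ℝ) ≤ 1 / 2 by norm_num) (show (0 : ℝ) ≤ 1 / 2 by norm_num) (by norm_num)
  rw [← smul_add, corner_add_corner_succ] at this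
  convert this using 1
  rw [Complex.real_smul]
  push_cast
  ring

/-- The midpoint of side `j` lies on no other side and is related only to itself and to the opposite
midpoint. So an edge `k` that contains its class has `k ≡ j` or `k ≡ j + n` modulo `2n`. -/
theorem edge_injOn (hn : 2 ≤ n) (hr : 0 < r) (h1 : OneVertex n r) :
    InjOn (edge n r) (Finset.range n) := by
  have hn' : n ≠ 0 := by omega
  intro j hj k hk hjk
  simp only [Finset.coe_range, mem_Iio] at hj hk
  set m : ℂ := (apothem n r : ℂ) * normal n j with hm
  have hmc := apothem_mul_normal_not_mem hn hr (j : ℤ)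
  have hmP := apothem_mul_normal_mem (r := r) hn (j : ℤ)
  rw [← hm] at hmc hmP
  have hmh : height n j m = apothem n r := by rw [hm, height_smul, height_normal, mul_one]
  have huniq : ∀ i : ℤ, height n i m = apothem n r → (2 * n : ℤ) ∣ i - j := fun i hi => by
    by_contra hd
    exact hmc (mem_range_corner_of_height_eq hn hr hmP hi hmh hd)
  have hmem : proj n r ⟨m, hmP⟩ ∈ edge n r k := by
    rw [← hjk]
    exact ⟨⟨m, hmP⟩, (mem_side_iff hn hr j m).2 ⟨hmP, hmh⟩, rfl⟩
  obtain ⟨z, hz, hzm⟩ := hmem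
  have hz' := ((mem_side_iff hn hr k z).1 hz).2
  rcases ((proj_eq_proj_iff hn hr h1 _ _).1 hzm).symm hn' with h | ⟨i, hi, hzi⟩ | ⟨h, -⟩
  · have h : m = z := h
    have hd := huniq k (h ▸ hz')
    obtain ⟨q, hq⟩ := hd
    have : q = 0 := by
      rcases lt_trichotomy q 0 with h0 | h0 | h0
      · nlinarith
      · exact h0
      · nlinarith
    rw [this] at hq
    omega
  · have hd := huniq i hi
    have hzi' : (z : ℂ) = crossing n r i m := hzi
    have hzc : (z : ℂ) ∉ range (corner n r) := by
      rw [hzi', crossing_mem_range_corner_iff hn hr hi]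
      exact hmc
    have hzh : height n (i + n) z = apothem n r := by
      rw [hzi']; exact height_crossing_opposite hn' hi
    have hd2 : (2 * n : ℤ) ∣ (i + n) - k := by
      by_contra hd2
      exact hzc (mem_range_corner_of_height_eq hn hr z.2 hzh hz' hd2)
    -- With `j, k < n` the number `n + j - k` lies strictly between `0` and `2n`.
    have hd3 := dvd_sub hd2 hd
    rw [show (i + n - k : ℤ) - (i - j) = n + j - k by ring] at hd3
    have := Int.le_of_dvd (by omega) hd3
    omega
  · exact absurd h hmc

theorem ncard_range_edge (hn : 2 ≤ n) (hr : 0 < r) (h1 : OneVertex n r) :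
    (range (edge n r)).ncard = n := by
  have hset : range (edge n r) = edge n r '' (Finset.range n) := by
    refine Subset.antisymm ?_ (image_subset_range _ _)
    rintro _ ⟨k, rfl⟩
    refine ⟨k % n, by simpa using Nat.mod_lt _ (by omega), ?_⟩
    have hq : ∀ q m : ℕ, edge n r (m + n * q) = edge n r m := by
      intro q m
      induction q with
      | zero => rfl
      | succ q ih => rw [← ih, mul_add, mul_one, ← add_assoc, edge_opposite hn hr]
    conv_rhs => rw [← Nat.mod_add_div k n]
    rw [hq]
  rw [hset, (edge_injOn hn hr h1).ncard_image, ncard_coe_finset, Finset.card_range]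

theorem eulerChar_eq (hn : 2 ≤ n) (hr : 0 < r) (h1 : OneVertex n r) :
    eulerChar n r = 2 - n := by
  have hset : range (vertexPoint n r) = {vertexPoint n r 0} := by
    ext x
    constructor
    · rintro ⟨k, rfl⟩; exact h1 k
    · rintro rfl; exact mem_range_self 0
  rw [eulerChar, hset, ncard_singleton, ncard_range_edge hn hr h1]
  push_cast
  ring

end Gluing

/-! ### Construction of charts -/

section Charts

variable {n : ℕ} {r : ℝ}

open Classical in
/-- The projection of the polygon to the surface, extended to the plane by a constant. -/
def toSurface (n : ℕ) (r : ℝ) (w : ℂ) : Surface n r :=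
  if h : w ∈ polygon n r then proj n r ⟨w, h⟩ else vertexPoint n r 0

theorem toSurface_of_mem {w : ℂ} (h : w ∈ polygon n r) : toSurface n r w = proj n r ⟨w, h⟩ :=
  dif_pos h

theorem toSurface_coe (z : polygon n r) : toSurface n r z = proj n r z := dif_pos z.2

theorem continuousOn_toSurface : ContinuousOn (toSurface n r) (polygon n r) := by
  rw [continuousOn_iff_continuous_domRestrict]
  exact (continuous_proj n r).congr fun z => (toSurface_coe z).symm

theorem toSurface_eq_iff (hn : 2 ≤ n) (hr : 0 < r) (h1 : OneVertex n r) {z w : ℂ}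
    (hz : z ∈ polygon n r) (hw : w ∈ polygon n r) :
    toSurface n r z = toSurface n r w ↔ Related n r z w := by
  rw [toSurface_of_mem hz, toSurface_of_mem hw, proj_eq_proj_iff hn hr h1]

theorem toSurface_corner (hn : n ≠ 0) (h1 : OneVertex n r) (k : ℤ) :
    toSurface n r (corner n r k) = vertexPoint n r 0 := by
  obtain ⟨m, -, hm⟩ := exists_vertex_eq_corner (r := r) hn k
  rw [← h1 m, toSurface_of_mem (corner_mem_polygon hn k)]
  unfold vertexPoint
  congr 1
  exact Subtype.ext hm.symm

/-- A disc cut into finitely many closed pieces, mapped to the polygon piece by piece, is an open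
subset of the surface if the pieces are glued in the same way as the sides of the polygon. -/
structure DiscPieces (n : ℕ) (r : ℝ) {ι : Type*} (C : ι → Set ℂ) (f : ι → ℂ → ℂ) (c : ℂ)
    (ρ : ℝ) : Prop where
  closed : ∀ i, IsClosed (C i)
  continuous : ∀ i, Continuous (f i)
  cover : ∀ a ∈ Metric.closedBall c ρ, ∃ i, a ∈ C i
  maps : ∀ i, ∀ a ∈ C i, a ∈ Metric.closedBall c ρ → f i a ∈ polygon n r
  injective : ∀ i j, ∀ a ∈ C i, ∀ b ∈ C j, a ∈ Metric.closedBall c ρ →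
    b ∈ Metric.closedBall c ρ → (Related n r (f i a) (f j b) ↔ a = b)
  isOpen : ∀ i, ∀ a ∈ C i, a ∈ Metric.ball c ρ → ∀ᶠ w in 𝓝 (f i a), w ∈ polygon n r →
    ∃ j, ∃ b ∈ C j, b ∈ Metric.ball c ρ ∧ f j b = w
  saturated : ∀ i, ∀ a ∈ C i, a ∈ Metric.ball c ρ → ∀ w ∈ polygon n r,
    Related n r (f i a) w → ∃ j, a ∈ C j ∧ f j a = w

/-- The pieces define one map on the closed disc, well defined and injective by `injective`, and
continuous because the finitely many pieces are closed. Fields `isOpen` and `saturated` make the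
image of the open disc open, and compactness of the closed disc makes the inverse continuous. -/
theorem DiscPieces.exists_chart {ι : Type*} [Finite ι] {C : ι → Set ℂ} {f : ι → ℂ → ℂ} {c : ℂ}
    {ρ : ℝ} (hn : 2 ≤ n) (hr : 0 < r) (h1 : OneVertex n r) (hρ : 0 < ρ)
    (h : DiscPieces n r C f c ρ) :
    ∃ φ : OpenPartialHomeomorph (Surface n r) ℂ, φ.target = Metric.ball c ρ ∧
      ∀ i, ∀ a ∈ C i, a ∈ Metric.ball c ρ → φ.symm a = toSurface n r (f i a) := by
  have := t2Space_surface hn hr h1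
  set K := Metric.closedBall c ρ
  set B := Metric.ball c ρ
  have hBK : B ⊆ K := Metric.ball_subset_closedBall
  have hcov := h.cover
  have : Nonempty ι := ⟨(hcov c (Metric.mem_closedBall_self hρ.le)).choose⟩
  choose! i hi using hcov
  let Ψ : ℂ → Surface n r := fun a => toSurface n r (f (i a) a)
  have hrel : ∀ l j, ∀ a ∈ C l, ∀ b ∈ C j, a ∈ K → b ∈ K →
      (toSurface n r (f l a) = toSurface n r (f j b) ↔ a = b) := by
    intro l j a ha b hb haK hbK
    rw [toSurface_eq_iff hn hr h1 (h.maps l a ha haK) (h.maps j b hb hbK)]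
    exact h.injective l j a ha b hb haK hbK
  have hΨ : ∀ j, ∀ a ∈ C j, a ∈ K → Ψ a = toSurface n r (f j a) := fun j a ha haK =>
    (hrel _ _ a (hi a haK) a ha haK haK).2 rfl
  have hinj : InjOn Ψ K := fun a ha b hb hab =>
    (hrel _ _ a (hi a ha) b (hi b hb) ha hb).1 hab
  have hcont : ContinuousOn Ψ K := by
    have hU : K = ⋃ j, C j ∩ K := by
      rw [← iUnion_inter, right_eq_inter]
      exact fun a ha => mem_iUnion.2 ⟨i a, hi a ha⟩
    rw [hU]
    refine (locallyFinite_of_finite _).continuousOn_iUnion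
      (fun j => (h.closed j).inter Metric.isClosed_closedBall) fun j => ?_
    refine ContinuousOn.congr (f := fun a => toSurface n r (f j a)) ?_
      (fun a ha => hΨ j a ha.1 ha.2)
    exact continuousOn_toSurface.comp (h.continuous j).continuousOn
      (fun a ha => h.maps j a ha.1 ha.2)
  have hopenB : IsOpen (Ψ '' B) := by
    rw [← (isQuotientMap_quot_mk (r := Glue n r)).isOpen_preimage, isOpen_iff_mem_nhds]
    rintro z ⟨a, ha, haz⟩
    have haz' : toSurface n r (f (i a) a) = toSurface n r z := by
      rw [toSurface_coe]; exact haz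
    rw [toSurface_eq_iff hn hr h1 (h.maps _ a (hi a (hBK ha)) (hBK ha)) z.2] at haz'
    -- Replaces the chosen piece by one that sends `a` to the representative `z` itself, so that
    -- `isOpen` describes a neighbourhood of `z`.
    obtain ⟨j, haj, hjz⟩ := h.saturated _ a (hi a (hBK ha)) ha z z.2 haz'
    have hev := h.isOpen j a haj ha
    rw [hjz] at hev
    filter_upwards [(continuous_subtype_val.tendsto z).eventually hev] with w hw
    obtain ⟨l, b, hbl, hb, hbw⟩ := hw w.2
    refine ⟨b, hb, ?_⟩
    rw [hΨ l b hbl (hBK hb), hbw, toSurface_coe]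
    rfl
  have hopen : ∀ U ⊆ B, IsOpen U → IsOpen (Ψ '' U) := by
    intro U hUB hU
    -- The image of an open `U` is the open image of the whole disc minus this compact set, by
    -- injectivity.
    have hKU : IsClosed (Ψ '' (K \ U)) :=
      (((isCompact_closedBall c ρ).diff hU).image_of_continuousOn
        (hcont.mono sdiff_subset)).isClosed
    have : Ψ '' U = Ψ '' B ∩ (Ψ '' (K \ U))ᶜ := by
      apply Subset.antisymm
      · rintro _ ⟨a, ha, rfl⟩
        refine ⟨⟨a, hUB ha, rfl⟩, ?_⟩
        rintro ⟨b, ⟨hbK, hbU⟩, hab⟩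
        exact hbU (hinj hbK (hBK (hUB ha)) hab ▸ ha)
      · rintro _ ⟨⟨a, ha, rfl⟩, hna⟩
        refine ⟨a, ?_, rfl⟩
        by_contra haU
        exact hna ⟨a, ⟨hBK ha, haU⟩, rfl⟩
    rw [this]
    exact hopenB.inter hKU.isOpen_compl
  let e : PartialEquiv ℂ (Surface n r) := (hinj.mono hBK).toPartialEquiv
  let E : OpenPartialHomeomorph ℂ (Surface n r) :=
    OpenPartialHomeomorph.ofContinuousOpenRestrict e (hcont.mono hBK) (by
      intro U hU
      obtain ⟨W, hW, rfl⟩ := isOpen_induced_iff.1 hU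
      have : e.source.domRestrict e '' (Subtype.val ⁻¹' W) = Ψ '' (B ∩ W) := by
        ext q
        constructor
        · rintro ⟨a, ha, rfl⟩; exact ⟨a, ⟨a.2, ha⟩, rfl⟩
        · rintro ⟨a, ⟨ha, haW⟩, rfl⟩; exact ⟨⟨a, ha⟩, haW, rfl⟩
      rw [this]
      exact hopen _ inter_subset_left (Metric.isOpen_ball.inter hW)) Metric.isOpen_ball
  refine ⟨E.symm, rfl, fun j a ha haB => ?_⟩
  rw [OpenPartialHomeomorph.symm_symm]
  exact hΨ j a ha (hBK haB)

theorem DiscPieces.exists_flatChart {ι : Type*} [Finite ι] {C : ι → Set ℂ} {t : ι → ℂ} {c : ℂ}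
    {ρ : ℝ} (hn : 2 ≤ n) (hr : 0 < r) (h1 : OneVertex n r) (hρ : 0 < ρ)
    (h : DiscPieces n r C (fun i a => a + t i) c ρ) {i : ι} (hi : c ∈ C i) :
    ∃ φ, IsFlatChart n r φ ∧ toSurface n r (c + t i) ∈ φ.source := by
  obtain ⟨φ, hφt, hφ⟩ := h.exists_chart hn hr h1 hρ
  have hBK : Metric.ball c ρ ⊆ Metric.closedBall c ρ := Metric.ball_subset_closedBall
  refine ⟨φ, ?_, ?_⟩
  · intro z hz
    set a := φ (proj n r z) with ha
    have haB : a ∈ Metric.ball c ρ := hφt ▸ φ.map_source hz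
    obtain ⟨j₀, hj₀⟩ := h.cover a (hBK haB)
    have hza : toSurface n r (a + t j₀) = toSurface n r z := by
      rw [← hφ j₀ a hj₀ haB, toSurface_coe, ha, φ.left_inv hz]
    rw [toSurface_eq_iff hn hr h1 (h.maps j₀ a hj₀ (hBK haB)) z.2] at hza
    obtain ⟨j, haj, hjz⟩ := h.saturated j₀ a hj₀ haB z z.2 hza
    refine ⟨-t j, ?_⟩
    have hev1 := h.isOpen j a haj haB
    -- Near `z` only one translation occurs: a piece with another translation has a compact image
    -- that avoids `a + t j`, because `b + t l = a + t j` forces `b = a` and so `t l = t j`.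
    have hev2 : ∀ᶠ w in 𝓝 (a + t j), ∀ l, ∀ b ∈ C l, b ∈ Metric.closedBall c ρ → b + t l = w →
        t l = t j := by
      rw [eventually_all]
      intro l
      by_cases hl : t l = t j
      · exact Eventually.of_forall fun _ _ _ _ _ => hl
      · have hcl : IsClosed ((fun b => b + t l) '' (C l ∩ Metric.closedBall c ρ)) :=
          (((isCompact_closedBall c ρ).inter_left (h.closed l)).image (h.continuous l)).isClosed
        filter_upwards [hcl.isOpen_compl.mem_nhds (x := a + t j) (by
          rintro ⟨b, ⟨hbl, hbK⟩, hb⟩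
          have hb : b + t l = a + t j := hb
          have := (h.injective l j b hbl a haj hbK (hBK haB)).1 (Or.inl hb)
          exact hl (by rw [this] at hb; exact add_left_cancel hb))] with w hw b hbl hbK hbw
        exact absurd ⟨b, ⟨hbl, hbK⟩, hbw⟩ hw
    simp only [hjz] at hev1 hev2
    have htend := continuous_subtype_val.tendsto z
    filter_upwards [htend.eventually hev1, htend.eventually hev2] with w hw1 hw2
    obtain ⟨l, b, hbl, hbB, hbw⟩ := hw1 w.2
    have htl := hw2 l b hbl (hBK hbB) hbw
    have : φ.symm b = proj n r w := by rw [hφ l b hbl hbB, hbw, toSurface_coe]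
    rw [← this, φ.right_inv (by rw [hφt]; exact hbB), ← hbw, htl]
    ring
  · rw [← hφ i c hi (Metric.mem_ball_self hρ)]
    exact φ.map_target (by rw [hφt]; exact Metric.mem_ball_self hρ)

theorem eventually_height_lt (hn : n ≠ 0) (z₀ : ℂ) :
    ∀ᶠ z in 𝓝 z₀, ∀ j : ℤ, height n j z₀ < apothem n r → height n j z < apothem n r := by
  have h : ∀ᶠ z in 𝓝 z₀, ∀ m ∈ Finset.range (2 * n), height n (m : ℕ) z₀ < apothem n r →
      height n (m : ℕ) z < apothem n r := by
    rw [eventually_all_finset]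
    intro m _
    by_cases hm : height n m z₀ < apothem n r
    · filter_upwards [(continuous_height n m).continuousAt.eventually_lt continuousAt_const hm]
        with z hz _ using hz
    · exact Eventually.of_forall fun z h => absurd h hm
  filter_upwards [h] with z hz j hj
  obtain ⟨m, hm, hd⟩ := exists_nat_dvd_sub hn j
  rw [height_congr hn hd] at hj ⊢
  exact hz m (Finset.mem_range.2 hm) hj

theorem exists_closedBall_height_lt (hn : n ≠ 0) (z₀ : ℂ) :
    ∃ ρ > 0, ∀ z ∈ Metric.closedBall z₀ ρ, ∀ j : ℤ, height n j z₀ < apothem n r →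
      height n j z < apothem n r :=
  Metric.nhds_basis_closedBall.eventually_iff.1 (eventually_height_lt hn z₀)

/-- A point at which only the height of index `k` can be maximal is related at most to its
translate on the opposite side. -/
theorem Related.eq_or_crossing (hn : 2 ≤ n) {k : ℤ} {z w : ℂ}
    (hz : ∀ j : ℤ, ¬ (2 * n : ℤ) ∣ j - k → height n j z < apothem n r) (h : Related n r z w) :
    w = z ∨ (height n k z = apothem n r ∧ w = crossing n r k z) := by
  have hn' : n ≠ 0 := by omega
  have key : ∀ j, height n j z = apothem n r → (2 * n : ℤ) ∣ j - k := fun j hj => by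
    by_contra hd
    exact (hz j hd).ne hj
  rcases h with rfl | ⟨j, hj, rfl⟩ | ⟨⟨j, rfl⟩, -⟩
  · exact Or.inl rfl
  · have hd := key j hj
    exact Or.inr ⟨by rw [← hj, height_congr hn' hd], crossing_congr hn' hd z⟩
  · have h1 := key j (height_corner_self n r j)
    have h2 := key (j - 1) (by simpa using height_corner_succ n r (j - 1))
    have h3 := dvd_sub h1 h2
    rw [show j - k - (j - 1 - k) = 1 by ring] at h3
    have := Int.le_of_dvd (by norm_num) h3
    omega

theorem exists_flatChart_interior (hn : 2 ≤ n) (hr : 0 < r) (h1 : OneVertex n r) {z₀ : ℂ}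
    (hz₀ : ∀ j, height n j z₀ < apothem n r) :
    ∃ φ, IsFlatChart n r φ ∧ toSurface n r z₀ ∈ φ.source := by
  have hn' : n ≠ 0 := by omega
  obtain ⟨ρ, hρ, hlt⟩ := exists_closedBall_height_lt (r := r) hn' z₀
  have hlt' : ∀ z ∈ Metric.closedBall z₀ ρ, ∀ j, height n j z < apothem n r :=
    fun z hz j => hlt z hz j (hz₀ j)
  have hrel : ∀ z ∈ Metric.closedBall z₀ ρ, ∀ w, Related n r z w → w = z := by
    intro z hz w hw
    rcases hw.eq_or_crossing (k := 0) hn (fun j _ => hlt' z hz j) with h | h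
    · exact h
    · exact absurd h.1 (hlt' z hz 0).ne
  have hP : DiscPieces n r (fun _ : Unit => univ) (fun i a => a + (fun _ : Unit => (0 : ℂ)) i)
      z₀ ρ := by
    refine ⟨fun _ => isClosed_univ, fun _ => by fun_prop, fun a _ => ⟨(), trivial⟩, ?_, ?_, ?_, ?_⟩
    · intro _ a _ ha
      rw [add_zero, mem_polygon_iff hn hr]
      exact fun j => (hlt' a ha j).le
    · intro _ _ a _ b _ ha hb
      simp only [add_zero]
      exact ⟨fun h => (hrel a ha b h).symm, fun h => Or.inl h⟩
    · intro _ a _ ha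
      simp only [add_zero]
      filter_upwards [Metric.isOpen_ball.mem_nhds ha] with w hw _
      exact ⟨(), w, trivial, hw, rfl⟩
    · intro _ a _ ha w _ hw
      simp only [add_zero] at hw ⊢
      exact ⟨(), trivial, (hrel a (Metric.ball_subset_closedBall ha) w hw).symm⟩
  simpa using hP.exists_flatChart hn hr h1 hρ (i := ()) trivial

/-- The disc around `z₀` is cut by the line of side `k`. Its inner half lies in the polygon, and its
outer half is moved into the polygon, at the opposite side, by the gluing translation. -/
theorem exists_flatChart_side (hn : 2 ≤ n) (hr : 0 < r) (h1 : OneVertex n r) {z₀ : ℂ}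
    (hz₀ : z₀ ∈ polygon n r) (hc : z₀ ∉ range (corner n r)) {k : ℤ}
    (hk : height n k z₀ = apothem n r) :
    ∃ φ, IsFlatChart n r φ ∧ toSurface n r z₀ ∈ φ.source := by
  have hn' : n ≠ 0 := by omega
  have hstrict : ∀ (k : ℤ) (z : ℂ), z ∈ polygon n r → z ∉ range (corner n r) →
      height n k z = apothem n r → ∀ j : ℤ, ¬ (2 * n : ℤ) ∣ j - k →
      height n j z < apothem n r := by
    intro k z hz hzc hk j hd
    refine lt_of_le_of_ne (height_le_of_mem hn' hr hz j) fun hj => hzc ?_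
    exact mem_range_corner_of_height_eq hn hr hz hj hk hd
  have hpos := apothem_pos hn hr
  set z₁ := crossing n r k z₀ with hz₁
  have hz₁P : z₁ ∈ polygon n r := crossing_mem_polygon hn hr hz₀ hk
  have hz₁c : z₁ ∉ range (corner n r) := mt (crossing_mem_range_corner_iff hn hr hk).1 hc
  have hz₁h : height n (k + n) z₁ = apothem n r := height_crossing_opposite hn' hk
  obtain ⟨ρ₀, hρ₀, hlt₀⟩ := exists_closedBall_height_lt (r := r) hn' z₀
  obtain ⟨ρ₁, hρ₁, hlt₁⟩ := exists_closedBall_height_lt (r := r) hn' z₁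
  -- The bound by half the apothem separates the two half discs: heights over side `k` are positive
  -- on the disc and negative on its translate.
  set ρ := min (min ρ₀ ρ₁) (apothem n r / 2) with hρdef
  have hρ : 0 < ρ := by positivity
  set T : ℂ := -(2 * apothem n r * normal n k) with hT
  have hcr : ∀ a, a + T = crossing n r k a := fun a => by rw [hT, crossing]; ring
  have hs₀ : ∀ a ∈ Metric.closedBall z₀ ρ, ∀ j : ℤ, ¬ (2 * n : ℤ) ∣ j - k →
      height n j a < apothem n r := fun a ha j hd =>
    hlt₀ a (Metric.closedBall_subset_closedBall
      ((min_le_left _ _).trans (min_le_left _ _)) ha) j (hstrict k z₀ hz₀ hc hk j hd)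
  have hs₁ : ∀ a ∈ Metric.closedBall z₀ ρ, ∀ j : ℤ, ¬ (2 * n : ℤ) ∣ j - (k + n) →
      height n j (crossing n r k a) < apothem n r := by
    intro a ha j hd
    refine hlt₁ _ ?_ j (hstrict _ z₁ hz₁P hz₁c hz₁h j hd)
    refine Metric.closedBall_subset_closedBall ((min_le_left _ _).trans (min_le_right _ _))
      (?_ : _ ∈ Metric.closedBall z₁ ρ)
    rw [hz₁, ← hcr, ← hcr, Metric.mem_closedBall, dist_add_right]
    exact ha
  have hkpos : ∀ a ∈ Metric.closedBall z₀ ρ, 0 < height n k a ∧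
      height n k (crossing n r k a) < 0 := by
    intro a ha
    rw [Metric.mem_closedBall, dist_eq_norm] at ha
    have h2 := (abs_height_le n k (a - z₀)).trans (ha.trans (min_le_right _ _))
    rw [height_sub, hk] at h2
    rw [height_crossing]
    constructor <;> linarith [abs_le.1 h2]
  have hopp : ∀ a, height n (k + n) (crossing n r k a) = 2 * apothem n r - height n k a := by
    intro a
    rw [height_add_self hn', height_crossing]; ring
  -- The value `true` stands for the inner half and `false` for the outer one.
  let C : Bool → Set ℂ := fun b => bif b then {a | height n k a ≤ apothem n r} else
    {a | apothem n r ≤ height n k a}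
  let t : Bool → ℂ := fun b => bif b then 0 else T
  have hinj : ∀ a b, crossing n r k a = crossing n r k b → a = b := fun a b h => by
    rw [← hcr, ← hcr] at h
    exact add_right_cancel h
  have hrel₀ : ∀ a ∈ Metric.closedBall z₀ ρ, ∀ w, Related n r a w →
      w = a ∨ (height n k a = apothem n r ∧ w = crossing n r k a) :=
    fun a ha w hw => hw.eq_or_crossing hn (hs₀ a ha)
  have hrel₁ : ∀ a ∈ Metric.closedBall z₀ ρ, ∀ w, Related n r (crossing n r k a) w →
      w = crossing n r k a ∨ (height n k a = apothem n r ∧ w = a) := by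
    intro a ha w hw
    rcases hw.eq_or_crossing hn (hs₁ a ha) with h | ⟨h, h'⟩
    · exact Or.inl h
    · rw [crossing_crossing hn'] at h'
      rw [hopp] at h
      exact Or.inr ⟨by linarith, h'⟩
  have hP : DiscPieces n r C (fun i a => a + t i) z₀ ρ := by
    refine ⟨?_, fun _ => by fun_prop, ?_, ?_, ?_, ?_, ?_⟩
    · rintro (_ | _)
      · exact isClosed_le continuous_const (continuous_height n k)
      · exact isClosed_le (continuous_height n k) continuous_const
    · intro a _
      rcases le_total (height n k a) (apothem n r) with h | h
      · exact ⟨true, h⟩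
      · exact ⟨false, h⟩
    · rintro (_ | _) a ha haK
      · change a + T ∈ _
        rw [hcr, mem_polygon_iff hn hr]
        intro j
        by_cases hd : (2 * n : ℤ) ∣ j - (k + n)
        · rw [height_congr hn' hd, hopp]
          have : apothem n r ≤ height n k a := ha
          linarith
        · exact (hs₁ a haK j hd).le
      · change a + 0 ∈ _
        rw [add_zero, mem_polygon_iff hn hr]
        intro j
        by_cases hd : (2 * n : ℤ) ∣ j - k
        · rw [height_congr hn' hd]; exact ha
        · exact (hs₀ a haK j hd).le
    · rintro (_ | _) (_ | _) a ha b hb haK hbK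
      · change Related n r (a + T) (b + T) ↔ _
        rw [hcr, hcr]
        refine ⟨fun h => ?_, fun h => Or.inl (by rw [h])⟩
        rcases hrel₁ a haK _ h with h | ⟨-, h⟩
        · exact (hinj _ _ h).symm
        · have h3 := (hkpos b hbK).2
          rw [h] at h3
          exact absurd h3 (hkpos a haK).1.le.not_gt
      · change Related n r (a + T) (b + 0) ↔ _
        rw [hcr, add_zero]
        constructor
        · intro h
          rcases hrel₁ a haK _ h with h | ⟨-, h⟩
          · have h3 := (hkpos a haK).2
            rw [← h] at h3
            exact absurd h3 (hkpos b hbK).1.le.not_gt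
          · exact h.symm
        · rintro rfl
          exact Related.symm hn' (Or.inr (Or.inl ⟨k, le_antisymm hb ha, rfl⟩))
      · change Related n r (a + 0) (b + T) ↔ _
        rw [hcr, add_zero]
        constructor
        · intro h
          rcases hrel₀ a haK _ h with h | ⟨-, h⟩
          · have h3 := (hkpos b hbK).2
            rw [h] at h3
            exact absurd h3 (hkpos a haK).1.le.not_gt
          · exact (hinj _ _ h).symm
        · rintro rfl
          exact Or.inr (Or.inl ⟨k, le_antisymm ha hb, rfl⟩)
      · change Related n r (a + 0) (b + 0) ↔ _
        rw [add_zero, add_zero]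
        refine ⟨fun h => ?_, fun h => Or.inl h⟩
        rcases hrel₀ a haK _ h with h | ⟨-, h⟩
        · exact h.symm
        · have h3 := (hkpos a haK).2
          rw [← h] at h3
          exact absurd h3 (hkpos b hbK).1.le.not_gt
    · rintro (_ | _) a ha haB
      · change ∀ᶠ w in 𝓝 (a + T), _
        have hcont : Tendsto (fun w => w - T) (𝓝 (a + T)) (𝓝 a) := by
          have : Continuous fun w : ℂ => w - T := by fun_prop
          simpa using this.tendsto (a + T)
        filter_upwards [hcont.eventually (Metric.isOpen_ball.mem_nhds haB)] with w hw hwP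
        refine ⟨false, w - T, ?_, hw, sub_add_cancel w T⟩
        change apothem n r ≤ height n k (w - T)
        have h2 := height_le_of_mem hn' hr hwP (k + n)
        have h3 := hopp (w - T)
        rw [← hcr, sub_add_cancel] at h3
        linarith
      · change ∀ᶠ w in 𝓝 (a + 0), _
        rw [add_zero]
        filter_upwards [Metric.isOpen_ball.mem_nhds haB] with w hw hwP
        exact ⟨true, w, height_le_of_mem hn' hr hwP k, hw, add_zero w⟩
    · rintro (_ | _) a ha haB w hwP hw
      · change Related n r (a + T) w at hw
        rw [hcr] at hw
        rcases hrel₁ a (Metric.ball_subset_closedBall haB) w hw with h | ⟨h, h'⟩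
        · exact ⟨false, ha, by rw [h]; exact hcr a⟩
        · exact ⟨true, h.le, by rw [h']; exact add_zero a⟩
      · change Related n r (a + 0) w at hw
        rw [add_zero] at hw
        rcases hrel₀ a (Metric.ball_subset_closedBall haB) w hw with h | ⟨h, h'⟩
        · exact ⟨true, ha, by rw [h]; exact add_zero a⟩
        · exact ⟨false, h.ge, by rw [h']; exact hcr a⟩
  have := hP.exists_flatChart hn hr h1 hρ (i := true) (show height n k z₀ ≤ apothem n r from hk.le)
  change ∃ φ, IsFlatChart n r φ ∧ toSurface n r (z₀ + 0) ∈ φ.source at this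
  rwa [add_zero] at this

theorem conePoints_subset (hn : 2 ≤ n) (hr : 0 < r) (h1 : OneVertex n r) :
    conePoints n r ⊆ {vertexPoint n r 0} := by
  intro x hx
  obtain ⟨z, rfl⟩ := proj_surjective n r x
  rw [← toSurface_coe] at hx ⊢
  by_cases hc : (z : ℂ) ∈ range (corner n r)
  · obtain ⟨k, hk⟩ := hc
    rw [← hk]
    exact toSurface_corner (by omega) h1 k
  · exfalso
    by_cases hk : ∃ k, height n k z = apothem n r
    · obtain ⟨k, hk⟩ := hk
      exact hx (exists_flatChart_side hn hr h1 z.2 hc hk)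
    · push Not at hk
      exact hx (exists_flatChart_interior hn hr h1 fun j =>
        lt_of_le_of_ne (height_le_of_mem (by omega) hr z.2 j) (hk j))

end Charts

/-! ### The chart at the vertex -/

/-- The closed sector of angle `π / n` around the direction of angle `π m / n`. -/
def sector (n : ℕ) (m : ℤ) : Set ℂ :=
  {ζ | Real.cos (Real.pi / (2 * n)) * ‖ζ‖ ≤ (ζ * cis n (-m)).re}

/-- The index of the vertex at the apex of the corner of the polygon parametrized by the
`m`-th sector. -/
def apexIndex (n : ℕ) (m : ℤ) : ℤ := (n - 1) * m + n

/-- The parametrization of a corner of the polygon by the `m`-th sector. -/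
def wedgeMap (n : ℕ) (r : ℝ) (m : ℤ) (ζ : ℂ) : ℂ := ζ ^ (n - 1) + corner n r (apexIndex n m)

section Vertex

variable {n : ℕ} {r : ℝ}

theorem sector_congr (hn : n ≠ 0) {j k : ℤ} (h : (2 * n : ℤ) ∣ j - k) :
    sector n j = sector n k := by
  have h' : (2 * n : ℤ) ∣ -j - -k := by
    rw [show -j - -k = -(j - k) by ring]; exact h.neg_right
  have := cis_congr hn h' 0
  simp only [add_zero, Int.cast_neg] at this
  simp only [sector, this]

theorem apexIndex_dvd {j k : ℤ} (h : (2 * n : ℤ) ∣ j - k) :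
    (2 * n : ℤ) ∣ apexIndex n j - apexIndex n k := by
  rw [apexIndex, apexIndex, show ((n : ℤ) - 1) * j + n - ((n - 1) * k + n) = (n - 1) * (j - k) by
    ring]
  exact h.mul_left _

/-- For even `n`, `(n - 1)² ≡ 1` modulo `2n`, so `m ↦ apexIndex n m` is injective modulo `2n`. The
same inverse `n - 1` gives surjectivity in `exists_apexIndex_dvd`: each corner is used by exactly
one sector. -/
theorem dvd_of_apexIndex_dvd (he : Even n) {j k : ℤ}
    (h : (2 * n : ℤ) ∣ apexIndex n j - apexIndex n k) : (2 * n : ℤ) ∣ j - k := by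
  obtain ⟨q, hq⟩ := h
  obtain ⟨m, hm⟩ := he
  have hm' : (n : ℤ) = m + m := by exact_mod_cast hm
  refine ⟨(n - 1) * q - (m - 1) * (j - k), ?_⟩
  unfold apexIndex at hq
  rw [hm'] at hq ⊢
  linear_combination ((m : ℤ) + m - 1) * hq

theorem exists_apexIndex_dvd (he : Even n) (q : ℤ) :
    ∃ l : ℤ, (2 * n : ℤ) ∣ apexIndex n l - q := by
  obtain ⟨m, hm⟩ := he
  have hm' : (n : ℤ) = m + m := by exact_mod_cast hm
  refine ⟨(n - 1) * (q - n), (m - 1) * (q - n), ?_⟩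
  unfold apexIndex
  rw [hm']
  ring

theorem wedgeMap_congr (hn : n ≠ 0) {j k : ℤ} (h : (2 * n : ℤ) ∣ j - k) :
    wedgeMap n r j = wedgeMap n r k := by
  funext ζ
  rw [wedgeMap, wedgeMap, corner_congr hn (apexIndex_dvd h)]

theorem exists_norm_mul_cis (hn : n ≠ 0) (ζ : ℂ) : ∃ x : ℝ, |x| ≤ n ∧ ζ = ‖ζ‖ * cis n x := by
  have hn0 : (0 : ℝ) < n := by exact_mod_cast Nat.pos_of_ne_zero hn
  have hpi := Real.pi_pos
  refine ⟨n * ζ.arg / Real.pi, ?_, ?_⟩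
  · rw [abs_div, abs_mul, abs_of_pos hpi, abs_of_pos hn0, div_le_iff₀ hpi]
    exact mul_le_mul_of_nonneg_left (Complex.abs_arg_le_pi ζ) hn0.le
  · rw [cis, show Real.pi * (n * ζ.arg / Real.pi) / n = ζ.arg by field_simp]
    exact (Complex.norm_mul_exp_arg_mul_I ζ).symm

theorem mem_sector_iff (hn : 2 ≤ n) (m : ℤ) (ζ : ℂ) :
    ζ ∈ sector n m ↔ ∃ x : ℝ, |x| ≤ 1 / 2 ∧ ζ = ‖ζ‖ * cis n (m + x) := by
  have hn' : n ≠ 0 := by omega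
  have hn0 : (0 : ℝ) < n := by exact_mod_cast Nat.pos_of_ne_zero hn'
  have hpi := Real.pi_pos
  have hα0 := half_angle_pos hn'
  have hα1 := half_angle_le hn
  have habs : ∀ x : ℝ, |Real.pi * x / n| = Real.pi * |x| / n := fun x => by
    rw [abs_div, abs_mul, abs_of_pos hpi, abs_of_pos hn0]
  have hre : ∀ x : ℝ, ζ = ‖ζ‖ * cis n (m + x) →
      (ζ * cis n (-m)).re = ‖ζ‖ * Real.cos (Real.pi * |x| / n) := by
    intro x hx
    have h2 : ζ * cis n (-m) = ‖ζ‖ * cis n x := by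
      conv_lhs => rw [hx]
      rw [mul_assoc, ← cis_add]
      congr 2
      ring
    rw [h2, Complex.re_ofReal_mul, cis_re, ← Real.cos_abs, habs]
  constructor
  · intro h
    obtain ⟨y, hy, hξ⟩ := exists_norm_mul_cis hn' (ζ * cis n (-m))
    have hnorm : ‖ζ * cis n (-m)‖ = ‖ζ‖ := by simp
    rw [hnorm] at hξ
    have hζ : ζ = ‖ζ‖ * cis n (m + y) := by
      rw [cis_add, mul_left_comm, ← hξ, mul_left_comm, cis_mul_cis_neg, mul_one]
    rcases eq_or_ne ζ 0 with h0 | h0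
    · exact ⟨0, by norm_num, by simp [h0]⟩
    refine ⟨y, ?_, hζ⟩
    by_contra! hlt
    have h3 : Real.cos (Real.pi * |y| / n) < Real.cos (Real.pi / (2 * n)) := by
      apply Real.cos_lt_cos_of_nonneg_of_le_pi hα0.le
      · rw [div_le_iff₀ hn0]
        exact mul_le_mul_of_nonneg_left hy hpi.le
      · rw [div_lt_div_iff₀ (by positivity) hn0]
        have := mul_lt_mul_of_pos_left hlt (mul_pos hpi hn0)
        linarith
    have h4 : Real.cos (Real.pi / (2 * n)) * ‖ζ‖ ≤ (ζ * cis n (-m)).re := h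
    rw [hre y hζ] at h4
    have := norm_pos_iff.2 h0
    nlinarith
  · rintro ⟨x, hx, hζ⟩
    change Real.cos (Real.pi / (2 * n)) * ‖ζ‖ ≤ (ζ * cis n (-m)).re
    rw [hre x hζ, mul_comm]
    refine mul_le_mul_of_nonneg_left ?_ (norm_nonneg _)
    apply Real.cos_le_cos_of_nonneg_of_le_pi (by positivity) (by linarith)
    rw [div_le_div_iff₀ hn0 (by positivity)]
    have := mul_le_mul_of_nonneg_left hx (mul_pos hpi hn0).le
    linarith

theorem exists_mem_sector (hn : 2 ≤ n) (ζ : ℂ) : ∃ m : ℤ, ζ ∈ sector n m := by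
  obtain ⟨x, -, hx⟩ := exists_norm_mul_cis (n := n) (by omega) ζ
  refine ⟨round x, (mem_sector_iff hn _ _).2 ⟨x - round x, abs_sub_round x, ?_⟩⟩
  rw [add_sub_cancel]
  exact hx

theorem zero_mem_sector (n : ℕ) (m : ℤ) : (0 : ℂ) ∈ sector n m := by simp [sector]

theorem isClosed_sector (n : ℕ) (m : ℤ) : IsClosed (sector n m) :=
  isClosed_le (by fun_prop) (by fun_prop)

/-- The bisector of sector `m` goes to the direction `apexIndex n m + n`, from the apex to the
centre of the polygon; this explains the choice of `apexIndex`. Angles from the bisector are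
multiplied by `n - 1`. -/
theorem wedgeMap_polar (hn : 2 ≤ n) (m : ℤ) (ρ x : ℝ) :
    wedgeMap n r m (ρ * cis n (m + x)) = corner n r (apexIndex n m) +
      (ρ ^ (n - 1) : ℝ) * cis n (apexIndex n m + n + (n - 1) * x) := by
  rw [wedgeMap, mul_pow, ← cis_nat_mul, add_comm]
  congr 1
  push_cast [Nat.cast_sub (show 1 ≤ n by omega), apexIndex]
  congr 1
  rw [← cis_add_period (by omega : n ≠ 0) _ 1]
  congr 1
  push_cast
  ring

/-- The power is common to all sectors, so neighbouring wedge maps differ by a translation. It is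
the crossing of one of the two sides at the apex: side `apexIndex n m` towards sector `m - 1`, and
the preceding side towards sector `m + 1`. -/
theorem wedgeMap_pred (hn : n ≠ 0) (m : ℤ) (ζ : ℂ) :
    wedgeMap n r (m - 1) ζ = crossing n r (apexIndex n m) (wedgeMap n r m ζ) := by
  have h : corner n r (apexIndex n (m - 1)) = -corner n r (apexIndex n m + 1) := by
    rw [← corner_add_self hn]
    exact corner_congr hn ⟨-1, by unfold apexIndex; ring⟩
  rw [crossing, wedgeMap, wedgeMap, h, ← corner_add_corner_succ]
  ring

theorem wedgeMap_succ (hn : n ≠ 0) (m : ℤ) (ζ : ℂ) :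
    wedgeMap n r (m + 1) ζ = crossing n r (apexIndex n m - 1) (wedgeMap n r m ζ) := by
  have h : corner n r (apexIndex n (m + 1)) = -corner n r (apexIndex n m - 1) := by
    rw [← corner_add_self hn]
    exact corner_congr hn ⟨0, by unfold apexIndex; ring⟩
  rw [crossing, wedgeMap, wedgeMap, h, ← corner_add_corner_succ, sub_add_cancel]
  ring

/-- Polar coordinates at corner `k`, with the angle `y` taken from the inward direction in units of
`π / n`. Here and in `height_pred_corner_add` the constraints of the two sides become signs of
cosines, and for `|y| ≤ n` they hold together exactly when `|y| ≤ (n - 1) / 2`, half the angle of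
the corner. Side `k` is the ray `y = -(n - 1) / 2`, and side `k - 1` the ray `y = (n - 1) / 2`. -/
theorem height_corner_add (hn : n ≠ 0) (k : ℤ) (σ y : ℝ) :
    height n k (corner n r k + σ * cis n (k + n + y)) =
      apothem n r - σ * Real.cos (Real.pi * (y - 1 / 2) / n) := by
  rw [height_add, height_corner_self, height_smul, height, ← cis_add,
    show (k + n + y + -(k + 1 / 2) : ℝ) = (y - 1 / 2) + n by ring, cis_add_self hn, Complex.neg_re,
    cis_re]
  ring

theorem height_pred_corner_add (hn : n ≠ 0) (k : ℤ) (σ y : ℝ) :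
    height n (k - 1) (corner n r k + σ * cis n (k + n + y)) =
      apothem n r - σ * Real.cos (Real.pi * (y + 1 / 2) / n) := by
  have h : height n (k - 1) (corner n r k) = apothem n r := by
    simpa using height_corner_succ n r (k - 1)
  rw [height_add, h, height_smul, height, ← cis_add,
    show (k + n + y + -((k - 1 : ℤ) + 1 / 2) : ℝ) = (y + 1 / 2) + n by push_cast; ring,
    cis_add_self hn, Complex.neg_re, cis_re]
  ring

theorem cos_nonneg_of_abs_le (hn : n ≠ 0) {y : ℝ} (hy : |y| ≤ n / 2) :
    0 ≤ Real.cos (Real.pi * y / n) := by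
  have hn0 : (0 : ℝ) < n := by exact_mod_cast Nat.pos_of_ne_zero hn
  have hpi := Real.pi_pos
  rw [abs_le] at hy
  apply Real.cos_nonneg_of_mem_Icc
  constructor
  · rw [le_div_iff₀ hn0]; nlinarith
  · rw [div_le_iff₀ hn0]; nlinarith

theorem cos_pos_of_abs_lt (hn : n ≠ 0) {y : ℝ} (hy : |y| < n / 2) :
    0 < Real.cos (Real.pi * y / n) := by
  have hn0 : (0 : ℝ) < n := by exact_mod_cast Nat.pos_of_ne_zero hn
  have hpi := Real.pi_pos
  rw [abs_lt] at hy
  apply Real.cos_pos_of_mem_Ioo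
  constructor
  · rw [lt_div_iff₀ hn0]; nlinarith
  · rw [div_lt_iff₀ hn0]; nlinarith

theorem cos_neg_of_lt (hn : n ≠ 0) {y : ℝ} (hy : n / 2 < y) (hy' : y < 3 * n / 2) :
    Real.cos (Real.pi * y / n) < 0 := by
  have hn0 : (0 : ℝ) < n := by exact_mod_cast Nat.pos_of_ne_zero hn
  have hpi := Real.pi_pos
  apply Real.cos_neg_of_pi_div_two_lt_of_lt
  · rw [lt_div_iff₀ hn0]; nlinarith
  · rw [div_lt_iff₀ hn0]; nlinarith

theorem height_corner_add_le (hn : n ≠ 0) (k : ℤ) {σ y : ℝ} (hσ : 0 ≤ σ)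
    (hy : |y| ≤ (n - 1) / 2) :
    height n k (corner n r k + σ * cis n (k + n + y)) ≤ apothem n r ∧
      height n (k - 1) (corner n r k + σ * cis n (k + n + y)) ≤ apothem n r := by
  rw [height_corner_add hn, height_pred_corner_add hn]
  rw [abs_le] at hy
  have h1 := cos_nonneg_of_abs_le hn (y := y - 1 / 2) (abs_le.2 ⟨by linarith, by linarith⟩)
  have h2 := cos_nonneg_of_abs_le hn (y := y + 1 / 2) (abs_le.2 ⟨by linarith, by linarith⟩)
  constructor <;> nlinarith

theorem abs_le_of_height_corner_add_le (hn : 2 ≤ n) (k : ℤ) {σ y : ℝ} (hσ : 0 < σ)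
    (hy : |y| ≤ n) (h1 : height n k (corner n r k + σ * cis n (k + n + y)) ≤ apothem n r)
    (h2 : height n (k - 1) (corner n r k + σ * cis n (k + n + y)) ≤ apothem n r) :
    |y| ≤ (n - 1) / 2 := by
  have hn' : n ≠ 0 := by omega
  have hn2 : (2 : ℝ) ≤ n := by exact_mod_cast hn
  rw [height_corner_add hn'] at h1
  rw [height_pred_corner_add hn'] at h2
  rw [abs_le] at hy
  rw [abs_le]
  constructor
  · by_contra! hlt
    have h3 := cos_neg_of_lt hn' (y := -(y - 1 / 2)) (by linarith) (by linarith)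
    rw [mul_neg, neg_div, Real.cos_neg] at h3
    nlinarith
  · by_contra! hlt
    have h3 := cos_neg_of_lt hn' (y := y + 1 / 2) (by linarith) (by linarith)
    nlinarith

theorem eq_of_height_corner_add_eq (hn : n ≠ 0) (k : ℤ) {σ y : ℝ} (hσ : 0 < σ)
    (hy : |y| ≤ (n - 1) / 2)
    (h : height n k (corner n r k + σ * cis n (k + n + y)) = apothem n r) :
    y = -((n - 1) / 2) := by
  rw [height_corner_add hn] at h
  rw [abs_le] at hy
  by_contra hne
  have hlt : -((n - 1) / 2) < y := lt_of_le_of_ne hy.1 (Ne.symm hne)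
  have h3 := cos_pos_of_abs_lt hn (y := y - 1 / 2) (abs_lt.2 ⟨by linarith, by linarith⟩)
  nlinarith

theorem eq_of_height_pred_corner_add_eq (hn : n ≠ 0) (k : ℤ) {σ y : ℝ} (hσ : 0 < σ)
    (hy : |y| ≤ (n - 1) / 2)
    (h : height n (k - 1) (corner n r k + σ * cis n (k + n + y)) = apothem n r) :
    y = (n - 1) / 2 := by
  rw [height_pred_corner_add hn] at h
  rw [abs_le] at hy
  by_contra hne
  have hlt : y < (n - 1) / 2 := lt_of_le_of_ne hy.2 hne
  have h3 := cos_pos_of_abs_lt hn (y := y + 1 / 2) (abs_lt.2 ⟨by linarith, by linarith⟩)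
  nlinarith

theorem cos_quarter (hn : n ≠ 0) : Real.cos (Real.pi * (n / 2) / n) = 0 := by
  have : (n : ℝ) ≠ 0 := by exact_mod_cast hn
  rw [show Real.pi * (n / 2) / n = Real.pi / 2 by field_simp, Real.cos_pi_div_two]

theorem height_corner_add_of_eq (hn : n ≠ 0) (k : ℤ) (σ : ℝ) {y : ℝ} (hy : y = -((n - 1) / 2)) :
    height n k (corner n r k + σ * cis n (k + n + y)) = apothem n r := by
  rw [height_corner_add hn, hy, show (-((n - 1) / 2) - 1 / 2 : ℝ) = -(n / 2) by ring, mul_neg,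
    neg_div, Real.cos_neg, cos_quarter hn]
  ring

/-- A radius of discs around the vertices which are disjoint and meet only two sides each. -/
theorem exists_radius (hn : 2 ≤ n) (hr : 0 < r) : ∃ δ : ℝ, 0 < δ ∧ δ ≤ 1 ∧
    (∀ k : ℤ, ∀ z ∈ Metric.closedBall (corner n r k) δ, ∀ j : ℤ, ¬ (2 * n : ℤ) ∣ j - k →
      ¬ (2 * n : ℤ) ∣ j - (k - 1) → height n j z < apothem n r) ∧
    ∀ (j k : ℤ) (z : ℂ), z ∈ Metric.closedBall (corner n r j) δ →
      z ∈ Metric.closedBall (corner n r k) δ → (2 * n : ℤ) ∣ j - k := by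
  have hn' : n ≠ 0 := by omega
  have hev1 : ∀ᶠ δ in 𝓝[>] (0 : ℝ), ∀ m ∈ Finset.range (2 * n),
      ∀ z ∈ Metric.closedBall (corner n r (m : ℕ)) δ, ∀ j : ℤ,
        height n j (corner n r (m : ℕ)) < apothem n r → height n j z < apothem n r := by
    rw [eventually_all_finset]
    intro m _
    obtain ⟨ρ, hρ, h⟩ := exists_closedBall_height_lt (r := r) hn' (corner n r (m : ℕ))
    filter_upwards [Ioc_mem_nhdsGT hρ] with δ hδ z hz
    exact h z (Metric.closedBall_subset_closedBall hδ.2 hz)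
  have hev2 : ∀ᶠ δ in 𝓝[>] (0 : ℝ), ∀ m ∈ Finset.range (2 * n), ∀ l ∈ Finset.range (2 * n),
      corner n r (m : ℕ) ≠ corner n r (l : ℕ) →
        2 * δ < dist (corner n r (m : ℕ)) (corner n r (l : ℕ)) := by
    simp only [eventually_all_finset]
    intro m _ l _
    by_cases h : corner n r (m : ℕ) = corner n r (l : ℕ)
    · exact Eventually.of_forall fun _ h' => absurd h h'
    · filter_upwards [Ioo_mem_nhdsGT (half_pos (dist_pos.2 h))] with δ hδ _
      linarith [hδ.2]
  -- The bound `1` ensures that `‖a‖ ≤ δ` implies `‖a‖ ^ (n - 1) ≤ δ`.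
  have hev3 : ∀ᶠ δ in 𝓝[>] (0 : ℝ), δ ∈ Ioc (0 : ℝ) 1 := Ioc_mem_nhdsGT zero_lt_one
  obtain ⟨δ, h1, h2, h3⟩ := (hev1.and (hev2.and hev3)).exists
  refine ⟨δ, h3.1, h3.2, ?_, ?_⟩
  · intro k z hz j hd hd'
    obtain ⟨m, hm, hmk⟩ := exists_nat_dvd_sub hn' k
    rw [corner_congr hn' hmk] at hz
    refine h1 m (Finset.mem_range.2 hm) z hz j ?_
    rw [← corner_congr hn' hmk]
    refine height_corner_lt hn' hr (fun h => hd ?_) (fun h => hd' ?_)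
    · rw [show j - k = -(k - j) by ring]; exact h.neg_right
    · rw [show j - (k - 1) = -(k - j - 1) by ring]; exact h.neg_right
  · intro j k z hz hz'
    obtain ⟨a, ha, haj⟩ := exists_nat_dvd_sub hn' j
    obtain ⟨b, hb, hbk⟩ := exists_nat_dvd_sub hn' k
    rw [← corner_eq_corner_iff hn hr]
    rw [corner_congr hn' haj] at hz ⊢
    rw [corner_congr hn' hbk] at hz' ⊢
    by_contra hne
    have h5 := h2 a (Finset.mem_range.2 ha) b (Finset.mem_range.2 hb) hne
    have h6 := dist_triangle_left (corner n r (a : ℕ)) (corner n r (b : ℕ)) z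
    rw [Metric.mem_closedBall] at hz hz'
    linarith

/-- The `2n` sectors of angle `π / n` fill a disc, and the power `n - 1` opens each to a corner of
angle `π(n - 1) / n`. Evenness of `n` makes the sectors run through every corner once, so the
corners close up to a single disc around the vertex. -/
theorem discPieces_wedgeMap (hn : 2 ≤ n) (hr : 0 < r) (he : Even n) :
    ∃ ρ > 0, DiscPieces n r (fun m : Fin (2 * n) => sector n (m : ℕ))
      (fun m : Fin (2 * n) => wedgeMap n r (m : ℕ)) 0 ρ := by
  have hn' : n ≠ 0 := by omega
  have hn2 : (2 : ℝ) ≤ n := by exact_mod_cast hn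
  have hN0 : n - 1 ≠ 0 := by omega
  obtain ⟨δ, hδ, hδ1, hheight, hsep⟩ := exists_radius hn hr
  have hfin : ∀ k : ℤ, ∃ m : Fin (2 * n), sector n (m : ℕ) = sector n k ∧
      wedgeMap n r (m : ℕ) = wedgeMap n r k := by
    intro k
    obtain ⟨m, hm, hd⟩ := exists_nat_dvd_sub hn' k
    exact ⟨⟨m, hm⟩, (sector_congr hn' hd).symm, (wedgeMap_congr hn' hd).symm⟩
  have hnorm : ∀ a ∈ Metric.closedBall (0 : ℂ) δ, ‖a‖ ^ (n - 1) ≤ δ := by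
    intro a ha
    rw [mem_closedBall_zero_iff] at ha
    exact (pow_le_of_le_one (norm_nonneg a) (ha.trans hδ1) hN0).trans ha
  have hball : ∀ a ∈ Metric.closedBall (0 : ℂ) δ, ∀ m,
      wedgeMap n r m a ∈ Metric.closedBall (corner n r (apexIndex n m)) δ := by
    intro a ha m
    rw [Metric.mem_closedBall, dist_eq_norm, wedgeMap, add_sub_cancel_right, norm_pow]
    exact hnorm a ha
  have hpolar : ∀ (m : ℤ), ∀ a ∈ sector n m, ∃ x : ℝ, |x| ≤ 1 / 2 ∧ a = ‖a‖ * cis n (m + x) ∧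
      |(n - 1) * x| ≤ ((n : ℝ) - 1) / 2 ∧
      wedgeMap n r m a = corner n r (apexIndex n m) +
        (‖a‖ ^ (n - 1) : ℝ) * cis n (apexIndex n m + n + (n - 1) * x) := by
    intro m a ha
    obtain ⟨x, hx, hax⟩ := (mem_sector_iff hn m a).1 ha
    refine ⟨x, hx, hax, ?_, ?_⟩
    · rw [abs_mul, abs_of_pos (by linarith : (0 : ℝ) < n - 1)]
      nlinarith
    · rw [← wedgeMap_polar hn, ← hax]
  have hmaps : ∀ (m : ℤ), ∀ a ∈ sector n m, a ∈ Metric.closedBall (0 : ℂ) δ →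
      wedgeMap n r m a ∈ polygon n r := by
    intro m a ha haK
    obtain ⟨x, hx, hax, hy, hw⟩ := hpolar m a ha
    obtain ⟨h1, h2⟩ := height_corner_add_le (r := r) hn' (apexIndex n m)
      (pow_nonneg (norm_nonneg a) (n - 1)) hy
    rw [← hw] at h1 h2
    rw [mem_polygon_iff hn hr]
    intro j
    by_cases hd : (2 * n : ℤ) ∣ j - apexIndex n m
    · rwa [height_congr hn' hd]
    by_cases hd' : (2 * n : ℤ) ∣ j - (apexIndex n m - 1)
    · rwa [height_congr hn' hd']
    exact (hheight _ _ (hball a haK m) j hd hd').le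
  have hzero : ∀ m, wedgeMap n r m 0 = corner n r (apexIndex n m) := by
    intro m
    rw [wedgeMap, zero_pow hN0, zero_add]
  have hsat : ∀ (m : ℤ), ∀ a ∈ sector n m, a ∈ Metric.closedBall (0 : ℂ) δ → ∀ w,
      Related n r (wedgeMap n r m a) w → ∃ l : ℤ, a ∈ sector n l ∧ wedgeMap n r l a = w := by
    intro m a ha haK w hw
    rcases eq_or_ne a 0 with rfl | ha0
    · rw [hzero] at hw
      obtain ⟨q, rfl⟩ := hw.mem_range_corner hn hr (mem_range_self _)
      obtain ⟨l, hl⟩ := exists_apexIndex_dvd he q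
      exact ⟨l, zero_mem_sector n l, by rw [hzero, corner_congr hn' hl]⟩
    have hpos := norm_pos_iff.2 ha0
    obtain ⟨x, hx, hax, hy, hwa⟩ := hpolar m a ha
    rcases hw with h | ⟨j, hj, rfl⟩ | ⟨⟨q, hq⟩, -⟩
    · exact ⟨m, ha, h⟩
    · have hcase : (2 * n : ℤ) ∣ j - apexIndex n m ∨ (2 * n : ℤ) ∣ j - (apexIndex n m - 1) := by
        by_contra! hc
        exact (hheight _ _ (hball a haK m) j hc.1 hc.2).ne hj
      rcases hcase with hd | hd
      · rw [height_congr hn' hd, hwa] at hj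
        have hyx := eq_of_height_corner_add_eq hn' _ (pow_pos hpos _) hy hj
        have hxv : x = -(1 / 2) := by
          have : ((n : ℝ) - 1) * (x + 1 / 2) = 0 := by linarith
          rcases mul_eq_zero.1 this with h | h <;> linarith
        refine ⟨m - 1, (mem_sector_iff hn _ _).2 ⟨1 / 2, by norm_num, ?_⟩, ?_⟩
        · rw [hax, hxv]
          simp only [norm_mul, norm_cis, Complex.norm_real, norm_norm, mul_one]
          congr 2
          push_cast
          ring
        · rw [wedgeMap_pred hn', crossing_congr hn' hd]
      · rw [height_congr hn' hd, hwa] at hj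
        have hyx := eq_of_height_pred_corner_add_eq hn' _ (pow_pos hpos _) hy hj
        have hxv : x = 1 / 2 := by
          have : ((n : ℝ) - 1) * (x - 1 / 2) = 0 := by linarith
          rcases mul_eq_zero.1 this with h | h <;> linarith
        refine ⟨m + 1, (mem_sector_iff hn _ _).2 ⟨-(1 / 2), by rw [abs_neg]; norm_num, ?_⟩, ?_⟩
        · rw [hax, hxv]
          simp only [norm_mul, norm_cis, Complex.norm_real, norm_norm, mul_one]
          congr 2
          push_cast
          ring
        · rw [wedgeMap_succ hn', crossing_congr hn' hd]
    · exfalso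
      have hd := hsep q (apexIndex n m) (corner n r q) (Metric.mem_closedBall_self hδ.le)
        (hq ▸ hball a haK m)
      rw [corner_congr hn' hd, wedgeMap] at hq
      have : a ^ (n - 1) = 0 := by
        have := hq.symm
        rwa [add_eq_right] at this
      exact ha0 (pow_eq_zero_iff hN0 |>.1 this)
  -- The discs around the corners are disjoint, so equal images have the same apex and hence the
  -- same sector. There `|x - y| ≤ 1`, so the angles multiplied by `n - 1` differ by less than the
  -- period `2n`, and the power is injective.
  have hinj : ∀ m l : ℤ, ∀ a ∈ sector n m, ∀ b ∈ sector n l, a ∈ Metric.closedBall (0 : ℂ) δ →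
      b ∈ Metric.closedBall (0 : ℂ) δ → wedgeMap n r m a = wedgeMap n r l b → a = b := by
    intro m l a ha b hb haK hbK hab
    have hd := hsep _ _ _ (hball a haK m) (hab ▸ hball b hbK l)
    have hml := dvd_of_apexIndex_dvd he hd
    rw [wedgeMap, wedgeMap, corner_congr hn' hd] at hab
    have hpow : a ^ (n - 1) = b ^ (n - 1) := add_right_cancel hab
    have hnab : ‖a‖ = ‖b‖ := by
      have h2 : ‖a‖ ^ (n - 1) = ‖b‖ ^ (n - 1) := by rw [← norm_pow, ← norm_pow, hpow]
      exact (pow_left_inj₀ (norm_nonneg _) (norm_nonneg _) hN0).1 h2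
    rw [← sector_congr hn' hml] at hb
    obtain ⟨x, hx, hax⟩ := (mem_sector_iff hn m a).1 ha
    obtain ⟨y, hy, hby⟩ := (mem_sector_iff hn m b).1 hb
    rcases eq_or_ne a 0 with rfl | ha0
    · rw [norm_zero] at hnab
      exact (norm_eq_zero.1 hnab.symm).symm
    have hcis : cis n ((n - 1 : ℕ) * (m + x)) = cis n ((n - 1 : ℕ) * (m + y)) := by
      rw [hax, hby, hnab, mul_pow, mul_pow, ← cis_nat_mul, ← cis_nat_mul] at hpow
      refine mul_left_cancel₀ (pow_ne_zero _ ?_) hpow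
      rw [← hnab]
      exact_mod_cast (norm_pos_iff.2 ha0).ne'
    rw [cis, cis, Complex.exp_eq_exp_iff_exists_int] at hcis
    obtain ⟨q, hq⟩ := hcis
    have hq' : Real.pi * ((n - 1 : ℕ) * (m + x)) / n =
        Real.pi * ((n - 1 : ℕ) * (m + y)) / n + q * (2 * Real.pi) := by
      have := congrArg Complex.im hq
      simpa using this
    have hn0 : (0 : ℝ) < n := by linarith
    have hpi := Real.pi_pos
    have hNr : ((n - 1 : ℕ) : ℝ) = n - 1 := by
      rw [Nat.cast_sub (by omega)]; simp
    rw [hNr] at hq'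
    have hq2 : ((n : ℝ) - 1) * (x - y) = 2 * n * q := by
      field_simp at hq'
      linarith
    rw [abs_le] at hx hy
    have hq0 : q = 0 := by
      have hlt : |((2 * n * q : ℝ))| < 2 * n := by
        rw [← hq2, abs_lt]
        constructor <;> nlinarith
      rw [abs_mul, abs_of_pos (by linarith : (0 : ℝ) < 2 * n)] at hlt
      have h3 : |(q : ℝ)| < 1 := by
        by_contra! h4
        nlinarith
      exact Int.abs_lt_one_iff.1 (by exact_mod_cast h3)
    rw [hq0] at hq2
    have hxy : x = y := by
      have : ((n : ℝ) - 1) * (x - y) = 0 := by simpa using hq2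
      rcases mul_eq_zero.1 this with h | h <;> linarith
    rw [hax, hby, hnab, hxy]
  have hglue : ∀ m l : ℤ, ∀ a ∈ sector n m, a ∈ sector n l → a ∈ Metric.closedBall (0 : ℂ) δ →
      Related n r (wedgeMap n r m a) (wedgeMap n r l a) := by
    intro m l a ha hal haK
    rcases eq_or_ne a 0 with rfl | ha0
    · rw [hzero, hzero]
      exact Or.inr (Or.inr ⟨mem_range_self _, mem_range_self _⟩)
    have hcross : ∀ (m : ℤ) (x : ℝ), x = -(1 / 2) → a = ‖a‖ * cis n (m + x) →
        Related n r (wedgeMap n r m a) (wedgeMap n r (m - 1) a) := by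
      intro m x hx hax
      refine Or.inr (Or.inl ⟨apexIndex n m, ?_, wedgeMap_pred hn' m a⟩)
      have := wedgeMap_polar (r := r) hn m ‖a‖ x
      rw [← hax] at this
      rw [this]
      exact height_corner_add_of_eq hn' _ _ (by rw [hx]; ring)
    obtain ⟨x, hx, hax⟩ := (mem_sector_iff hn m a).1 ha
    obtain ⟨y, hy, hay⟩ := (mem_sector_iff hn l a).1 hal
    have hcis : cis n (m + x) = cis n (l + y) := by
      have h2 : (‖a‖ : ℂ) * cis n (m + x) = ‖a‖ * cis n (l + y) := by rw [← hax, ← hay]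
      refine mul_left_cancel₀ ?_ h2
      exact_mod_cast (norm_pos_iff.2 ha0).ne'
    rw [cis, cis, Complex.exp_eq_exp_iff_exists_int] at hcis
    obtain ⟨q, hq⟩ := hcis
    have hq' : Real.pi * (m + x) / n = Real.pi * (l + y) / n + q * (2 * Real.pi) := by
      have := congrArg Complex.im hq
      simpa using this
    have hn0 : (0 : ℝ) < n := by linarith
    have hpi := Real.pi_pos
    have hq2 : (m : ℝ) + x = l + y + 2 * n * q := by
      field_simp at hq'
      linarith
    rw [abs_le] at hx hy
    -- The distance of the two sectors modulo `2n`. It equals `y - x`, of absolute value at most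
    -- `1`, so the sectors are equal or adjacent.
    set d : ℤ := m - l - 2 * n * q with hd
    have hdr : (d : ℝ) = y - x := by rw [hd]; push_cast; linarith
    have hd1 : d ≤ 1 := by
      have : (d : ℝ) ≤ 1 := by linarith
      exact_mod_cast this
    have hd2 : -1 ≤ d := by
      have : (-1 : ℝ) ≤ d := by linarith
      exact_mod_cast this
    have hcases : d = -1 ∨ d = 0 ∨ d = 1 := by omega
    rcases hcases with h | h | h
    · rw [h] at hdr
      push_cast at hdr
      have h3 : (2 * n : ℤ) ∣ m - (l - 1) := ⟨q, by linarith⟩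
      rw [wedgeMap_congr hn' h3]
      exact (hcross l y (by linarith) hay).symm hn'
    · have h3 : (2 * n : ℤ) ∣ m - l := ⟨q, by linarith⟩
      rw [wedgeMap_congr hn' h3]
      exact Or.inl rfl
    · rw [h] at hdr
      push_cast at hdr
      have h3 : (2 * n : ℤ) ∣ l - (m - 1) := ⟨-q, by linarith⟩
      rw [wedgeMap_congr hn' h3]
      exact hcross m x (by linarith) hax
  refine ⟨δ, hδ, fun m => isClosed_sector n _, ?_, ?_, fun m a => hmaps m a, ?_, ?_, ?_⟩
  · intro m
    unfold wedgeMap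
    fun_prop
  · intro a _
    obtain ⟨k, hk⟩ := exists_mem_sector hn a
    obtain ⟨m, hm, -⟩ := hfin k
    exact ⟨m, by rwa [hm]⟩
  · intro m l a ha b hb haK hbK
    constructor
    · intro h
      obtain ⟨k, hak, hk⟩ := hsat m a ha haK _ h
      exact hinj k l a hak b hb haK hbK hk
    · rintro rfl
      exact hglue m l a ha hb haK
  · intro m a ha haB
    set k := apexIndex n (m : ℕ) with hk
    -- The power carries the disc of radius `δ` to that of radius `δ ^ (n - 1)`, so the part of the
    -- polygon in this smaller disc is covered by sector `m` alone.
    have hw : wedgeMap n r (m : ℕ) a ∈ Metric.ball (corner n r k) (δ ^ (n - 1)) := by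
      rw [Metric.mem_ball, dist_eq_norm, wedgeMap, add_sub_cancel_right, norm_pow]
      rw [mem_ball_zero_iff] at haB
      exact pow_lt_pow_left₀ haB (norm_nonneg a) hN0
    filter_upwards [Metric.isOpen_ball.mem_nhds hw] with w hwB hwP
    rw [Metric.mem_ball, dist_eq_norm] at hwB
    refine ⟨m, ?_⟩
    rcases eq_or_ne w (corner n r k) with hwk | hwk
    · exact ⟨0, zero_mem_sector n _, Metric.mem_ball_self hδ, by rw [hzero, hwk]⟩
    set σ := ‖w - corner n r k‖ with hσ
    have hσ0 : 0 < σ := norm_pos_iff.2 (sub_ne_zero.2 hwk)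
    obtain ⟨y, hy, hwy⟩ := exists_norm_mul_cis hn' ((w - corner n r k) * cis n (-(k + n)))
    have hnw : ‖(w - corner n r k) * cis n (-(k + n))‖ = σ := by simp [hσ]
    rw [hnw] at hwy
    have hwp : w = corner n r k + σ * cis n (k + n + y) := by
      rw [cis_add, mul_left_comm, ← hwy, mul_left_comm, cis_mul_cis_neg, mul_one]
      ring
    have h1 := height_le_of_mem hn' hr hwP k
    have h2 := height_le_of_mem hn' hr hwP (k - 1)
    rw [hwp] at h1 h2
    have hyN := abs_le_of_height_corner_add_le hn k hσ0 hy h1 h2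
    -- The preimage of `w`: the root of its distance to the apex, at the angle `y / (n - 1)` from
    -- the bisector.
    set ρ : ℝ := σ ^ ((n - 1 : ℕ) : ℝ)⁻¹ with hρ
    have hρ0 : 0 ≤ ρ := Real.rpow_nonneg hσ0.le _
    have hρpow : ρ ^ (n - 1) = σ := Real.rpow_inv_natCast_pow hσ0.le hN0
    have hn1 : (0 : ℝ) < n - 1 := by linarith
    have hnρ : ‖(ρ : ℂ) * cis n ((m : ℕ) + y / (n - 1))‖ = ρ := by
      simp [abs_of_nonneg hρ0]
    refine ⟨ρ * cis n ((m : ℕ) + y / (n - 1)), ?_, ?_, ?_⟩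
    · refine (mem_sector_iff hn _ _).2 ⟨y / (n - 1), ?_, ?_⟩
      · rw [abs_div, abs_of_pos hn1, div_le_iff₀ hn1]
        linarith
      · rw [hnρ]
        push_cast
        rfl
    · rw [mem_ball_zero_iff, hnρ]
      by_contra! hle
      have := pow_le_pow_left₀ hδ.le hle (n - 1)
      rw [hρpow] at this
      linarith
    · have := wedgeMap_polar (r := r) hn (m : ℕ) ρ (y / (n - 1))
      rw [mul_div_cancel₀ _ hn1.ne', hρpow, ← hk] at this
      rw [hwp, ← this]
      push_cast
      rfl
  · intro m a ha haB w _ hw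
    obtain ⟨k, hak, hk⟩ := hsat m a ha (Metric.ball_subset_closedBall haB) w hw
    obtain ⟨l, hl, hl'⟩ := hfin k
    exact ⟨l, by rwa [hl], by rw [hl', hk]⟩

end Vertex

/-! ### The cone point and the oriented atlas -/

section Cone

variable {n : ℕ} {r : ℝ}

/-- For `n = 2` the exponent `n - 1` is `1`, so the wedge maps are translations and the chart at the
vertex is flat. -/
theorem conePoints_eq_empty (hr : 0 < r) (h1 : OneVertex 2 r) : conePoints 2 r = ∅ := by
  obtain ⟨ρ, hρ, h⟩ := discPieces_wedgeMap (n := 2) le_rfl hr even_two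
  have hfun : (fun m : Fin (2 * 2) => wedgeMap 2 r (m : ℕ)) = fun (m : Fin (2 * 2)) (a : ℂ) =>
      a + (fun m : Fin (2 * 2) => corner 2 r (apexIndex 2 (m : ℕ))) m := by
    funext m a
    simp [wedgeMap]
  rw [hfun] at h
  have hflat := h.exists_flatChart le_rfl hr h1 hρ (i := 0) (zero_mem_sector 2 _)
  rw [zero_add, toSurface_corner (by norm_num) h1] at hflat
  rw [eq_empty_iff_forall_notMem]
  intro x hx
  have hx' : x = vertexPoint 2 r 0 := conePoints_subset le_rfl hr h1 hx
  exact hx (hx' ▸ hflat)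

/-- In every direction there are two different vertices from which one can move into the interior
of the polygon, if it has at least eight sides. -/
theorem exists_two_corners (hn : 4 ≤ n) (hr : 0 < r) {u : ℂ} (hu : u ≠ 0) :
    ∃ (k l : ℤ) (ε : ℝ), 0 < ε ∧ corner n r k ≠ corner n r l ∧ ∀ t ∈ Ioo 0 ε,
      (∀ j, height n j (corner n r k + t * u) < apothem n r) ∧
      ∀ j, height n j (corner n r l + t * u) < apothem n r := by
  have hn' : n ≠ 0 := by omega
  have hn2 : 2 ≤ n := by omega
  have hn4 : (4 : ℝ) ≤ n := by exact_mod_cast hn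
  have hpos := norm_pos_iff.2 hu
  obtain ⟨δ, hδ, -, hheight, -⟩ := exists_radius (n := n) hn2 hr
  obtain ⟨x, -, hx⟩ := exists_norm_mul_cis hn' u
  -- For `n ≥ 4` half the angle of a corner is `(n - 1) / 2 > 1` in units of `π / n`, so a direction
  -- within one unit of the inward bisector points into the interior.
  have key : ∀ (k : ℤ) (y : ℝ), |y| ≤ 1 → u = ‖u‖ * cis n (k + n + y) → ∀ t ∈ Ioo 0 (δ / ‖u‖),
      ∀ j, height n j (corner n r k + t * u) < apothem n r := by
    intro k y hy huy t ht j
    rw [abs_le] at hy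
    have htu : 0 < t * ‖u‖ := mul_pos ht.1 hpos
    have heq : corner n r k + t * u =
        corner n r k + ((t * ‖u‖ : ℝ) : ℂ) * cis n (k + n + y) := by
      conv_lhs => rw [huy]
      push_cast
      ring
    by_cases hd : (2 * n : ℤ) ∣ j - k
    · rw [height_congr hn' hd, heq, height_corner_add hn']
      have := cos_pos_of_abs_lt hn' (y := y - 1 / 2) (abs_lt.2 ⟨by linarith, by linarith⟩)
      linarith [mul_pos htu this]
    by_cases hd' : (2 * n : ℤ) ∣ j - (k - 1)
    · rw [height_congr hn' hd', heq, height_pred_corner_add hn']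
      have := cos_pos_of_abs_lt hn' (y := y + 1 / 2) (abs_lt.2 ⟨by linarith, by linarith⟩)
      linarith [mul_pos htu this]
    refine hheight k _ ?_ j hd hd'
    have h2 := (lt_div_iff₀ hpos).1 ht.2
    rw [Metric.mem_closedBall, dist_eq_norm, add_sub_cancel_left, norm_mul, Complex.norm_real,
      Real.norm_of_nonneg ht.1.le]
    exact h2.le
  have hf0 := Int.fract_nonneg x
  have hf1 := (Int.fract_lt_one x).le
  -- The inward bisectors of these two corners have directions `⌊x⌋` and `⌊x⌋ + 1`, each within one
  -- unit of the direction `x` of `u`.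
  refine ⟨⌊x⌋ - n, ⌊x⌋ - n + 1, δ / ‖u‖, by positivity, ?_, fun t ht =>
    ⟨key _ (Int.fract x) (abs_le.2 ⟨by linarith, hf1⟩) ?_ t ht,
      key _ (Int.fract x - 1) (abs_le.2 ⟨by linarith, by linarith⟩) ?_ t ht⟩⟩
  · intro h
    rw [corner_eq_corner_iff hn2 hr, show (⌊x⌋ - n - (⌊x⌋ - n + 1) : ℤ) = -1 by ring] at h
    have := Int.le_of_dvd (by norm_num) h.neg_right
    omega
  · rw [show (((⌊x⌋ - n : ℤ) : ℝ) + n + Int.fract x) = x by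
      push_cast; linarith [Int.floor_add_fract x]]
    exact hx
  · rw [show (((⌊x⌋ - n + 1 : ℤ) : ℝ) + n + (Int.fract x - 1)) = x by
      push_cast; linarith [Int.floor_add_fract x]]
    exact hx

theorem mem_polygon_of_height_lt (hn : 2 ≤ n) (hr : 0 < r) {z : ℂ}
    (hz : ∀ j, height n j z < apothem n r) : z ∈ polygon n r :=
  (mem_polygon_iff hn hr z).2 fun j => (hz j).le

/-- The projection is injective on the interior of the polygon. -/
theorem eq_of_toSurface_eq (hn : 2 ≤ n) (hr : 0 < r) (h1 : OneVertex n r) {z w : ℂ}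
    (hz : ∀ j, height n j z < apothem n r) (hw : w ∈ polygon n r)
    (h : toSurface n r z = toSurface n r w) : w = z := by
  rw [toSurface_eq_iff hn hr h1 (mem_polygon_of_height_lt hn hr hz) hw] at h
  rcases h.eq_or_crossing (k := 0) hn (fun j _ => hz j) with h | h
  · exact h
  · exact absurd h.1 (hz 0).ne

theorem IsFlatChart.eventually_toSurface {φ : OpenPartialHomeomorph (Surface n r) ℂ}
    (hφ : IsFlatChart n r φ) {z : ℂ} (hz : z ∈ polygon n r) (hzφ : toSurface n r z ∈ φ.source) :
    ∀ᶠ w in 𝓝[polygon n r] z, toSurface n r w ∈ φ.source ∧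
      φ (toSurface n r w) = φ (toSurface n r z) + (w - z) := by
  have h1 := (continuousOn_toSurface z hz).eventually (φ.open_source.mem_nhds hzφ)
  rw [toSurface_of_mem hz] at hzφ
  obtain ⟨c, hc⟩ := hφ ⟨z, hz⟩ hzφ
  have hc0 := hc.self_of_nhds
  have h2 : ∀ᶠ w in 𝓝[polygon n r] z, φ (toSurface n r w) = w + c := by
    rw [nhdsWithin_eq_map_subtype_coe hz, eventually_map]
    filter_upwards [hc] with w hw
    rw [toSurface_coe, hw]
  filter_upwards [h1, h2] with w hw1 hw2
  refine ⟨hw1, ?_⟩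
  rw [hw2, toSurface_of_mem hz, hc0]
  ring

theorem tendsto_corner_ray (hn : 2 ≤ n) (hr : 0 < r) {u : ℂ} {k : ℤ} {ε : ℝ} (hε : 0 < ε)
    (h : ∀ t ∈ Ioo 0 ε, ∀ j, height n j (corner n r k + t * u) < apothem n r) :
    Tendsto (fun t : ℝ => corner n r k + t * u) (𝓝[>] 0) (𝓝[polygon n r] (corner n r k)) := by
  refine tendsto_nhdsWithin_iff.2 ⟨?_, ?_⟩
  · have : Continuous fun t : ℝ => corner n r k + t * u := by fun_prop
    have h2 := this.tendsto 0
    simp only [Complex.ofReal_zero, zero_mul, add_zero] at h2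
    exact h2.mono_left nhdsWithin_le_nhds
  · filter_upwards [Ioo_mem_nhdsGT hε] with t ht
    exact mem_polygon_of_height_lt hn hr (h t ht)

/-- A flat chart at the vertex would send the rays of direction `1` from two different corners to
the same segment, although the projection is injective on the interior of the polygon. -/
theorem conePoints_eq_singleton (hn : 4 ≤ n) (hr : 0 < r) (h1 : OneVertex n r) :
    conePoints n r = {vertexPoint n r 0} := by
  have hn' : n ≠ 0 := by omega
  have hn2 : 2 ≤ n := by omega
  refine (conePoints_subset hn2 hr h1).antisymm ?_
  rintro _ rfl ⟨φ, hφ, hp⟩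
  obtain ⟨k, l, ε, hε, hkl, hlt⟩ := exists_two_corners (u := 1) hn hr one_ne_zero
  have hev : ∀ k : ℤ, (∀ t ∈ Ioo 0 ε, ∀ j, height n j (corner n r k + t * 1) < apothem n r) →
      ∀ᶠ t : ℝ in 𝓝[>] 0, toSurface n r (corner n r k + t * 1) ∈ φ.source ∧
        φ (toSurface n r (corner n r k + t * 1)) = φ (vertexPoint n r 0) + t := by
    intro k hk
    have h2 := hφ.eventually_toSurface (corner_mem_polygon hn' k)
      (by rwa [toSurface_corner hn' h1])
    filter_upwards [(tendsto_corner_ray hn2 hr hε hk).eventually h2] with t ht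
    refine ⟨ht.1, ?_⟩
    rw [ht.2, toSurface_corner hn' h1]
    ring
  obtain ⟨t, ⟨ht1, ht2⟩, ⟨ht3, ht4⟩, ht⟩ := ((hev k fun t ht => (hlt t ht).1).and
    ((hev l fun t ht => (hlt t ht).2).and (Ioo_mem_nhdsGT hε))).exists
  have heq := φ.injOn ht1 ht3 (ht2.trans ht4.symm)
  have := eq_of_toSurface_eq hn2 hr h1 (hlt t ht).1
    (mem_polygon_of_height_lt hn2 hr (hlt t ht).2) heq
  exact hkl (add_right_cancel this).symm

theorem isStraightOn_ray (hn : 2 ≤ n) (hr : 0 < r) (h1 : OneVertex n r) {u z : ℂ} {ε : ℝ}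
    (h : ∀ t ∈ Ioo 0 ε, ∀ j, height n j (z + t * u) < apothem n r) :
    IsStraightOn n r u (fun t => toSurface n r (z + t * u)) (Ioo 0 ε) := by
  intro t ht
  obtain ⟨φ, hφ, hx⟩ := exists_flatChart_interior hn hr h1 (h t ht)
  refine ⟨φ, hφ, hx, ?_⟩
  have h2 := hφ.eventually_toSurface (mem_polygon_of_height_lt hn hr (h t ht)) hx
  have h3 : Tendsto (fun s : ℝ => z + s * u) (𝓝 t) (𝓝[polygon n r] (z + t * u)) := by
    refine tendsto_nhdsWithin_iff.2 ⟨?_, ?_⟩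
    · have : Continuous fun t : ℝ => z + t * u := by fun_prop
      exact this.tendsto t
    · filter_upwards [isOpen_Ioo.mem_nhds ht] with s hs
      exact mem_polygon_of_height_lt hn hr (h s hs)
  filter_upwards [h3.eventually h2] with s hs
  refine ⟨hs.1, ?_⟩
  rw [hs.2]
  push_cast
  ring

theorem exists_lines_ne (hn : 4 ≤ n) (hr : 0 < r) (h1 : OneVertex n r) {u : ℂ} (hu : u ≠ 0) :
    ∃ L ∈ lines n r u, ∃ L' ∈ lines n r u, L ≠ L' ∧ vertexPoint n r 0 ∈ L ∩ L' := by
  have hn' : n ≠ 0 := by omega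
  have hn2 : 2 ≤ n := by omega
  have := compactSpace_polygon (r := r) hn'
  have := compactSpace_surface (r := r) hn'
  have := t2Space_surface hn2 hr h1
  have hcone := conePoints_eq_singleton hn hr h1
  obtain ⟨k, l, ε, hε, hkl, hlt⟩ := exists_two_corners hn hr hu
  have hlim : ∀ k : ℤ, (∀ t ∈ Ioo 0 ε, ∀ j, height n j (corner n r k + t * u) < apothem n r) →
      Tendsto (fun t : ℝ => toSurface n r (corner n r k + t * u)) (𝓝[>] 0)
        (𝓝 (vertexPoint n r 0)) := by
    intro k hk
    have h2 : Tendsto (toSurface n r) (𝓝[polygon n r] (corner n r k))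
        (𝓝 (toSurface n r (corner n r k))) := continuousOn_toSurface _ (corner_mem_polygon hn' k)
    rw [toSurface_corner hn' h1] at h2
    exact h2.comp (tendsto_corner_ray hn2 hr hε hk)
  refine exists_lines_ne_of_rays (by rw [hcone]; exact subsingleton_singleton) hu
    (by rw [hcone]; rfl) hε (isStraightOn_ray hn2 hr h1 fun t ht => (hlt t ht).1)
    (hlim k fun t ht => (hlt t ht).1) (isStraightOn_ray hn2 hr h1 fun t ht => (hlt t ht).2)
    (hlim l fun t ht => (hlt t ht).2) ?_
  intro t ht heq
  have := eq_of_toSurface_eq hn2 hr h1 (hlt t ht).1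
    (mem_polygon_of_height_lt hn2 hr (hlt t ht).2) heq
  exact hkl (add_right_cancel this).symm

/-! ### The oriented atlas -/

theorem det_fderiv_pos {f : ℂ → ℂ} {d z : ℂ} (h : HasDerivAt f d z) (hd : d ≠ 0) :
    0 < (fderiv ℝ f z).det := by
  have hf : HasFDerivAt f (d • (1 : ℂ →L[ℝ] ℂ)) z := h.complexToReal_fderiv
  rw [hf.fderiv]
  have hdet : (d • (1 : ℂ →L[ℝ] ℂ)).det = Complex.normSq d := by
    rw [← Algebra.norm_complex_apply, Algebra.norm_apply, ContinuousLinearMap.det]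
    congr 1
  rw [hdet]
  exact Complex.normSq_pos.2 hd

theorem transition_smooth_of_hasDerivAt {S : Type*} [TopologicalSpace S]
    {φ ψ : OpenPartialHomeomorph S ℂ}
    (h : ∀ z ∈ (φ.symm.trans ψ).source, ∃ d ≠ 0, HasDerivAt (ψ ∘ φ.symm) d z) :
    ContDiffOn ℝ ∞ (ψ ∘ φ.symm) (φ.symm.trans ψ).source ∧
      ∀ z ∈ (φ.symm.trans ψ).source, 0 < (fderiv ℝ (ψ ∘ φ.symm) z).det := by
  constructor
  · have hdiff : DifferentiableOn ℂ (ψ ∘ φ.symm) (φ.symm.trans ψ).source := by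
      intro z hz
      obtain ⟨d, -, hd⟩ := h z hz
      exact hd.differentiableAt.differentiableWithinAt
    exact (hdiff.contDiffOn (φ.symm.trans ψ).open_source).restrict_scalars ℝ
  · intro z hz
    obtain ⟨d, hd0, hd⟩ := h z hz
    exact det_fderiv_pos hd hd0

/-- The atlas consists of all flat charts and the vertex chart `Φ`. Transitions between flat charts
are local translations, and from `Φ` to a flat chart they are `ζ ^ (n - 1)` plus a local constant.
The critical point `0` lies in such a transition only for `n = 2`, where the power is the identity.
-/
theorem isClosedOrientableSurface (hn : 2 ≤ n) (hr : 0 < r) (h1 : OneVertex n r) :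
    IsClosedOrientableSurface (Surface n r) := by
  have hn' : n ≠ 0 := by omega
  have he := even_of_oneVertex hn hr h1
  have := compactSpace_polygon (r := r) hn'
  have ht2 := t2Space_surface hn hr h1
  obtain ⟨ρ, hρ, hpieces⟩ := discPieces_wedgeMap hn hr he
  obtain ⟨Φ, hΦt, hΦ⟩ := hpieces.exists_chart hn hr h1 hρ
  have hΦ0 : Φ.symm 0 = vertexPoint n r 0 := by
    rw [hΦ ⟨0, by omega⟩ 0 (zero_mem_sector n _) (Metric.mem_ball_self hρ), wedgeMap,
      zero_pow (by omega), zero_add, toSurface_corner hn' h1]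
  have hlocal : ∀ ψ, IsFlatChart n r ψ → ∀ ζ₀ ∈ (Φ.symm.trans ψ).source,
      ∀ᶠ ζ in 𝓝 ζ₀, (ψ ∘ Φ.symm) ζ = ζ ^ (n - 1) + ((ψ ∘ Φ.symm) ζ₀ - ζ₀ ^ (n - 1)) := by
    intro ψ hψ ζ₀ hζ₀
    rw [OpenPartialHomeomorph.trans_source, OpenPartialHomeomorph.symm_source, hΦt] at hζ₀
    obtain ⟨hB, hψs⟩ := hζ₀
    -- The formula is checked on each sector through `ζ₀`; the additive constant is the same for
    -- all, being fixed by the value at `ζ₀`. The other sectors stay away from `ζ₀`.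
    have hev : ∀ᶠ ζ in 𝓝 ζ₀, ∀ m : Fin (2 * n), ζ ∈ sector n (m : ℕ) →
        (ψ ∘ Φ.symm) ζ = ζ ^ (n - 1) + ((ψ ∘ Φ.symm) ζ₀ - ζ₀ ^ (n - 1)) := by
      rw [eventually_all]
      intro m
      by_cases hm : ζ₀ ∈ sector n (m : ℕ)
      swap
      · filter_upwards [(isClosed_sector n (m : ℕ)).isOpen_compl.mem_nhds hm] with ζ h1 h2
        exact absurd h2 h1
      have hP := hpieces.maps m ζ₀ hm (Metric.ball_subset_closedBall hB)
      have hsrc : toSurface n r (wedgeMap n r (m : ℕ) ζ₀) ∈ ψ.source := by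
        rw [← hΦ m ζ₀ hm hB]; exact hψs
      have hev := eventually_nhdsWithin_iff.1 (hψ.eventually_toSurface hP hsrc)
      filter_upwards [(hpieces.continuous m).continuousAt.eventually hev,
        Metric.isOpen_ball.mem_nhds hB] with ζ h1 h2 hζ
      obtain ⟨-, h3⟩ := h1 (hpieces.maps m ζ hζ (Metric.ball_subset_closedBall h2))
      rw [Function.comp_apply, Function.comp_apply, hΦ m ζ hζ h2, hΦ m ζ₀ hm hB, h3]
      simp only [wedgeMap]
      ring
    filter_upwards [hev, Metric.isOpen_ball.mem_nhds hB] with ζ h1 h2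
    obtain ⟨m, hm⟩ := hpieces.cover ζ (Metric.ball_subset_closedBall h2)
    exact h1 m hm
  have hderiv : ∀ ψ, IsFlatChart n r ψ → ∀ ζ₀ ∈ (Φ.symm.trans ψ).source,
      ∃ d ≠ 0, HasDerivAt (ψ ∘ Φ.symm) d ζ₀ := by
    intro ψ hψ ζ₀ hζ₀
    refine ⟨((n - 1 : ℕ) : ℂ) * ζ₀ ^ (n - 1 - 1), ?_,
      ((hasDerivAt_pow (n - 1) ζ₀).add_const _).congr_of_eventuallyEq (hlocal ψ hψ ζ₀ hζ₀)⟩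
    refine mul_ne_zero (by exact_mod_cast (by omega : n - 1 ≠ 0)) ?_
    rcases eq_or_ne ζ₀ 0 with rfl | h0
    · have hp : vertexPoint n r 0 ∈ ψ.source := hΦ0 ▸ hζ₀.2
      have hn4 : ¬ 4 ≤ n := fun h4 => hψ.not_mem_conePoints hp (by
        rw [conePoints_eq_singleton h4 hr h1]; rfl)
      obtain ⟨m, hm⟩ := he
      rw [show n - 1 - 1 = 0 by omega]
      simp
    · exact pow_ne_zero _ h0
  refine ⟨ht2, compactSpace_surface hn', connectedSpace_surface hn',
    {φ | IsFlatChart n r φ} ∪ {Φ}, ?_, ?_⟩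
  · intro x
    by_cases hx : x ∈ conePoints n r
    · have hx' : x = vertexPoint n r 0 := conePoints_subset hn hr h1 hx
      refine ⟨Φ, Or.inr rfl, ?_⟩
      rw [hx', ← hΦ0]
      exact Φ.map_target (by rw [hΦt]; exact Metric.mem_ball_self hρ)
    · obtain ⟨φ, hφ, hxφ⟩ : ∃ φ, IsFlatChart n r φ ∧ x ∈ φ.source := by
        simpa [conePoints] using hx
      exact ⟨φ, Or.inl hφ, hxφ⟩
  · rintro φ (hφ | rfl) ψ (hψ | rfl) <;> apply transition_smooth_of_hasDerivAt
    · intro z hz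
      refine ⟨1, one_ne_zero, ?_⟩
      have hz1 : z ∈ φ.target := hz.1
      have hev := (φ.continuousAt_symm hz1).eventually
        (IsFlatChart.sub_eventuallyEq hφ hψ (φ.map_target hz1) hz.2)
      refine ((hasDerivAt_id z).add_const
        (ψ (φ.symm z) - φ (φ.symm z))).congr_of_eventuallyEq ?_
      filter_upwards [hev, φ.open_target.mem_nhds hz1] with w hw hwt
      rw [Function.comp_apply, hw, φ.right_inv hwt]
      rfl
    · intro z hz
      -- From a flat chart to the vertex chart: the transition is the inverse of the previous kind,
      -- so its derivative is the inverse of a nonzero number.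
      have hz' : z ∈ (ψ.symm.trans φ).target := by
        rw [← OpenPartialHomeomorph.symm_source, OpenPartialHomeomorph.trans_symm_eq_symm_trans_symm]
        exact hz
      obtain ⟨d, hd0, hd⟩ := hderiv φ hφ _ ((ψ.symm.trans φ).map_target hz')
      exact ⟨d⁻¹, inv_ne_zero hd0, (ψ.symm.trans φ).hasDerivAt_symm hz' hd0 hd⟩
    · exact hderiv ψ hψ
    · intro z hz
      refine ⟨1, one_ne_zero, (hasDerivAt_id z).congr_of_eventuallyEq ?_⟩
      filter_upwards [ψ.open_target.mem_nhds hz.1] with w hw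
      exact ψ.right_inv hw

end Cone

end PolygonSurface

end

/-! ### Assembly of the theorem -/

theorem theorem2 (r : ℝ) (hr : 0 < r) :
    (∀ g : ℕ, 1 ≤ g → PolygonSurface.OneVertex (2 * g) r ∧
      PolygonSurface.eulerChar (2 * g) r = 2 - 2 * (g : ℤ)) ∧
    ∀ n : ℕ, 2 ≤ n → PolygonSurface.OneVertex n r →
      PolygonSurface.IsClosedOrientableSurface (PolygonSurface.Surface n r) ∧
      ∃ g : ℕ, 1 ≤ g ∧ PolygonSurface.eulerChar n r = 2 - 2 * (g : ℤ) ∧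
        (1 < g → PolygonSurface.conePoints n r = {PolygonSurface.vertexPoint n r 0}) ∧
        (g = 1 → PolygonSurface.conePoints n r = ∅) ∧
        ∀ u : ℂ, u ≠ 0 →
          ⋃₀ PolygonSurface.lines n r u = Set.univ ∧
          (1 < g →
            PolygonSurface.singularPoints (PolygonSurface.lines n r u) =
                {PolygonSurface.vertexPoint n r 0} ∧
            ∃ L ∈ PolygonSurface.lines n r u, ∃ L' ∈ PolygonSurface.lines n r u,
              L ≠ L' ∧ PolygonSurface.vertexPoint n r 0 ∈ L ∩ L') ∧
          (g = 1 → PolygonSurface.singularPoints (PolygonSurface.lines n r u) = ∅) := by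
  open PolygonSurface in
  refine ⟨fun g hg => ?_, fun n hn h1 => ?_⟩
  · have h1 : OneVertex (2 * g) r := oneVertex_of_even (by omega) (even_two_mul g)
    refine ⟨h1, ?_⟩
    rw [eulerChar_eq (by omega) hr h1]
    push_cast
    rfl
  · have hn' : n ≠ 0 := by omega
    have := compactSpace_polygon (r := r) hn'
    have := compactSpace_surface (r := r) hn'
    have := t2Space_surface hn hr h1
    obtain ⟨g, hg⟩ := even_of_oneVertex hn hr h1
    have hsub : (conePoints n r).Subsingleton :=
      Set.subsingleton_singleton.anti (conePoints_subset hn hr h1)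
    have hcone : 1 < g → conePoints n r = {vertexPoint n r 0} := fun h =>
      conePoints_eq_singleton (by omega) hr h1
    have hempty : g = 1 → conePoints n r = ∅ := by
      intro h
      obtain rfl : n = 2 := by omega
      exact conePoints_eq_empty hr h1
    have hregular : ∀ u : ℂ, u ≠ 0 → singularPoints (lines n r u) ⊆ conePoints n r := by
      intro u hu x hx
      by_contra hxc
      exact hx (isRegularPoint_lines hsub hu hxc)
    refine ⟨isClosedOrientableSurface hn hr h1, g, by omega, ?_, hcone, hempty, fun u hu =>
      ⟨?_, fun h => ?_, fun h => ?_⟩⟩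
    · rw [eulerChar_eq hn hr h1, hg]
      push_cast
      ring
    · rw [Set.eq_univ_iff_forall]
      intro x
      by_cases hx : x ∈ conePoints n r
      · have hg1 : 1 < g := by
          by_contra hle
          rw [hempty (by omega)] at hx
          exact hx
        rw [hcone hg1] at hx
        obtain ⟨L, hL, _, _, _, hp⟩ := exists_lines_ne (by omega) hr h1 hu
        exact ⟨L, hL, hx ▸ hp.1⟩
      · obtain ⟨L, hL, hxL⟩ := exists_mem_lines hsub hu hx
        exact ⟨L, hL, hxL⟩
    · obtain ⟨L, hL, L', hL', hne, hp⟩ := exists_lines_ne (by omega) hr h1 hu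
      refine ⟨Set.Subset.antisymm ((hregular u hu).trans (hcone h).subset) ?_,
        L, hL, L', hL', hne, hp⟩
      rintro _ rfl ⟨φ, hpφ, -, huniq, -⟩
      -- A regular point lies on exactly one leaf, whereas `p` lies on two.
      exact hne ((huniq _ hpφ).unique ⟨hL, hp.1⟩ ⟨hL', hp.2⟩)
    · exact Set.subset_empty_iff.1 ((hregular u hu).trans (hempty h).subset)
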